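/- Let $\Delta$ be a polar space of rank $n\ge 2$ (points $X$; singular subspaces are projective spaces of dimension at most $n-1$ with at least three points on each line), not assumed embeddable, with associated Tits building $\Delta^b$. Call $\Delta$ hyperbolic if every singular subspace of dimension $n-2$ lies in exactly two maximal singular subspaces. If $\Delta$ is not hyperbolic, the elements of $\Delta^b$ are the nonempty singular subspaces, incidence is inclusion, and the type $t(U)$ of a singular subspace $U$ is its dimension. If $\Delta$ is hyperbolic, $\Delta^b$ is the building of the oriflamme complex: its elements are the nonempty singular subspaces of dimension different from $n-2$; incidence is inclusion, or, for two maximal singular subspaces, meeting in a subspace of dimension $n-2$; $t(U)=\dim U$ if $\dim U\le n-2$, while a maximal singular subspace has type $(n-1)'$ or $(n-1)''$ according to which of the two natural families it belongs to (two maximal singular subspaces are in the same family when the codimension of their intersection is even). The empty subspace has type $-1$. A flag is a set of pairwise incident elements, and a chamber is a maximal flag. The Weyl group of $\Delta^b$, with its canonical generators, is realised on the cross-polytope graph with $2n$ vertices: as its full automorphism group (type $\mathsf B_n$) if $\Delta$ is not hyperbolic, and as the subgroup preserving each of the two classes of maximal cliques (type $\mathsf D_n$) if $\Delta$ is hyperbolic.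 For elements $U,V$ of $\Delta^b$ the Weyl distance $\delta(U,V)$ is the element of minimal length among the Weyl distances $\delta(C,C')$, where $C$ is a chamber containing $U$ and $C'$ is a chamber containing $V$. For singular subspaces $U,V$ let $U^V$ be the singular subspace generated by $U$ and by the points of $V$ that are collinear with or equal to every point of $U$. Let $I,J,I',J'$ be elements of $\Delta^b$ such that neither $\{I,J\}$ nor $\{I',J'\}$ is a flag. Then the minimal length defining $\delta(I,J)$, respectively $\delta(I',J')$, is attained, and $$\delta(I,J)=\delta(I',J')\iff t(I)=t(I'),\ t(J)=t(J'),\ t(I\cap J)=t(I'\cap J')\ \text{and}\ t(I^J)=t(I'^{J'}).$$ In particular, for such a pair, $\delta(I,J)$ is determined by $i=t(I)$, $j=t(J)$, $k=t(I\cap J)$ and $\ell=t(I^J)$. -/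

import Mathlib

noncomputable section

/-! ### Projective spaces and polar spaces -/

/-- A set `P` of points together with a family `𝒮` of subsets of `P` is a (possibly empty, not
necessarily Desarguesian) projective space with `𝒮` as its family of subspaces: for some family
`𝓛` of lines the axioms of Veblen and Young hold, each line has at least three points, and `𝒮`
consists of the subsets of `P` that contain the line joining any two of their points. -/
def IsProjectiveSpace {X : Type*} (P : Set X) (𝒮 : Set (Set X)) : Prop :=
  ∃ 𝓛 : Set (Set X),
    (∀ L ∈ 𝓛, L ⊆ P ∧ 3 ≤ L.encard) ∧
    (∀ x ∈ P, ∀ y ∈ P, x ≠ y → ∃! L, L ∈ 𝓛 ∧ x ∈ L ∧ y ∈ L) ∧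
    (∀ a b c d : X, a ≠ b → c ≠ d → a ≠ c → b ≠ d →
      ∀ ab ∈ 𝓛, ∀ cd ∈ 𝓛, ∀ ac ∈ 𝓛, ∀ bd ∈ 𝓛,
        a ∈ ab → b ∈ ab → c ∈ cd → d ∈ cd → a ∈ ac → c ∈ ac → b ∈ bd → d ∈ bd →
          (ab ∩ cd).Nonempty → (ac ∩ bd).Nonempty) ∧
    𝒮 = {S | S ⊆ P ∧ ∀ L ∈ 𝓛, ∀ x ∈ S, ∀ y ∈ S, x ≠ y → x ∈ L → y ∈ L → L ⊆ S}

/-- The largest number of members of a chain of nonempty elements of `Ω` contained in `U`. For a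
subspace of a projective space this is the projective dimension plus one. -/
def projRank {X : Type*} (Ω : Set (Set X)) (U : Set X) : ℕ∞ :=
  Set.chainHeight {V | V ∈ Ω ∧ V.Nonempty ∧ V ⊆ U} (· ⊆ ·)

/-- The projective dimension; the empty set has dimension `-1`, points `0` and lines `1`. -/
def projDim {X : Type*} (Ω : Set (Set X)) (U : Set X) : ℤ :=
  ((projRank Ω U).toNat : ℤ) - 1

/-- A polar space of rank `n ≥ 2` with point set `X`, given by its family `Ω` of singular
subspaces. -/
structure PolarSpace (X : Type*) (n : ℕ) where
  /-- the singular subspaces -/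
  Ω : Set (Set X)
  two_le : 2 ≤ n
  /-- Each singular subspace, with the singular subspaces in it, is a projective space of
  dimension at most `n - 1`. -/
  ps1 : ∀ U ∈ Ω, IsProjectiveSpace U {V | V ∈ Ω ∧ V ⊆ U} ∧ projRank Ω U ≤ n
  /-- Intersections of singular subspaces are singular subspaces. -/
  ps2 : ∀ 𝒰 : Set (Set X), 𝒰 ⊆ Ω → 𝒰.Nonempty → ⋂₀ 𝒰 ∈ Ω
  /-- For `U` of dimension `n - 1` and a point `p` outside `U`, the lines through `p` that meet `U`
  fill a singular subspace of dimension `n - 1` meeting `U` in a hyperplane. -/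
  ps3 : ∀ U ∈ Ω, projDim Ω U = n - 1 → ∀ p, p ∉ U →
    ⋃₀ {L | L ∈ Ω ∧ projDim Ω L = 1 ∧ p ∈ L ∧ (L ∩ U).Nonempty} ∈ Ω ∧
    projDim Ω (⋃₀ {L | L ∈ Ω ∧ projDim Ω L = 1 ∧ p ∈ L ∧ (L ∩ U).Nonempty}) = n - 1 ∧
    projDim Ω (⋃₀ {L | L ∈ Ω ∧ projDim Ω L = 1 ∧ p ∈ L ∧ (L ∩ U).Nonempty} ∩ U) = n - 2
  /-- There are two disjoint singular subspaces of dimension `n - 1`. -/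
  ps4 : ∃ U ∈ Ω, ∃ V ∈ Ω, projDim Ω U = n - 1 ∧ projDim Ω V = n - 1 ∧ Disjoint U V

/-! ### The cross-polytope graph, its automorphisms and their word length -/

/-- The vertices of the cross-polytope: `(i, false)` is `ξ_{i+1}` and `(i, true)` is `ξ_{-(i+1)}`,
for `i = 0, …, n - 1`. -/
abbrev Vert (n : ℕ) : Type := Fin n × Bool

namespace Vert

/-- The antipode `ξ_{-i}` of `ξ_i`. -/
def opp {n : ℕ} (a : Vert n) : Vert n := (a.1, !a.2)

/-- The graph `Ξ`: two distinct vertices are adjacent unless they are antipodal, that is, `ξ_i` and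
`ξ_j` are adjacent when `|i| ≠ |j|`. -/
def Xi (n : ℕ) : SimpleGraph (Vert n) where
  Adj a b := a ≠ b ∧ b ≠ opp a
  symm := ⟨fun a b h => ⟨h.1.symm, fun e => h.2 (by subst e; simp [opp])⟩⟩
  loopless := ⟨fun _ h => h.1 rfl⟩

theorem Xi_adj {n : ℕ} (a b : Vert n) : (Xi n).Adj a b ↔ a.1 ≠ b.1 := by
  obtain ⟨i, x⟩ := a
  obtain ⟨j, y⟩ := b
  cases x <;> cases y <;> simp [Xi, opp, eq_comm]

/-- The automorphism of `Ξ` interchanging `ξ_i` with `ξ_j` and `ξ_{-i}` with `ξ_{-j}`. -/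
def transp {n : ℕ} (i j : Fin n) : Xi n ≃g Xi n where
  toEquiv := Equiv.prodCongr (Equiv.swap i j) (Equiv.refl Bool)
  map_rel_iff' := by
    intro a b
    simp [Xi_adj]

/-- The automorphism of `Ξ` interchanging `ξ_i` with `ξ_{-i}`. -/
def flip {n : ℕ} (i : Fin n) : Xi n ≃g Xi n where
  toFun a := if a.1 = i then opp a else a
  invFun a := if a.1 = i then opp a else a
  left_inv a := by
    obtain ⟨j, x⟩ := a
    by_cases h : j = i <;> simp [h, opp]
  right_inv a := by
    obtain ⟨j, x⟩ := a
    by_cases h : j = i <;> simp [h, opp]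
  map_rel_iff' := by
    intro a b
    by_cases h : a.1 = i <;> by_cases h' : b.1 = i <;> simp [h, h', Xi_adj, opp]

/-- The generators `s_1, …, s_n` of the Coxeter group of type `B_n`. -/
def gensB (n : ℕ) : Set (Xi n ≃g Xi n) :=
  {s | (∃ i j : Fin n, (i : ℕ) + 1 = j ∧ s = transp i j) ∨
    ∃ j : Fin n, (j : ℕ) + 1 = n ∧ s = flip j}

/-- The generators `s_1, …, s_{n-1}, s_n' = s_n s_{n-1} s_n` of the Coxeter group of type `D_n`. -/
def gensD (n : ℕ) : Set (Xi n ≃g Xi n) :=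
  {s | (∃ i j : Fin n, (i : ℕ) + 1 = j ∧ s = transp i j) ∨
    ∃ i j : Fin n, (i : ℕ) + 1 = j ∧ (j : ℕ) + 1 = n ∧ s = flip j * transp i j * flip j}

/-- The two classes of maximal cliques of `Ξ`: two of them are in the same class when the size of
their intersection has the same parity as `n`. -/
def SameClass {n : ℕ} (K K' : Set (Vert n)) : Prop :=
  (K ∩ K').ncard % 2 = n % 2

/-- `w` maps each of the two classes of maximal cliques of `Ξ` to itself. -/
def PreservesClasses {n : ℕ} (w : Xi n ≃g Xi n) : Prop :=
  ∀ K : Set (Vert n), Maximal (Xi n).IsClique K → SameClass K (w '' K)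

/-- `{ξ_1, …, ξ_m}` -/
def initial (n m : ℕ) : Set (Vert n) := {a | (a.1 : ℕ) < m ∧ a.2 = false}

/-- `{ξ_1, …, ξ_{n-1}, ξ_{-n}}` -/
def twisted (n : ℕ) : Set (Vert n) := {a | a.2 = true ↔ (a.1 : ℕ) + 1 = n}

/-- The standard chamber of type `B_n`. -/
def stdChamberB (n : ℕ) : Set (Set (Vert n)) :=
  {K | ∃ m : ℕ, 1 ≤ m ∧ m ≤ n ∧ K = initial n m}

/-- The standard chamber of type `D_n`. -/
def stdChamberD (n : ℕ) : Set (Set (Vert n)) :=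
  {K | (∃ m : ℕ, 1 ≤ m ∧ m + 2 ≤ n ∧ K = initial n m) ∨ K = initial n n ∨ K = twisted n}

end Vert

/-- The length of `w` with respect to the set `S` of generators (`⊤` if `w` is not a product of
elements of `S`). -/
def wordLength {G : Type*} [Group G] (S : Set G) (w : G) : ℕ∞ :=
  ⨅ l : {l : List G // (∀ s ∈ l, s ∈ S) ∧ l.prod = w}, (l.1.length : ℕ∞)

/-- The values of the type function. In the hyperbolic case `dim (n - 2)` is the abbreviation for
the type `{(n-1)', (n-1)''}` of a flag; `dim (-1)` is the type of the empty subspace. -/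
inductive BuildingType : Type
  | dim (d : ℤ)
  | prime
  | doublePrime

namespace PolarSpace

variable {X : Type*} {n : ℕ} (Δ : PolarSpace X n)

/-! ### Collinearity, projections, types, flags -/

/-- The dimension of a singular subspace. -/
def dim (U : Set X) : ℤ := projDim Δ.Ω U

/-- The maximal singular subspaces. -/
def IsMSS (U : Set X) : Prop := U ∈ Δ.Ω ∧ Δ.dim U = n - 1

/-- `x^⊥`: the points equal to `x` or on a common line with `x`. -/
def perpPt (x : X) : Set X :=
  {y | y = x ∨ ∃ L ∈ Δ.Ω, Δ.dim L = 1 ∧ x ∈ L ∧ y ∈ L}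

/-- `U^⊥` -/
def perp (U : Set X) : Set X := ⋂ x ∈ U, Δ.perpPt x

/-- The smallest singular subspace containing `S`. -/
def span (S : Set X) : Set X := ⋂₀ {V | V ∈ Δ.Ω ∧ S ⊆ V}

/-- The projection `proj_V(U) = V ∩ U^⊥`. -/
def proj (V U : Set X) : Set X := V ∩ Δ.perp U

/-- `U^V`, the singular subspace spanned by `U` and `proj_V(U)`. -/
def up (U V : Set X) : Set X := Δ.span (U ∪ Δ.proj V U)

/-- `Δ` is hyperbolic: each singular subspace of dimension `n - 2` lies in exactly two maximal
singular subspaces. -/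
def IsHyperbolic : Prop :=
  ∀ V ∈ Δ.Ω, Δ.dim V = n - 2 → {M | Δ.IsMSS M ∧ V ⊆ M}.encard = 2

/-- Two maximal singular subspaces of a hyperbolic polar space are in the same natural family when
the codimension of their intersection is even. -/
def SameFamily (U V : Set X) : Prop := Even ((n : ℤ) - 1 - Δ.dim (U ∩ V))

open Classical in
/-- The type of a singular subspace. In the hyperbolic case `(n-1)'` denotes the family of the
maximal singular subspace `M₀`, and `(n-1)''` the other family; otherwise `M₀` plays no role. -/
def type (M₀ U : Set X) : BuildingType :=
  if Δ.IsHyperbolic ∧ Δ.dim U = n - 1 then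
    if Δ.SameFamily M₀ U then .prime else .doublePrime
  else .dim (Δ.dim U)

/-- The elements of the building: the nonempty singular subspaces, except, in the hyperbolic case,
those of dimension `n - 2`. -/
def IsElement (U : Set X) : Prop :=
  U ∈ Δ.Ω ∧ U.Nonempty ∧ (Δ.IsHyperbolic → Δ.dim U ≠ n - 2)

/-- Incidence of elements of the building: inclusion, or, in the hyperbolic case, being maximal
singular subspaces that meet in dimension `n - 2`. -/
def Incident (U V : Set X) : Prop :=
  U ⊆ V ∨ V ⊆ U ∨ (Δ.IsHyperbolic ∧ Δ.IsMSS U ∧ Δ.IsMSS V ∧ Δ.dim (U ∩ V) = n - 2)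

/-- A flag: a set of pairwise incident elements. -/
def IsFlag (F : Set (Set X)) : Prop :=
  (∀ U ∈ F, Δ.IsElement U) ∧ ∀ U ∈ F, ∀ V ∈ F, Δ.Incident U V

/-- A chamber: a maximal flag. In the non-hyperbolic case it is a maximal chain of nonempty singular
subspaces; in the hyperbolic case it consists of nested subspaces of dimensions `0, …, n - 3` and
two maximal singular subspaces meeting in a subspace of dimension `n - 2` that contains them. -/
def IsChamber (C : Set (Set X)) : Prop := Maximal Δ.IsFlag C

/-! ### Weyl distance -/

/-- A numbered frame: `2n` points `f ξ_i` such that `f ξ_{-i}` is the only one of them opposite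
(i.e. different from and not collinear with) `f ξ_i`. -/
def IsFrame (f : Vert n → X) : Prop :=
  ∀ a b, f b ∉ Δ.perpPt (f a) ↔ b = a.opp

/-- The set of singular subspaces spanned by the images of the members of `c` under a numbered
frame `f`. -/
def realize (f : Vert n → X) (c : Set (Set (Vert n))) : Set (Set X) :=
  (fun K => Δ.span (f '' K)) '' c

open Classical in
/-- The standard chamber of `Ξ`, for the Coxeter type of the building of `Δ`. -/
def stdChamber : Set (Set (Vert n)) :=
  if Δ.IsHyperbolic then Vert.stdChamberD n else Vert.stdChamberB n

open Classical in
/-- The canonical generators of the Weyl group of the building of `Δ`. -/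
def gens : Set (Vert.Xi n ≃g Vert.Xi n) :=
  if Δ.IsHyperbolic then Vert.gensD n else Vert.gensB n

/-- The automorphism `w` of `Ξ` is the Weyl distance from the chamber `C` to the chamber `C'`: there
is an apartment with a numbered frame that identifies `C` with the standard chamber and `C'` with
the image of the standard chamber under `w`. In the hyperbolic case `w` has to preserve the two
classes of maximal cliques of `Ξ`, and the numbering is such that the generator `s_{n-1}`, which
moves `{ξ_1, …, ξ_{n-1}, ξ_{-n}}` only, belongs to the type `(n-1)'`. -/
def IsChamberDistance (M₀ : Set X) (C C' : Set (Set X)) (w : Vert.Xi n ≃g Vert.Xi n) : Prop :=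
  ∃ f : Vert n → X, Δ.IsFrame f ∧
    C = Δ.realize f Δ.stdChamber ∧
    C' = Δ.realize f ((fun K => w '' K) '' Δ.stdChamber) ∧
    (Δ.IsHyperbolic → Vert.PreservesClasses w ∧
      Δ.type M₀ (Δ.span (f '' Vert.twisted n)) = .prime)

/-- The set of Weyl distances from a chamber containing `U` to a chamber containing `V`. -/
def distances (M₀ U V : Set X) : Set (Vert.Xi n ≃g Vert.Xi n) :=
  {w | ∃ C C', Δ.IsChamber C ∧ Δ.IsChamber C' ∧ U ∈ C ∧ V ∈ C' ∧ Δ.IsChamberDistance M₀ C C' w}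

/-- `w` is an element of minimal length among the Weyl distances from a chamber containing `U` to a
chamber containing `V`. -/
def IsWeylDistance (M₀ U V : Set X) (w : Vert.Xi n ≃g Vert.Xi n) : Prop :=
  w ∈ Δ.distances M₀ U V ∧
    ∀ w' ∈ Δ.distances M₀ U V, wordLength Δ.gens w ≤ wordLength Δ.gens w'

open Classical in
/-- The Weyl distance `δ(U, V)`: the element of minimal length among the Weyl distances from a
chamber containing `U` to a chamber containing `V`. -/
def weylDistance (M₀ U V : Set X) : Vert.Xi n ≃g Vert.Xi n :=
  if h : ∃ w, Δ.IsWeylDistance M₀ U V w then h.choose else 1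

end PolarSpace

end

/-!
The Weyl distance of two elements is computed in an apartment, that is, a frame of `n` hyperbolic
pairs, all of whose cliques span singular subspaces.

The geometric half of the proof shows that any two singular subspaces `I` and `J` are spanned by
cliques `A` and `B` of one frame (`exists_frame`). The frame is built by adding hyperbolic pairs one
at a time: a point of `I` is paired with a point of `J` not collinear with it, or, if there is none,
with a point collinear with all that remains of `J` and with the frame so far
(`exists_hyperbolic_partner`). The partner comes from a maximal singular subspace disjoint from a
given one (`exists_disjoint_mss_ge`) and from the fact that every dimension of `U` costs `A ∩ U^⊥`
at most one dimension (`rk_proj_le`). In a frame, intersections and the operation `up` can be read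
off from the cliques (`span_clique_inter`, `up_span_clique`), so the dimensions in the theorem are
the cardinalities of `A`, `B`, `A ∩ B` and of `A` together with the vertices of `B` not antipodal
to `A`.

In the combinatorial half, the automorphism group of the cross-polytope is transitive on pairs of
cliques with these four cardinalities given (`exists_aut`). In the hyperbolic case two maximal
singular subspaces of a frame are in the same family exactly if their cliques have the same parity
(`sameFamily_span_sec`), because the dimensions in which a maximal singular subspace meets two
adjacent ones differ by one (`rk_inter_adjacent`). The type of `up I J`, if this is maximal, then
forces the automorphism to respect the families, and if it is not maximal, a coordinate is free for
a sign change. Hence the four types determine the set of Weyl distances between chambers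
containing `I` and `J` (`distances_subset`), and with it the Weyl distance.

Conversely, let `w` be of minimal length for `I` and `J`, where `I` corresponds to the member `K` of
the standard chamber. A generator fixing `K` does not shorten `w` from the left. Every generator
fixes all but one member of the standard chamber, and some generator shortens `w`, as `w ≠ 1` for a
pair that is not a flag. So `w` determines `K`, and from the right in the same way the member
belonging to `J` (`Realizes.eq_of_minimal`); together with `w` they determine the four types
(`Realizes.sameTypes`).
-/

noncomputable section

namespace PolarSpace

variable {X : Type*} {n : ℕ} (Δ : PolarSpace X n)

/-- The projective dimension plus one. -/
def rk (U : Set X) : ℕ := (projRank Δ.Ω U).toNat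

/-- The line joining two collinear points. -/
def ln (x y : X) : Set X := Δ.span {x, y}

/-- Two points are collinear or equal: some singular subspace contains both. -/
def Col (x y : X) : Prop := ∃ U ∈ Δ.Ω, x ∈ U ∧ y ∈ U

variable {Δ}

/-! ### Lines and subspaces of a singular subspace -/

theorem dim_eq (U : Set X) : Δ.dim U = Δ.rk U - 1 := rfl

theorem Col.symm {x y : X} (h : Δ.Col x y) : Δ.Col y x := by
  obtain ⟨U, hU, hx, hy⟩ := h
  exact ⟨U, hU, hy, hx⟩

theorem inter_mem {U V : Set X} (hU : U ∈ Δ.Ω) (hV : V ∈ Δ.Ω) : U ∩ V ∈ Δ.Ω := by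
  have := Δ.ps2 {U, V} (by rintro W (rfl | rfl) <;> assumption) ⟨U, by simp⟩
  simpa using this

theorem subset_span (S : Set X) : S ⊆ Δ.span S := fun _ hx _ hV => hV.2 hx

theorem span_subset {S V : Set X} (hV : V ∈ Δ.Ω) (h : S ⊆ V) : Δ.span S ⊆ V :=
  Set.sInter_subset_of_mem ⟨hV, h⟩

theorem span_mem {S V : Set X} (hV : V ∈ Δ.Ω) (h : S ⊆ V) : Δ.span S ∈ Δ.Ω :=
  Δ.ps2 _ (fun _ hW => hW.1) ⟨V, hV, h⟩

theorem span_mono {S T : Set X} (h : S ⊆ T) : Δ.span S ⊆ Δ.span T :=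
  fun _ hx V hV => hx V ⟨hV.1, h.trans hV.2⟩

theorem span_self {S : Set X} (h : S ∈ Δ.Ω) : Δ.span S = S :=
  (span_subset h subset_rfl).antisymm (subset_span S)

theorem left_mem_ln (x y : X) : x ∈ Δ.ln x y := subset_span _ (by simp)

theorem right_mem_ln (x y : X) : y ∈ Δ.ln x y := subset_span _ (by simp)

theorem ln_comm (x y : X) : Δ.ln x y = Δ.ln y x := by
  unfold ln; rw [Set.pair_comm]

theorem ln_subset {x y : X} {V : Set X} (hV : V ∈ Δ.Ω) (hx : x ∈ V) (hy : y ∈ V) :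
    Δ.ln x y ⊆ V :=
  span_subset hV (by rintro z (rfl | rfl) <;> assumption)

theorem Col.ln_mem {x y : X} (h : Δ.Col x y) : Δ.ln x y ∈ Δ.Ω := by
  obtain ⟨U, hU, hx, hy⟩ := h
  exact span_mem hU (by rintro z (rfl | rfl) <;> assumption)

/-- The lines that a family of lines as in the axioms of Veblen and Young provides are the spans of
pairs of points. -/
theorem line_eq_ln {U : Set X} (hU : U ∈ Δ.Ω) {𝓛 : Set (Set X)}
    (h1 : ∀ L ∈ 𝓛, L ⊆ U ∧ 3 ≤ L.encard)
    (h2 : ∀ x ∈ U, ∀ y ∈ U, x ≠ y → ∃! L, L ∈ 𝓛 ∧ x ∈ L ∧ y ∈ L)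
    (h4 : {V | V ∈ Δ.Ω ∧ V ⊆ U} =
      {S | S ⊆ U ∧ ∀ L ∈ 𝓛, ∀ x ∈ S, ∀ y ∈ S, x ≠ y → x ∈ L → y ∈ L → L ⊆ S})
    {L : Set X} (hL : L ∈ 𝓛) {x y : X} (hx : x ∈ L) (hy : y ∈ L) (hxy : x ≠ y) :
    L = Δ.ln x y := by
  have hLU := (h1 L hL).1
  have hLΩ : L ∈ {V | V ∈ Δ.Ω ∧ V ⊆ U} := by
    rw [h4]
    refine ⟨hLU, fun L' hL' a ha b hb hab ha' hb' => ?_⟩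
    rw [(h2 a (hLU ha) b (hLU hb) hab).unique ⟨hL', ha', hb'⟩ ⟨hL, ha, hb⟩]
  refine Set.Subset.antisymm ?_ (ln_subset hLΩ.1 hx hy)
  rintro z hz V ⟨hV, hxyV⟩
  have hVU : V ∩ U ∈ {V | V ∈ Δ.Ω ∧ V ⊆ U} := ⟨inter_mem hV hU, Set.inter_subset_right⟩
  rw [h4] at hVU
  exact (hVU.2 L hL x ⟨hxyV (by simp), hLU hx⟩ y ⟨hxyV (by simp), hLU hy⟩ hxy hx hy hz).1

theorem ln_eq_of_mem {x y a b : X} (h : Δ.Col x y) (hxy : x ≠ y) (ha : a ∈ Δ.ln x y)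
    (hb : b ∈ Δ.ln x y) (hab : a ≠ b) : Δ.ln a b = Δ.ln x y := by
  obtain ⟨U, hU, hx, hy⟩ := h
  obtain ⟨⟨𝓛, h1, h2, h3, h4⟩, -⟩ := Δ.ps1 U hU
  obtain ⟨L, ⟨hL, hxL, hyL⟩, -⟩ := h2 x hx y hy hxy
  have e := line_eq_ln hU h1 h2 h4 hL hxL hyL hxy
  rw [← e] at ha hb ⊢
  exact (line_eq_ln hU h1 h2 h4 hL ha hb hab).symm

/-- The axiom of Veblen and Young, for the lines in a singular subspace. -/
theorem veblen {U : Set X} (hU : U ∈ Δ.Ω) {a b c d p : X} (ha : a ∈ U) (hb : b ∈ U) (hc : c ∈ U)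
    (hd : d ∈ U) (hab : a ≠ b) (hcd : c ≠ d) (hac : a ≠ c) (hbd : b ≠ d)
    (hp : p ∈ Δ.ln a b) (hp' : p ∈ Δ.ln c d) : (Δ.ln a c ∩ Δ.ln b d).Nonempty := by
  obtain ⟨⟨𝓛, h1, h2, h3, h4⟩, -⟩ := Δ.ps1 U hU
  have key : ∀ x ∈ U, ∀ y ∈ U, x ≠ y → Δ.ln x y ∈ 𝓛 := by
    intro x hx y hy hxy
    obtain ⟨L, ⟨hL, hxL, hyL⟩, -⟩ := h2 x hx y hy hxy
    rwa [← line_eq_ln hU h1 h2 h4 hL hxL hyL hxy]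
  exact h3 a b c d hab hcd hac hbd _ (key a ha b hb hab) _ (key c hc d hd hcd)
    _ (key a ha c hc hac) _ (key b hb d hd hbd) (left_mem_ln _ _) (right_mem_ln _ _)
    (left_mem_ln _ _) (right_mem_ln _ _) (left_mem_ln _ _) (right_mem_ln _ _)
    (left_mem_ln _ _) (right_mem_ln _ _) ⟨p, hp, hp'⟩

theorem mem_of_ln_subset {U S : Set X} (hU : U ∈ Δ.Ω) (hS : S ⊆ U)
    (h : ∀ x ∈ S, ∀ y ∈ S, x ≠ y → Δ.ln x y ⊆ S) : S ∈ Δ.Ω := by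
  obtain ⟨⟨𝓛, h1, h2, h3, h4⟩, -⟩ := Δ.ps1 U hU
  have : S ∈ {V | V ∈ Δ.Ω ∧ V ⊆ U} := by
    rw [h4]
    refine ⟨hS, fun L hL x hx y hy hxy hxL hyL => ?_⟩
    rw [line_eq_ln hU h1 h2 h4 hL hxL hyL hxy]
    exact h x hx y hy hxy
  exact this.1

theorem singleton_mem {U : Set X} (hU : U ∈ Δ.Ω) {x : X} (hx : x ∈ U) : {x} ∈ Δ.Ω :=
  mem_of_ln_subset hU (by simpa using hx) (by
    rintro a rfl b rfl h
    exact absurd rfl h)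

theorem ln_exchange {x y z : X} (h : Δ.Col x y) (hxy : x ≠ y) (hz : z ∈ Δ.ln x y) (hzx : z ≠ x) :
    y ∈ Δ.ln x z := by
  rw [ln_eq_of_mem h hxy (left_mem_ln x y) hz hzx.symm]
  exact right_mem_ln _ _

/-- The case of `mem_span_insert` in which the line through `x` and `y` meets `S`. -/
theorem cone_aux {U S : Set X} (hU : U ∈ Δ.Ω) (hS : S ∈ Δ.Ω) (hSU : S ⊆ U) {p x y r z s : X}
    (hp : p ∈ U) (hpS : p ∉ S) (hs : s ∈ S) (hx : x ∈ Δ.ln p s) (hy : y ∈ U) (hxy : x ≠ y)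
    (hr : r ∈ S) (hrl : r ∈ Δ.ln x y) (hrx : r ≠ x) (hz : z ∈ Δ.ln x y) :
    z = p ∨ ∃ s ∈ S, z ∈ Δ.ln p s := by
  have hxU : x ∈ U := ln_subset hU hp (hSU hs) hx
  have hzU : z ∈ U := ln_subset hU hxU hy hz
  have hps : p ≠ s := fun e => hpS (e ▸ hs)
  have hxr : Δ.ln x r = Δ.ln x y := ln_eq_of_mem ⟨U, hU, hxU, hy⟩ hxy (left_mem_ln _ _) hrl hrx.symm
  by_cases hzp : z = p
  · exact .inl hzp
  right
  by_cases hxS : x ∈ S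
  · refine ⟨z, ?_, right_mem_ln _ _⟩
    rw [← hxr] at hz
    exact ln_subset hS hxS hr hz
  by_cases hxp : x = p
  · subst hxp
    exact ⟨r, hr, hxr ▸ hz⟩
  by_cases hzr : z = r
  · subst hzr
    exact ⟨z, hr, right_mem_ln _ _⟩
  by_cases hsr : s = r
  · subst hsr
    refine ⟨s, hs, ?_⟩
    rw [← hxr] at hz
    exact ln_subset (Col.ln_mem ⟨U, hU, hp, hSU hs⟩) hx (right_mem_ln _ _) hz
  have hxs : x ∈ Δ.ln s p := by rwa [ln_comm]
  have hxz : x ∈ Δ.ln r z := by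
    rw [ln_eq_of_mem ⟨U, hU, hxU, hy⟩ hxy hrl hz (Ne.symm hzr)]
    exact left_mem_ln _ _
  obtain ⟨q, hq1, hq2⟩ := veblen hU (hSU hs) hp (hSU hr) hzU hps.symm (Ne.symm hzr) hsr
    (Ne.symm hzp) hxs hxz
  have hqS : q ∈ S := ln_subset hS hs hr hq1
  exact ⟨q, hqS, ln_exchange ⟨U, hU, hp, hzU⟩ (Ne.symm hzp) hq2 (fun e => hpS (e ▸ hqS))⟩

/-- The span of a point `p` and a subspace `S` is the union of the lines that join `p` to the
points of `S`. -/
theorem mem_span_insert {U S : Set X} (hU : U ∈ Δ.Ω) (hS : S ∈ Δ.Ω) (hSU : S ⊆ U) {p x : X}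
    (hp : p ∈ U) (hpS : p ∉ S) (hx : x ∈ Δ.span (insert p S)) :
    x = p ∨ ∃ s ∈ S, x ∈ Δ.ln p s := by
  have hT : {x | x = p ∨ ∃ s ∈ S, x ∈ Δ.ln p s} ∈ Δ.Ω := by
    refine mem_of_ln_subset hU ?_ ?_
    · rintro x (rfl | ⟨s, hs, hx⟩)
      · exact hp
      · exact ln_subset hU hp (hSU hs) hx
    intro x hx y hy hxy z hz
    rcases hx with rfl | ⟨s, hs, hx⟩
    · rcases hy with rfl | ⟨t, ht, hy⟩
      · exact absurd rfl hxy
      · exact .inr ⟨t, ht, ln_subset (Col.ln_mem ⟨U, hU, hp, hSU ht⟩) (left_mem_ln _ _) hy hz⟩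
    rcases hy with rfl | ⟨t, ht, hy⟩
    · exact .inr ⟨s, hs, ln_subset (Col.ln_mem ⟨U, hU, hp, hSU hs⟩) hx (left_mem_ln _ _) hz⟩
    have hxU : x ∈ U := ln_subset hU hp (hSU hs) hx
    have hyU : y ∈ U := ln_subset hU hp (hSU ht) hy
    by_cases hxS : x ∈ S
    · exact cone_aux hU hS hSU hp hpS ht hy hxU hxy.symm hxS (right_mem_ln _ _) hxy
        (ln_comm x y ▸ hz)
    by_cases hyS : y ∈ S
    · exact cone_aux hU hS hSU hp hpS hs hx hyU hxy hyS (right_mem_ln _ _) hxy.symm hz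
    by_cases hst : s = t
    · subst hst
      exact .inr ⟨s, hs, ln_subset (Col.ln_mem ⟨U, hU, hp, hSU hs⟩) hx hy hz⟩
    by_cases hxp : x = p
    · subst hxp
      exact .inr ⟨t, ht, ln_subset (Col.ln_mem ⟨U, hU, hp, hSU ht⟩) (left_mem_ln _ _) hy hz⟩
    by_cases hyp : y = p
    · subst hyp
      exact .inr ⟨s, hs, ln_subset (Col.ln_mem ⟨U, hU, hp, hSU hs⟩) hx (left_mem_ln _ _) hz⟩
    have hpx : p ∈ Δ.ln s x := by
      refine ln_exchange ⟨U, hU, hSU hs, hp⟩ (fun e => hpS (e ▸ hs)) (ln_comm p s ▸ hx) ?_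
      rintro rfl; exact hxS hs
    have hpy : p ∈ Δ.ln t y := by
      refine ln_exchange ⟨U, hU, hSU ht, hp⟩ (fun e => hpS (e ▸ ht)) (ln_comm p t ▸ hy) ?_
      rintro rfl; exact hyS ht
    obtain ⟨r, hr1, hr2⟩ := veblen hU (hSU hs) hxU (hSU ht) hyU (fun e => hxS (e ▸ hs))
      (fun e => hyS (e ▸ ht)) hst hxy hpx hpy
    have hrS : r ∈ S := ln_subset hS hs ht hr1
    exact cone_aux hU hS hSU hp hpS hs hx hyU hxy hrS hr2 (fun e => hxS (e ▸ hrS)) hz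
  refine span_subset hT ?_ hx
  rintro z (rfl | hz)
  · exact .inl rfl
  · exact .inr ⟨z, hz, right_mem_ln _ _⟩

theorem span_insert_exchange {U S : Set X} (hU : U ∈ Δ.Ω) (hS : S ∈ Δ.Ω) (hSU : S ⊆ U) {p x : X}
    (hp : p ∈ U) (hpS : p ∉ S) (hx : x ∈ Δ.span (insert p S)) (hxS : x ∉ S) :
    p ∈ Δ.span (insert x S) := by
  rcases mem_span_insert hU hS hSU hp hpS hx with rfl | ⟨s, hs, h⟩
  · exact subset_span _ (by simp)
  · have h1 : p ∈ Δ.ln s x := by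
      refine ln_exchange ⟨U, hU, hSU hs, hp⟩ (fun e => hpS (e ▸ hs)) (ln_comm p s ▸ h) ?_
      rintro rfl; exact hxS hs
    refine span_mono ?_ h1
    rintro z (rfl | rfl) <;> simp [hs]

/-- A subspace `S` that spans the whole of `T` together with some point of `T` meets each line
of `T`. -/
theorem exists_mem_ln_of_span {T S : Set X} (hT : T ∈ Δ.Ω) (hS : S ∈ Δ.Ω) (hST : S ⊆ T)
    {p : X} (hp : p ∈ T) (hpS : p ∉ S) (hpT : T ⊆ Δ.span (insert p S)) {x y : X}
    (hx : x ∈ T) (hy : y ∈ T) (hxy : x ≠ y) : ∃ s ∈ S, s ∈ Δ.ln x y := by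
  by_cases hyS : y ∈ S
  · exact ⟨y, hyS, right_mem_ln _ _⟩
  by_cases hxS : x ∈ S
  · exact ⟨x, hxS, left_mem_ln _ _⟩
  have h1 : y ∈ Δ.span (insert x S) := by
    have := span_insert_exchange hT hS hST hp hpS (hpT hx) hxS
    have h2 : Δ.span (insert p S) ⊆ Δ.span (insert x S) := by
      refine span_subset (span_mem hT ?_) ?_
      · rintro z (rfl | hz)
        · exact hx
        · exact hST hz
      · rintro z (rfl | hz)
        · exact this
        · exact subset_span _ (.inr hz)
    exact h2 (hpT hy)
  rcases mem_span_insert hT hS hST hx hxS h1 with rfl | ⟨s, hs, h⟩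
  · exact absurd rfl hxy
  · exact ⟨s, hs, ln_exchange ⟨T, hT, hx, hST hs⟩ (fun e => hxS (e ▸ hs)) h hxy.symm⟩

/-! ### Rank -/

theorem coe_rk {U : Set X} (hU : U ∈ Δ.Ω) : (Δ.rk U : ℕ∞) = projRank Δ.Ω U := by
  unfold rk
  refine ENat.natCast_toNat fun h => ?_
  have := (Δ.ps1 U hU).2
  rw [h] at this
  exact absurd this (by simp)

theorem rk_le {U : Set X} (hU : U ∈ Δ.Ω) : Δ.rk U ≤ n := by
  have := (Δ.ps1 U hU).2
  rw [← coe_rk hU] at this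
  exact_mod_cast this

theorem rk_lt {S T : Set X} (hS : S ∈ Δ.Ω) (hT : T ∈ Δ.Ω) (hST : S ⊆ T) {p : X} (hp : p ∈ T)
    (hpS : p ∉ S) : Δ.rk S < Δ.rk T := by
  have hfin : projRank Δ.Ω S ≠ ⊤ := by rw [← coe_rk hS]; simp
  obtain ⟨c, hc, hcard, hchain⟩ := Set.exists_eq_chainHeight_of_chainHeight_ne_top _ _ hfin
  have hTc : T ∉ c := fun h => hpS ((hc h).2.2 hp)
  have h1 : (insert T c).encard ≤ projRank Δ.Ω T := by
    refine Set.encard_le_chainHeight_of_isChain _ _ ?_ (hchain.insert ?_)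
    · rintro V (rfl | hV)
      · exact ⟨hT, ⟨p, hp⟩, subset_rfl⟩
      · exact ⟨(hc hV).1, (hc hV).2.1, (hc hV).2.2.trans hST⟩
    · intro V hV _
      exact .inr ((hc hV).2.2.trans hST)
  rw [Set.encard_insert_of_notMem hTc, hcard, ← coe_rk hT] at h1
  change projRank Δ.Ω S + 1 ≤ _ at h1
  rw [← coe_rk hS] at h1
  exact_mod_cast h1

theorem rk_mono {S T : Set X} (hS : S ∈ Δ.Ω) (hT : T ∈ Δ.Ω) (hST : S ⊆ T) :
    Δ.rk S ≤ Δ.rk T := by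
  by_cases h : T ⊆ S
  · rw [hST.antisymm h]
  · obtain ⟨p, hp, hpS⟩ := Set.not_subset.1 h
    exact (rk_lt hS hT hST hp hpS).le

theorem eq_of_rk_le {S T : Set X} (hS : S ∈ Δ.Ω) (hT : T ∈ Δ.Ω) (hST : S ⊆ T)
    (h : Δ.rk T ≤ Δ.rk S) : S = T := by
  refine hST.antisymm fun p hp => ?_
  by_contra hpS
  exact absurd (rk_lt hS hT hST hp hpS) (by omega)

theorem empty_mem : (∅ : Set X) ∈ Δ.Ω := by
  obtain ⟨U, hU, V, hV, -, -, h⟩ := Δ.ps4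
  have := inter_mem hU hV
  rwa [Set.disjoint_iff_inter_eq_empty.1 h] at this

theorem rk_empty : Δ.rk (∅ : Set X) = 0 := by
  have : projRank Δ.Ω ∅ = 0 := by
    unfold projRank
    rw [Set.chainHeight_eq_zero_iff]
    ext V
    simp only [Set.mem_ofPred_eq, Set.mem_empty_iff_false, iff_false, not_and]
    rintro - ⟨x, hx⟩ h
    exact h hx
  simp [rk, this]

theorem rk_pos {U : Set X} (hU : U ∈ Δ.Ω) {x : X} (hx : x ∈ U) : 0 < Δ.rk U := by
  have := rk_lt empty_mem hU (Set.empty_subset _) hx (Set.notMem_empty _)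
  omega

theorem eq_empty_of_rk {U : Set X} (hU : U ∈ Δ.Ω) (h : Δ.rk U = 0) : U = ∅ := by
  by_contra hne
  obtain ⟨x, hx⟩ := Set.nonempty_iff_ne_empty.2 hne
  have := rk_pos hU hx
  omega

theorem nonempty_of_rk {U : Set X} (h : 0 < Δ.rk U) : U.Nonempty := by
  by_contra hne
  rw [Set.not_nonempty_iff_eq_empty.1 hne, rk_empty] at h
  omega

/-- A subspace meeting every line of `T` has at most one dimension less: intersecting the members
of a chain in `T` with `S` merges at most two of them. -/
theorem rk_le_of_meets_lines {T S : Set X} (hT : T ∈ Δ.Ω) (hS : S ∈ Δ.Ω)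
    (h : ∀ x ∈ T, ∀ y ∈ T, x ≠ y → ∃ s ∈ S, s ∈ Δ.ln x y) : Δ.rk T ≤ Δ.rk S + 1 := by
  classical
  have hfin : projRank Δ.Ω T ≠ ⊤ := by rw [← coe_rk hT]; simp
  obtain ⟨c, hc, hcard, hchain⟩ := Set.exists_eq_chainHeight_of_chainHeight_ne_top _ _ hfin
  -- the members of the chain outside `S` are determined by their intersection with `S`
  have inj : ∀ V ∈ c, ∀ W ∈ c, ¬ V ⊆ S → V ⊆ W → V ∩ S = W ∩ S → V = W := by
    intro V hV W hW hVS hVW e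
    obtain ⟨v, hv, hvS⟩ := Set.not_subset.1 hVS
    refine hVW.antisymm fun w hw => ?_
    by_contra hwV
    have hvw : v ≠ w := fun e => hwV (e ▸ hv)
    obtain ⟨s, hs, hsl⟩ := h v ((hc hV).2.2 hv) w ((hc hW).2.2 hw) hvw
    have hsW : s ∈ W := ln_subset (hc hW).1 (hVW hv) hw hsl
    have hsV : s ∈ V := by
      have : s ∈ W ∩ S := ⟨hsW, hs⟩
      rw [← e] at this
      exact this.1
    refine hwV (ln_subset (hc hV).1 hv hsV ?_)
    refine ln_exchange ⟨W, (hc hW).1, hVW hv, hw⟩ hvw hsl ?_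
    rintro rfl
    exact hvS hs
  by_cases hall : ∀ V ∈ c, V ⊆ S
  · have h1 : c.encard ≤ projRank Δ.Ω S :=
      Set.encard_le_chainHeight_of_isChain _ _ (fun V hV => ⟨(hc hV).1, (hc hV).2.1, hall V hV⟩)
        hchain
    rw [hcard, ← coe_rk hS] at h1
    change projRank Δ.Ω T ≤ _ at h1
    rw [← coe_rk hT] at h1
    have : Δ.rk T ≤ Δ.rk S := by exact_mod_cast h1
    omega
  push Not at hall
  obtain ⟨V₁, hV₁, hV₁S⟩ := hall
  have hcfin : c.Finite := Set.finite_of_encard_le_coe (k := Δ.rk T)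
    (by rw [hcard, coe_rk hT]; exact le_rfl)
  -- the least member of the chain outside `S`
  obtain ⟨V₀, ⟨hV₀, hV₀S⟩, hmin⟩ :=
    (hcfin.subset (Set.sep_subset c fun V => ¬ V ⊆ S)).exists_minimal ⟨V₁, hV₁, hV₁S⟩
  have hle : ∀ V ∈ c, ¬ V ⊆ S → V₀ ⊆ V := by
    intro V hV hVS
    rcases hchain.total hV hV₀ with h | h
    · exact hmin ⟨hV, hVS⟩ h
    · exact h
  -- after the removal of `V₀`, intersecting with `S` is injective on the chain
  have himg : ((fun V => V ∩ S) '' (c \ {V₀})).encard = (c \ {V₀}).encard := by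
    refine Set.InjOn.encard_image ?_
    rintro V ⟨hV, hV0⟩ W ⟨hW, hW0⟩ e
    simp only [Set.mem_singleton_iff] at hV0 hW0
    simp only at e
    by_cases hVS : V ⊆ S
    · by_cases hWS : W ⊆ S
      · rwa [Set.inter_eq_left.2 hVS, Set.inter_eq_left.2 hWS] at e
      · have hV₀W := hle W hW hWS
        exfalso
        have hVV₀ : V ⊆ V₀ := by
          rcases hchain.total hV hV₀ with h | h
          · exact h
          · exact absurd (h.trans hVS) hV₀S
        refine hW0 (inj V₀ hV₀ W hW hV₀S hV₀W ?_).symm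
        refine Set.Subset.antisymm (Set.inter_subset_inter_left _ hV₀W) ?_
        rw [← e]
        exact Set.inter_subset_inter_left _ hVV₀
    · by_cases hWS : W ⊆ S
      · have hV₀W := hle V hV hVS
        exfalso
        have hVV₀ : W ⊆ V₀ := by
          rcases hchain.total hW hV₀ with h | h
          · exact h
          · exact absurd (h.trans hWS) hV₀S
        refine hV0 (inj V₀ hV₀ V hV hV₀S hV₀W ?_).symm
        refine Set.Subset.antisymm (Set.inter_subset_inter_left _ hV₀W) ?_
        rw [e]
        exact Set.inter_subset_inter_left _ hVV₀
      · rcases hchain.total hV hW with h | h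
        · exact inj V hV W hW hVS h e
        · exact (inj W hW V hV hWS h e.symm).symm
  have himg' : ((fun V => V ∩ S) '' (c \ {V₀})).encard ≤ projRank Δ.Ω S := by
    refine Set.encard_le_chainHeight_of_isChain _ _ ?_ ?_
    · rintro _ ⟨V, ⟨hV, hV0⟩, rfl⟩
      refine ⟨inter_mem (hc hV).1 hS, ?_, Set.inter_subset_right⟩
      change (V ∩ S).Nonempty
      by_cases hVS : V ⊆ S
      · rw [Set.inter_eq_left.2 hVS]
        exact (hc hV).2.1
      · by_contra hemp
        rw [Set.not_nonempty_iff_eq_empty] at hemp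
        refine hV0 (inj V₀ hV₀ V hV hV₀S (hle V hV hVS) ?_).symm
        rw [hemp]
        exact Set.subset_empty_iff.1 (hemp ▸ Set.inter_subset_inter_left _ (hle V hV hVS))
    · rintro _ ⟨V, ⟨hV, -⟩, rfl⟩ _ ⟨W, ⟨hW, -⟩, rfl⟩ -
      rcases hchain.total hV hW with h | h
      · exact .inl (Set.inter_subset_inter_left _ h)
      · exact .inr (Set.inter_subset_inter_left _ h)
  have h3 := Set.encard_sdiff_singleton_add_one hV₀
  rw [himg] at himg'
  have h4 : (Δ.rk T : ℕ∞) ≤ Δ.rk S + 1 := by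
    rw [coe_rk hT, coe_rk hS]
    change Set.chainHeight _ _ ≤ _
    rw [← hcard, ← h3]
    gcongr
  exact_mod_cast h4

theorem rk_insert {U S : Set X} (hU : U ∈ Δ.Ω) (hS : S ∈ Δ.Ω) (hSU : S ⊆ U) {p : X}
    (hp : p ∈ U) (hpS : p ∉ S) : Δ.rk (Δ.span (insert p S)) = Δ.rk S + 1 := by
  have hT : Δ.span (insert p S) ∈ Δ.Ω := span_mem hU (Set.insert_subset hp hSU)
  have hST : S ⊆ Δ.span (insert p S) := (Set.subset_insert _ _).trans (subset_span _)
  have hpT : p ∈ Δ.span (insert p S) := subset_span _ (by simp)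
  refine le_antisymm (rk_le_of_meets_lines hT hS fun x hx y hy hxy => ?_)
    (rk_lt hS hT hST hpT hpS)
  exact exists_mem_ln_of_span hT hS hST hpT hpS subset_rfl hx hy hxy

theorem span_insert_of_rk {T S : Set X} (hT : T ∈ Δ.Ω) (hS : S ∈ Δ.Ω) (hST : S ⊆ T)
    (h : Δ.rk T ≤ Δ.rk S + 1) {p : X} (hp : p ∈ T) (hpS : p ∉ S) :
    Δ.span (insert p S) = T := by
  have h1 : insert p S ⊆ T := Set.insert_subset hp hST
  refine eq_of_rk_le (span_mem hT h1) hT (span_subset hT h1) ?_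
  rw [rk_insert hT hS hST hp hpS]
  exact h

/-- A hyperplane of `T` meets each line of `T`. -/
theorem exists_mem_ln_of_rk {T S : Set X} (hT : T ∈ Δ.Ω) (hS : S ∈ Δ.Ω) (hST : S ⊆ T)
    (h : Δ.rk T ≤ Δ.rk S + 1) {x y : X} (hx : x ∈ T) (hy : y ∈ T) (hxy : x ≠ y) :
    ∃ s ∈ S, s ∈ Δ.ln x y := by
  by_cases hxS : x ∈ S
  · exact ⟨x, hxS, left_mem_ln _ _⟩
  · exact exists_mem_ln_of_span hT hS hST hx hxS (span_insert_of_rk hT hS hST h hx hxS).ge hx hy hxy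

theorem rk_singleton {U : Set X} (hU : U ∈ Δ.Ω) {x : X} (hx : x ∈ U) : Δ.rk {x} = 1 := by
  have := rk_insert hU empty_mem (Set.empty_subset _) hx (Set.notMem_empty x)
  rw [rk_empty, LawfulSingleton.insert_empty_eq, span_self (singleton_mem hU hx)] at this
  simpa using this

theorem rk_ln {x y : X} (h : Δ.Col x y) (hxy : x ≠ y) : Δ.rk (Δ.ln x y) = 2 := by
  obtain ⟨U, hU, hx, hy⟩ := h
  have := rk_insert hU (singleton_mem hU hy) (by simpa using hy) hx (p := x) (by simpa using hxy)
  rw [rk_singleton hU hy] at this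
  exact this

/-! ### Collinearity in polar spaces -/

theorem dim_eq_top_iff {U : Set X} : Δ.dim U = n - 1 ↔ Δ.rk U = n := by
  rw [dim_eq]; omega

theorem isMSS_iff {U : Set X} : Δ.IsMSS U ↔ U ∈ Δ.Ω ∧ Δ.rk U = n := by
  unfold IsMSS
  rw [dim_eq_top_iff]

/-- The axiom on a maximal singular subspace `M` and a point `p` outside it: the points of `M`
collinear with `p` form a hyperplane of `M`, which spans with `p` a maximal singular subspace. -/
theorem exists_mss_through {M : Set X} (hM : M ∈ Δ.Ω) (hr : Δ.rk M = n) {p : X} (hp : p ∉ M) :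
    ∃ N ∈ Δ.Ω, Δ.rk N = n ∧ p ∈ N ∧ (∀ y ∈ M, Δ.Col p y ↔ y ∈ N) ∧ Δ.rk (N ∩ M) + 1 = n := by
  obtain ⟨h1, h2, h3⟩ := Δ.ps3 M hM (dim_eq_top_iff.2 hr) p hp
  have h2n := Δ.two_le
  generalize hN : ⋃₀ {L | L ∈ Δ.Ω ∧ projDim Δ.Ω L = 1 ∧ p ∈ L ∧ (L ∩ M).Nonempty} = N at h1 h2 h3
  have h3' : Δ.rk (N ∩ M) + 1 = n := by
    change Δ.dim (N ∩ M) = _ at h3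
    rw [dim_eq] at h3
    omega
  refine ⟨N, h1, dim_eq_top_iff.1 h2, ?_, ?_, h3'⟩
  · obtain ⟨x, hx, -⟩ := nonempty_of_rk (Δ := Δ) (U := N ∩ M) (by omega)
    rw [← hN] at hx ⊢
    obtain ⟨L, hL, -⟩ := hx
    exact ⟨L, hL, hL.2.2.1⟩
  · intro y hy
    have hpy : p ≠ y := fun e => hp (e ▸ hy)
    rw [← hN]
    constructor
    · intro h
      refine ⟨Δ.ln p y, ⟨h.ln_mem, ?_, left_mem_ln _ _, y, right_mem_ln _ _, hy⟩, right_mem_ln _ _⟩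
      change Δ.dim _ = 1
      rw [dim_eq, rk_ln h hpy]
      norm_num
    · rintro ⟨L, hL, hyL⟩
      exact ⟨L, hL.1, hL.2.2.1, hyL⟩

theorem exists_rk_eq : ∃ M ∈ Δ.Ω, Δ.rk M = n := by
  obtain ⟨U, hU, -, -, h, -⟩ := Δ.ps4
  exact ⟨U, hU, dim_eq_top_iff.1 h⟩

theorem col_refl (x : X) : Δ.Col x x := by
  obtain ⟨M, hM, hr⟩ := exists_rk_eq (Δ := Δ)
  by_cases hx : x ∈ M
  · exact ⟨M, hM, hx, hx⟩
  · obtain ⟨N, hN, -, hxN, -⟩ := exists_mss_through hM hr hx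
    exact ⟨N, hN, hxN, hxN⟩

/-- Every singular subspace `U` lies in one of dimension `n - 1`: one that does not contain a point
`p` of `U` can be replaced by the one through `p`, whose intersection with `U` is larger. -/
theorem exists_mss_ge {U : Set X} (hU : U ∈ Δ.Ω) : ∃ M ∈ Δ.Ω, Δ.rk M = n ∧ U ⊆ M := by
  have key : ∀ k : ℕ, ∀ M ∈ Δ.Ω, Δ.rk M = n → Δ.rk U ≤ Δ.rk (M ∩ U) + k →
      ∃ M ∈ Δ.Ω, Δ.rk M = n ∧ U ⊆ M := by
    intro k
    induction k with
    | zero =>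
      intro M hM hr h
      have := eq_of_rk_le (inter_mem hM hU) hU Set.inter_subset_right h
      exact ⟨M, hM, hr, Set.inter_eq_right.1 this⟩
    | succ k ih =>
      intro M hM hr h
      by_cases hUM : U ⊆ M
      · exact ⟨M, hM, hr, hUM⟩
      obtain ⟨p, hp, hpM⟩ := Set.not_subset.1 hUM
      obtain ⟨N, hN, hNr, hpN, hcol, -⟩ := exists_mss_through hM hr hpM
      refine ih N hN hNr ?_
      have : Δ.rk (M ∩ U) < Δ.rk (N ∩ U) := by
        refine rk_lt (inter_mem hM hU) (inter_mem hN hU) ?_ ⟨hpN, hp⟩ fun h => hpM h.1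
        rintro y ⟨hyM, hyU⟩
        exact ⟨(hcol y hyM).1 ⟨U, hU, hp, hyU⟩, hyU⟩
      omega
  obtain ⟨M, hM, hr⟩ := exists_rk_eq (Δ := Δ)
  exact key (Δ.rk U) M hM hr (by omega)

theorem perp_inter_mem {U : Set X} (hU : U ∈ Δ.Ω) (p : X) :
    {y | y ∈ U ∧ Δ.Col p y} ∈ Δ.Ω := by
  obtain ⟨M, hM, hr, hUM⟩ := exists_mss_ge hU
  by_cases hp : p ∈ M
  · convert hU using 1
    ext y
    exact ⟨fun h => h.1, fun h => ⟨h, M, hM, hp, hUM h⟩⟩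
  · obtain ⟨N, hN, hNr, hpN, hcol, -⟩ := exists_mss_through hM hr hp
    convert inter_mem hU hN using 1
    ext y
    exact and_congr_right fun hy => hcol y (hUM hy)

/-- One or all: each point is collinear with a point of each line. -/
theorem exists_col_ln (p : X) {x y : X} (h : Δ.Col x y) (hxy : x ≠ y) :
    ∃ z ∈ Δ.ln x y, Δ.Col p z := by
  obtain ⟨U, hU, hx, hy⟩ := h
  obtain ⟨M, hM, hr, hUM⟩ := exists_mss_ge hU
  by_cases hp : p ∈ M
  · exact ⟨x, left_mem_ln _ _, M, hM, hp, hUM hx⟩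
  · obtain ⟨N, hN, hNr, hpN, hcol, h3⟩ := exists_mss_through hM hr hp
    obtain ⟨z, hz, hzl⟩ := exists_mem_ln_of_rk hM (inter_mem hN hM) Set.inter_subset_right
      (by omega) (hUM hx) (hUM hy) hxy
    exact ⟨z, hzl, (hcol z hz.2).2 hz.1⟩

theorem col_span {S U : Set X} (hU : U ∈ Δ.Ω) (hS : S ⊆ U) {p : X} (h : ∀ s ∈ S, Δ.Col p s)
    {x : X} (hx : x ∈ Δ.span S) : Δ.Col p x :=
  (span_subset (perp_inter_mem hU p) (fun s hs => ⟨hS hs, h s hs⟩) hx).2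

theorem col_ln {x y z p : X} (h : Δ.Col x y) (hx : Δ.Col p x) (hy : Δ.Col p y)
    (hz : z ∈ Δ.ln x y) : Δ.Col p z := by
  obtain ⟨U, hU, hxU, hyU⟩ := h
  refine col_span hU (S := {x, y}) ?_ ?_ hz
  · rintro w (rfl | rfl) <;> assumption
  · rintro w (rfl | rfl) <;> assumption

/-- A subspace of dimension `n - 1` contains each point collinear with all of it. -/
theorem mem_of_col {M : Set X} (hM : M ∈ Δ.Ω) (hr : Δ.rk M = n) {p : X}
    (h : ∀ y ∈ M, Δ.Col p y) : p ∈ M := by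
  by_contra hp
  obtain ⟨N, hN, hNr, hpN, hcol, h3⟩ := exists_mss_through hM hr hp
  have : N ∩ M = M := Set.inter_eq_right.2 fun y hy => (hcol y hy).1 (h y hy)
  rw [this] at h3
  omega

theorem exists_not_col {M : Set X} (hM : M ∈ Δ.Ω) (hr : Δ.rk M = n) {p : X} (hp : p ∉ M) :
    ∃ y ∈ M, ¬ Δ.Col p y := by
  by_contra h
  push Not at h
  exact hp (mem_of_col hM hr h)

theorem exists_insert {U : Set X} (hU : U ∈ Δ.Ω) {p : X} (h : ∀ y ∈ U, Δ.Col p y) :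
    ∃ N ∈ Δ.Ω, insert p U ⊆ N := by
  obtain ⟨M, hM, hr, hUM⟩ := exists_mss_ge hU
  by_cases hp : p ∈ M
  · exact ⟨M, hM, Set.insert_subset hp hUM⟩
  · obtain ⟨N, hN, hNr, hpN, hcol, -⟩ := exists_mss_through hM hr hp
    exact ⟨N, hN, Set.insert_subset hpN fun y hy => (hcol y (hUM hy)).1 (h y hy)⟩

theorem perpPt_iff {x y : X} : y ∈ Δ.perpPt x ↔ Δ.Col x y := by
  unfold perpPt
  constructor
  · rintro (rfl | ⟨L, hL, -, hx, hy⟩)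
    · exact col_refl _
    · exact ⟨L, hL, hx, hy⟩
  · intro h
    by_cases hxy : x = y
    · exact .inl hxy.symm
    · refine .inr ⟨Δ.ln x y, h.ln_mem, ?_, left_mem_ln _ _, right_mem_ln _ _⟩
      rw [dim_eq, rk_ln h hxy]
      norm_num

theorem mem_proj {V U : Set X} {y : X} : y ∈ Δ.proj V U ↔ y ∈ V ∧ ∀ x ∈ U, Δ.Col x y := by
  simp [proj, perp, perpPt_iff]

theorem proj_subset {V U : Set X} : Δ.proj V U ⊆ V := Set.inter_subset_left

theorem proj_mem {A : Set X} (hA : A ∈ Δ.Ω) (U : Set X) : Δ.proj A U ∈ Δ.Ω := by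
  refine mem_of_ln_subset hA proj_subset ?_
  intro x hx y hy _ z hz
  rw [mem_proj] at hx hy ⊢
  exact ⟨ln_subset hA hx.1 hy.1 hz, fun u hu =>
    col_ln ⟨A, hA, hx.1, hy.1⟩ (hx.2 u hu) (hy.2 u hu) hz⟩

theorem proj_empty (A : Set X) : Δ.proj A ∅ = A := by
  ext y; simp [mem_proj]

/-- Each dimension of `U` costs at most one dimension of `A ∩ U^⊥`. -/
theorem rk_proj_le {A V : Set X} (hA : A ∈ Δ.Ω) (hV : V ∈ Δ.Ω) :
    ∀ (k : ℕ) (U : Set X), U ∈ Δ.Ω → U ⊆ V → Δ.rk V ≤ Δ.rk U + k →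
      Δ.rk (Δ.proj A U) ≤ Δ.rk (Δ.proj A V) + k := by
  intro k
  induction k with
  | zero =>
    intro U hU hUV h
    rw [eq_of_rk_le hU hV hUV h]
    rfl
  | succ k ih =>
    intro U hU hUV h
    by_cases hVU : V ⊆ U
    · rw [hUV.antisymm hVU]; omega
    obtain ⟨p, hp, hpU⟩ := Set.not_subset.1 hVU
    have hi : insert p U ⊆ V := Set.insert_subset hp hUV
    have h1 := ih _ (span_mem hV hi) (span_subset hV hi) (by rw [rk_insert hV hU hUV hp hpU]; omega)
    have h2 : Δ.rk (Δ.proj A U) ≤ Δ.rk (Δ.proj A (Δ.span (insert p U))) + 1 := by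
      refine rk_le_of_meets_lines (proj_mem hA _) (proj_mem hA _) ?_
      intro x hx y hy hxy
      obtain ⟨z, hz, hpz⟩ := exists_col_ln p ⟨A, hA, proj_subset hx, proj_subset hy⟩ hxy
      have hz' := ln_subset (proj_mem hA U) hx hy hz
      rw [mem_proj] at hz'
      refine ⟨z, mem_proj.2 ⟨hz'.1, fun u hu => ?_⟩, hz⟩
      refine (col_span hV hi ?_ hu).symm
      rintro s (rfl | hs)
      · exact hpz.symm
      · exact (hz'.2 s hs).symm
    omega

/-! ### Opposite maximal singular subspaces -/

/-- Of two adjacent maximal singular subspaces `U` and `N`, if the first is disjoint from some `V`,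
so is the second: if `V` meets `N` in `v`, and `q` is a point of `U` not collinear with `v`, then
the maximal singular subspace through `q` adjacent to `V` is disjoint from `N`. -/
theorem exists_disjoint_of_adjacent {U N V : Set X} (hU : U ∈ Δ.Ω) (hUr : Δ.rk U = n)
    (hN : N ∈ Δ.Ω) (hNr : Δ.rk N = n) (hUN : n ≤ Δ.rk (N ∩ U) + 1) (hV : V ∈ Δ.Ω)
    (hVr : Δ.rk V = n) (hd : Disjoint V U) :
    ∃ V ∈ Δ.Ω, Δ.rk V = n ∧ Disjoint V N := by
  by_cases h : Disjoint V N
  · exact ⟨V, hV, hVr, h⟩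
  obtain ⟨v, hvV, hvN⟩ := Set.not_disjoint_iff.1 h
  have hvU : v ∉ U := fun h => Set.disjoint_left.1 hd hvV h
  obtain ⟨q, hqU, hqv⟩ := exists_not_col hU hUr hvU
  have hqV : q ∉ V := fun h => hqv ⟨V, hV, hvV, h⟩
  obtain ⟨V', hV', hV'r, hqV', hcol, h3⟩ := exists_mss_through hV hVr hqV
  refine ⟨V', hV', hV'r, Set.disjoint_left.2 fun z hzV' hzN => ?_⟩
  have hvV' : v ∉ V' := fun h => hqv ((hcol v hvV).2 h).symm
  have hzV : z ∈ V := by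
    refine mem_of_col hV hVr fun y hy => ?_
    have h4 := span_insert_of_rk hV (inter_mem hV' hV) Set.inter_subset_right (by omega) hvV
      (fun h => hvV' h.1)
    rw [← h4] at hy
    refine col_span hV (Set.insert_subset hvV Set.inter_subset_right) ?_ hy
    rintro s (rfl | hs)
    · exact ⟨N, hN, hzN, hvN⟩
    · exact ⟨V', hV', hzV', hs.1⟩
  have hzv : z ≠ v := by rintro rfl; exact hvV' hzV'
  obtain ⟨s, hs, hsl⟩ := exists_mem_ln_of_rk hN (inter_mem hN hU) Set.inter_subset_left
    (by omega) hzN hvN hzv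
  exact Set.disjoint_left.1 hd (ln_subset hV hzV hvV hsl) hs.2

/-- The axioms provide one pair of disjoint maximal singular subspaces; disjoint partners of the
others are found along a sequence of adjacent ones. -/
theorem exists_disjoint_mss {N : Set X} (hN : N ∈ Δ.Ω) (hNr : Δ.rk N = n) :
    ∃ V ∈ Δ.Ω, Δ.rk V = n ∧ Disjoint V N := by
  have key : ∀ k : ℕ, ∀ U ∈ Δ.Ω, Δ.rk U = n → (∃ V ∈ Δ.Ω, Δ.rk V = n ∧ Disjoint V U) →
      n ≤ Δ.rk (U ∩ N) + k → ∃ V ∈ Δ.Ω, Δ.rk V = n ∧ Disjoint V N := by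
    intro k
    induction k with
    | zero =>
      rintro U hU hUr ⟨V, hV⟩ h
      have h1 := eq_of_rk_le (inter_mem hU hN) hN Set.inter_subset_right (by omega)
      have h2 := eq_of_rk_le (inter_mem hU hN) hU Set.inter_subset_left (by omega)
      rw [← h1, h2]
      exact ⟨V, hV⟩
    | succ k ih =>
      rintro U hU hUr ⟨V, hV, hVr, hd⟩ h
      by_cases hNU : N ⊆ U
      · have := eq_of_rk_le hN hU hNU (by omega)
        subst this
        exact ⟨V, hV, hVr, hd⟩
      obtain ⟨q, hqN, hqU⟩ := Set.not_subset.1 hNU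
      obtain ⟨U', hU', hU'r, hqU', hcol, h3⟩ := exists_mss_through hU hUr hqU
      refine ih U' hU' hU'r
        (exists_disjoint_of_adjacent hU hUr hU' hU'r (by omega) hV hVr hd) ?_
      have : Δ.rk (U ∩ N) < Δ.rk (U' ∩ N) := by
        refine rk_lt (inter_mem hU hN) (inter_mem hU' hN) ?_ ⟨hqU', hqN⟩ fun h => hqU h.1
        rintro y ⟨hyU, hyN⟩
        exact ⟨(hcol y hyU).1 ⟨N, hN, hqN, hyN⟩, hyN⟩
      omega
  obtain ⟨U, hU, V, hV, hUr, hVr, hd⟩ := Δ.ps4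
  exact key n U hU (dim_eq_top_iff.1 hUr) ⟨V, hV, dim_eq_top_iff.1 hVr, hd.symm⟩ (by omega)

/-- A hyperplane `H` of a maximal singular subspace `N` lies in a second one: a subspace disjoint
from `N` contains a point collinear with the whole of `H`. -/
theorem exists_second_mss {H N : Set X} (hH : H ∈ Δ.Ω) (hHr : Δ.rk H + 1 = n) (hN : N ∈ Δ.Ω)
    (hNr : Δ.rk N = n) (hHN : H ⊆ N) : ∃ N' ∈ Δ.Ω, Δ.rk N' = n ∧ H ⊆ N' ∧ N' ≠ N := by
  obtain ⟨V, hV, hVr, hd⟩ := exists_disjoint_mss hN hNr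
  have h1 := rk_proj_le hV hH (Δ.rk H) ∅ empty_mem (Set.empty_subset _) (by omega)
  rw [proj_empty] at h1
  obtain ⟨p, hp⟩ := nonempty_of_rk (Δ := Δ) (U := Δ.proj V H) (by omega)
  rw [mem_proj] at hp
  obtain ⟨N', hN', hsub⟩ := exists_insert hH (p := p) fun y hy => (hp.2 y hy).symm
  obtain ⟨M, hM, hMr, hNM⟩ := exists_mss_ge hN'
  refine ⟨M, hM, hMr, (Set.subset_insert _ _).trans (hsub.trans hNM), ?_⟩
  rintro rfl
  exact Set.disjoint_left.1 hd hp.1 (hNM (hsub (by simp)))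

/-- A subspace that is maximal among those of `N` avoiding `x` is a hyperplane of `N`. -/
theorem exists_hyperplane {N J : Set X} (hN : N ∈ Δ.Ω) (hJ : J ∈ Δ.Ω) (hJN : J ⊆ N) {x : X}
    (hx : x ∈ N) (hxJ : x ∉ J) :
    ∃ H ∈ Δ.Ω, J ⊆ H ∧ H ⊆ N ∧ x ∉ H ∧ Δ.rk H + 1 = Δ.rk N := by
  have key : ∀ k : ℕ, ∀ J ∈ Δ.Ω, J ⊆ N → x ∉ J → Δ.rk N ≤ Δ.rk J + 1 + k →
      ∃ H ∈ Δ.Ω, J ⊆ H ∧ H ⊆ N ∧ x ∉ H ∧ Δ.rk H + 1 = Δ.rk N := by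
    intro k
    induction k with
    | zero =>
      intro J hJ hJN hxJ h
      have := rk_lt hJ hN hJN hx hxJ
      exact ⟨J, hJ, subset_rfl, hJN, hxJ, by omega⟩
    | succ k ih =>
      intro J hJ hJN hxJ h
      by_cases hsp : N ⊆ Δ.span (insert x J)
      · refine ⟨J, hJ, subset_rfl, hJN, hxJ, ?_⟩
        rw [← rk_insert hN hJ hJN hx hxJ]
        congr 1
        exact (span_subset hN (Set.insert_subset hx hJN)).antisymm hsp
      obtain ⟨y, hyN, hy⟩ := Set.not_subset.1 hsp
      have hyJ : y ∉ J := fun h => hy (subset_span _ (.inr h))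
      have hi := Set.insert_subset hyN hJN
      obtain ⟨H, hH, hJH, h2⟩ := ih _ (span_mem hN hi) (span_subset hN hi)
        (fun h => hy (span_insert_exchange hN hJ hJN hyN hyJ h hxJ))
        (by rw [rk_insert hN hJ hJN hyN hyJ]; omega)
      exact ⟨H, hH, (Set.subset_insert _ _).trans ((subset_span _).trans hJH), h2⟩
  exact key (Δ.rk N) J hJ hJN hxJ (by omega)

/-- A subspace disjoint from `M` lies in a maximal singular subspace `N` disjoint from `M`. While
`N` still contains a point `x` of `M`, it is replaced by another one through a hyperplane that
contains `J` and avoids `x`. -/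
theorem exists_disjoint_mss_ge {J M : Set X} (hJ : J ∈ Δ.Ω) (hM : M ∈ Δ.Ω) (hd : Disjoint J M) :
    ∃ N ∈ Δ.Ω, Δ.rk N = n ∧ J ⊆ N ∧ Disjoint N M := by
  have key : ∀ k : ℕ, ∀ N ∈ Δ.Ω, Δ.rk N = n → J ⊆ N → Δ.rk (N ∩ M) ≤ k →
      ∃ N ∈ Δ.Ω, Δ.rk N = n ∧ J ⊆ N ∧ Disjoint N M := by
    intro k
    induction k with
    | zero =>
      intro N hN hNr hJN h
      exact ⟨N, hN, hNr, hJN, Set.disjoint_iff_inter_eq_empty.2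
        (eq_empty_of_rk (inter_mem hN hM) (by omega))⟩
    | succ k ih =>
      intro N hN hNr hJN h
      by_cases hNM : Disjoint N M
      · exact ⟨N, hN, hNr, hJN, hNM⟩
      obtain ⟨x, hxN, hxM⟩ := Set.not_disjoint_iff.1 hNM
      obtain ⟨H, hH, hJH, hHN, hxH, hHr⟩ := exists_hyperplane hN hJ hJN hxN
        fun h => Set.disjoint_left.1 hd h hxM
      obtain ⟨N', hN', hN'r, hHN', hne⟩ := exists_second_mss hH (by omega) hN hNr hHN
      have hsub : N' ∩ M ⊆ H := by
        rintro y ⟨hyN', hyM⟩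
        by_contra hyH
        have e := span_insert_of_rk hN hH hHN (by omega) hxN hxH
        have hyN : y ∈ N := by
          refine mem_of_col hN hNr fun z hz => ?_
          rw [← e] at hz
          refine col_span hN (Set.insert_subset hxN hHN) ?_ hz
          rintro s (rfl | hs)
          · exact ⟨M, hM, hyM, hxM⟩
          · exact ⟨N', hN', hyN', hHN' hs⟩
        rw [← span_insert_of_rk hN hH hHN (by omega) hyN hyH,
          ← span_insert_of_rk hN' hH hHN' (by omega) hyN' hyH] at hne
        exact hne rfl
      refine ih N' hN' hN'r (hJH.trans hHN') ?_
      have : Δ.rk (N' ∩ M) < Δ.rk (N ∩ M) := by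
        refine rk_lt (inter_mem hN' hM) (inter_mem hN hM) ?_ ⟨hxN, hxM⟩ fun h => hxH (hsub h)
        exact fun y hy => ⟨hHN (hsub hy), hy.2⟩
      omega
  obtain ⟨N, hN, hNr, hJN⟩ := exists_mss_ge hJ
  exact key _ N hN hNr hJN le_rfl

/-! ### The hyperbolic case -/

theorem hyperbolic_iff : Δ.IsHyperbolic ↔ ∀ V ∈ Δ.Ω, Δ.rk V + 1 = n →
    {M | (M ∈ Δ.Ω ∧ Δ.rk M = n) ∧ V ⊆ M}.encard = 2 := by
  unfold IsHyperbolic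
  have : ∀ V, Δ.dim V = n - 2 ↔ Δ.rk V + 1 = n := fun V => by rw [dim_eq]; omega
  simp only [this, isMSS_iff]

/-- In a hyperbolic polar space, the dimensions in which a maximal singular subspace meets two
adjacent ones differ by one: it contains a point collinear with the whole of the common hyperplane
`B ∩ C` and not in it, and this point lies in one of the only two maximal singular subspaces
through `B ∩ C`. -/
theorem rk_inter_adjacent (hyp : Δ.IsHyperbolic) {A B C : Set X} (hA : A ∈ Δ.Ω) (hAr : Δ.rk A = n)
    (hB : B ∈ Δ.Ω) (hBr : Δ.rk B = n) (hC : C ∈ Δ.Ω) (hCr : Δ.rk C = n)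
    (hBC : Δ.rk (B ∩ C) + 1 = n) :
    Δ.rk (A ∩ B) = Δ.rk (A ∩ C) + 1 ∨ Δ.rk (A ∩ C) = Δ.rk (A ∩ B) + 1 := by
  rw [hyperbolic_iff] at hyp
  have hH := inter_mem hB hC
  have hAH := inter_mem hA hH
  have h2 := hyp _ hH hBC
  have hne : B ≠ C := by
    rintro rfl
    rw [Set.inter_self] at hBC
    omega
  have hsub : ∀ M ∈ Δ.Ω, Δ.rk M = n → B ∩ C ⊆ M → M = B ∨ M = C := by
    intro M hM hMr hHM
    by_contra hcon
    push Not at hcon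
    have h3 : ({M, B, C} : Set (Set X)) ⊆ {M | (M ∈ Δ.Ω ∧ Δ.rk M = n) ∧ B ∩ C ⊆ M} := by
      rintro W (rfl | rfl | rfl)
      · exact ⟨⟨hM, hMr⟩, hHM⟩
      · exact ⟨⟨hB, hBr⟩, Set.inter_subset_left⟩
      · exact ⟨⟨hC, hCr⟩, Set.inter_subset_right⟩
    have h4 := Set.encard_le_encard h3
    rw [h2, Set.encard_insert_of_notMem (by simp [hcon.1, hcon.2]), Set.encard_pair hne] at h4
    norm_num at h4
  have upper : ∀ D ∈ Δ.Ω, Δ.rk D = n → B ∩ C ⊆ D → Δ.rk (A ∩ D) ≤ Δ.rk (A ∩ (B ∩ C)) + 1 := by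
    intro D hD hDr hHD
    refine rk_le_of_meets_lines (inter_mem hA hD) hAH ?_
    rintro x ⟨hxA, hxD⟩ y ⟨hyA, hyD⟩ hxy
    obtain ⟨s, hs, hsl⟩ := exists_mem_ln_of_rk hD hH hHD (by omega) hxD hyD hxy
    exact ⟨s, ⟨ln_subset hA hxA hyA hsl, hs⟩, hsl⟩
  have hBle := upper B hB hBr Set.inter_subset_left
  have hCle := upper C hC hCr Set.inter_subset_right
  have hBge : Δ.rk (A ∩ (B ∩ C)) ≤ Δ.rk (A ∩ B) := rk_mono hAH (inter_mem hA hB)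
    (Set.inter_subset_inter_right _ Set.inter_subset_left)
  have hCge : Δ.rk (A ∩ (B ∩ C)) ≤ Δ.rk (A ∩ C) := rk_mono hAH (inter_mem hA hC)
    (Set.inter_subset_inter_right _ Set.inter_subset_right)
  -- not both intersections are larger
  have h5 : ¬ (Δ.rk (A ∩ (B ∩ C)) < Δ.rk (A ∩ B) ∧ Δ.rk (A ∩ (B ∩ C)) < Δ.rk (A ∩ C)) := by
    rintro ⟨hb, hc⟩
    have h6 : ¬ A ∩ B ⊆ A ∩ (B ∩ C) := fun h => by
      have := rk_mono (inter_mem hA hB) hAH h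
      omega
    have h7 : ¬ A ∩ C ⊆ A ∩ (B ∩ C) := fun h => by
      have := rk_mono (inter_mem hA hC) hAH h
      omega
    obtain ⟨x, ⟨hxA, hxB⟩, hx⟩ := Set.not_subset.1 h6
    obtain ⟨y, ⟨hyA, hyC⟩, hy⟩ := Set.not_subset.1 h7
    have hxC : x ∉ C := fun h => hx ⟨hxA, hxB, h⟩
    refine hxC (mem_of_col hC hCr fun z hz => ?_)
    rw [← span_insert_of_rk hC hH Set.inter_subset_right (by omega) hyC
      (fun h => hy ⟨hyA, h⟩)] at hz
    refine col_span hC (Set.insert_subset hyC Set.inter_subset_right) ?_ hz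
    rintro s (rfl | hs)
    · exact ⟨A, hA, hxA, hyA⟩
    · exact ⟨B, hB, hxB, hs.1⟩
  -- not both intersections are equal to the intersection with the hyperplane
  have h6 : ¬ (Δ.rk (A ∩ B) ≤ Δ.rk (A ∩ (B ∩ C)) ∧ Δ.rk (A ∩ C) ≤ Δ.rk (A ∩ (B ∩ C))) := by
    rintro ⟨hb, hc⟩
    have h7 := rk_proj_le hA hH (Δ.rk (B ∩ C) - Δ.rk (A ∩ (B ∩ C))) (A ∩ (B ∩ C)) hAH
      Set.inter_subset_right (by omega)
    have h8 : Δ.proj A (A ∩ (B ∩ C)) = A := by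
      ext y
      rw [mem_proj]
      exact ⟨fun h => h.1, fun h => ⟨h, fun x hx => ⟨A, hA, hx.1, h⟩⟩⟩
    have h9 := rk_mono hAH hH Set.inter_subset_right
    rw [h8] at h7
    have h10 : ¬ Δ.proj A (B ∩ C) ⊆ A ∩ (B ∩ C) := fun h => by
      have := rk_mono (proj_mem hA _) hAH h
      omega
    obtain ⟨p, hp, hp'⟩ := Set.not_subset.1 h10
    rw [mem_proj] at hp
    obtain ⟨N, hN, hsubN⟩ := exists_insert hH (p := p) fun y hy => (hp.2 y hy).symm
    obtain ⟨M, hM, hMr, hNM⟩ := exists_mss_ge hN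
    have hpM : p ∈ M := hNM (hsubN (by simp))
    rcases hsub M hM hMr ((Set.subset_insert _ _).trans (hsubN.trans hNM)) with rfl | rfl
    · have := rk_lt hAH (inter_mem hA hB)
        (Set.inter_subset_inter_right _ Set.inter_subset_left) ⟨hp.1, hpM⟩ hp'
      omega
    · have := rk_lt hAH (inter_mem hA hC)
        (Set.inter_subset_inter_right _ Set.inter_subset_right) ⟨hp.1, hpM⟩ hp'
      omega
  omega

theorem sameFamily_iff {U V : Set X} : Δ.SameFamily U V ↔ Even ((n : ℤ) - Δ.rk (U ∩ V)) := by
  unfold SameFamily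
  rw [dim_eq]
  ring_nf

theorem sameFamily_adjacent (hyp : Δ.IsHyperbolic) {A B C : Set X} (hA : Δ.IsMSS A)
    (hB : Δ.IsMSS B) (hC : Δ.IsMSS C) (hBC : Δ.rk (B ∩ C) + 1 = n) :
    Δ.SameFamily A B ↔ ¬ Δ.SameFamily A C := by
  rw [isMSS_iff] at hA hB hC
  rw [sameFamily_iff, sameFamily_iff, Int.not_even_iff_odd, Int.even_iff, Int.odd_iff]
  have := rk_inter_adjacent hyp hA.1 hA.2 hB.1 hB.2 hC.1 hC.2 hBC
  omega

end PolarSpace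

namespace PolarSpace

variable {X : Type*} {n : ℕ} {Δ : PolarSpace X n}

/-! ### Partial frames -/

@[simp] theorem opp_opp {k : ℕ} (a : Vert k) : a.opp.opp = a := by simp [Vert.opp]

theorem opp_ne {k : ℕ} (a : Vert k) : a.opp ≠ a := by
  obtain ⟨i, b⟩ := a
  cases b <;> simp [Vert.opp]

/-- A set of vertices without antipodal pairs, that is, a clique of the cross-polytope graph. -/
def Clq {k : ℕ} (A : Set (Vert k)) : Prop := ∀ a ∈ A, a.opp ∉ A

theorem Clq.mono {k : ℕ} {A B : Set (Vert k)} (hB : Clq B) (h : A ⊆ B) : Clq A :=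
  fun a ha ha' => hB a (h ha) (h ha')

variable (Δ) in
/-- A frame of `k` hyperbolic pairs; `k` need not be the rank of the polar space. -/
def IsPartialFrame {k : ℕ} (f : Vert k → X) : Prop :=
  ∀ a b, ¬ Δ.Col (f a) (f b) ↔ b = a.opp

theorem isFrame_iff {f : Vert n → X} : Δ.IsFrame f ↔ Δ.IsPartialFrame f := by
  simp only [IsFrame, IsPartialFrame, perpPt_iff]

variable {k : ℕ} {f : Vert k → X}

theorem IsPartialFrame.not_col (hf : Δ.IsPartialFrame f) (a : Vert k) :
    ¬ Δ.Col (f a) (f a.opp) :=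
  (hf a a.opp).2 rfl

theorem IsPartialFrame.col (hf : Δ.IsPartialFrame f) {a b : Vert k} (h : b ≠ a.opp) :
    Δ.Col (f a) (f b) := by
  by_contra hc
  exact h ((hf a b).1 hc)

theorem span_insert_span (p : X) (S : Set X) :
    Δ.span (insert p (Δ.span S)) = Δ.span (insert p S) := by
  refine Set.Subset.antisymm ?_ (span_mono (Set.insert_subset_insert (subset_span S)))
  rintro x hx V ⟨hV, hS⟩
  exact hx V ⟨hV, Set.insert_subset (hS (by simp))
    (span_subset hV ((Set.subset_insert _ _).trans hS))⟩

/-- The antipode of a vertex that is not used in generating `x` is collinear with `x`. -/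
theorem col_opp_of_mem (hf : Δ.IsPartialFrame f) {S : Set X}
    (hS : ∀ s ∈ S, ∀ a, Δ.Col (f a) s) {A : Set (Vert k)} {a : Vert k} (ha : a ∉ A)
    (hA : Δ.span (f '' A ∪ S) ∈ Δ.Ω) {x : X} (hx : x ∈ Δ.span (f '' A ∪ S)) :
    Δ.Col (f a.opp) x := by
  refine col_span hA (subset_span _) ?_ hx
  rintro s (⟨b, hb, rfl⟩ | hs)
  · refine hf.col ?_
    rw [opp_opp]
    rintro rfl
    exact ha hb
  · exact hS s hs _

/-- A clique spans, together with a singular subspace `S` collinear with the partial frame, a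
singular subspace, whose dimension is as large as possible. -/
theorem span_clique_union (hf : Δ.IsPartialFrame f) {S : Set X} (hS : S ∈ Δ.Ω)
    (hSf : ∀ s ∈ S, ∀ a, Δ.Col (f a) s) {A : Set (Vert k)} (hA : Clq A) :
    Δ.span (f '' A ∪ S) ∈ Δ.Ω ∧ Δ.rk (Δ.span (f '' A ∪ S)) = A.ncard + Δ.rk S := by
  induction A, A.toFinite using Set.Finite.induction_on with
  | empty => simp [span_self hS, hS]
  | @insert a A haA hfin ih =>
    obtain ⟨h1, h2⟩ := ih (hA.mono (Set.subset_insert _ _))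
    have hcol : ∀ x ∈ Δ.span (f '' A ∪ S), Δ.Col (f a) x := by
      have := fun x => col_opp_of_mem hf hSf (a := a.opp) (A := A) (x := x)
        (fun h => hA a (by simp) (by simp [h])) h1
      simpa using this
    obtain ⟨N, hN, hsub⟩ := exists_insert h1 hcol
    have e : Δ.span (f '' insert a A ∪ S) = Δ.span (insert (f a) (Δ.span (f '' A ∪ S))) := by
      rw [span_insert_span, Set.image_insert_eq, Set.insert_union]
    have hnot : f a ∉ Δ.span (f '' A ∪ S) := fun h =>
      hf.not_col a (col_opp_of_mem hf hSf haA h1 h).symm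
    rw [e]
    refine ⟨span_mem hN hsub, ?_⟩
    rw [rk_insert hN h1 ((Set.subset_insert _ _).trans hsub) (hsub (by simp)) hnot, h2,
      Set.ncard_insert_of_notMem haA hfin]
    omega

theorem mem_span_diff_singleton (hf : Δ.IsPartialFrame f) {S : Set X} (hS : S ∈ Δ.Ω)
    (hSf : ∀ s ∈ S, ∀ a, Δ.Col (f a) s) {A : Set (Vert k)} (hA : Clq A) {x : X}
    (hx : x ∈ Δ.span (f '' A ∪ S)) {a : Vert k} (ha : Δ.Col x (f a.opp)) :
    x ∈ Δ.span (f '' (A \ {a}) ∪ S) := by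
  by_cases haA : a ∈ A
  swap
  · rwa [Set.sdiff_singleton_eq_self haA]
  have h1 := (span_clique_union hf hS hSf (hA.mono (Set.sdiff_subset (t := {a})))).1
  have h2 := (span_clique_union hf hS hSf hA).1
  have hsub : Δ.span (f '' (A \ {a}) ∪ S) ⊆ Δ.span (f '' A ∪ S) :=
    span_mono (Set.union_subset_union_left _ (Set.image_mono Set.sdiff_subset))
  have hfa : f a ∈ Δ.span (f '' A ∪ S) := subset_span _ (.inl ⟨a, haA, rfl⟩)
  have hcol := fun x => col_opp_of_mem hf hSf (a := a) (A := A \ {a}) (x := x) (by simp) h1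
  have hnot : f a ∉ Δ.span (f '' (A \ {a}) ∪ S) := fun h => hf.not_col a (hcol _ h).symm
  have e : Δ.span (f '' A ∪ S) = Δ.span (insert (f a) (Δ.span (f '' (A \ {a}) ∪ S))) := by
    rw [span_insert_span, ← Set.insert_union, ← Set.image_insert_eq, Set.insert_sdiff_singleton,
      Set.insert_eq_of_mem haA]
  rw [e] at hx
  rcases mem_span_insert h2 h1 hsub hfa hnot hx with rfl | ⟨s, hs, hxs⟩
  · exact absurd ha (hf.not_col a)
  by_contra hxn
  have hsa : s ≠ f a := fun e => hnot (e ▸ hs)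
  have hxs' : x ≠ s := fun e => hxn (e ▸ hs)
  have h3 : f a ∈ Δ.ln s x :=
    ln_exchange ⟨_, h2, hsub hs, hfa⟩ hsa (ln_comm (f a) s ▸ hxs) hxs'
  refine hf.not_col a (col_ln ⟨_, h2, hsub hs, e ▸ hx⟩ (hcol s hs) ha.symm h3).symm

theorem mem_span_diff (hf : Δ.IsPartialFrame f) {S : Set X} (hS : S ∈ Δ.Ω)
    (hSf : ∀ s ∈ S, ∀ a, Δ.Col (f a) s) {A B : Set (Vert k)} (hA : Clq A) {x : X}
    (hx : x ∈ Δ.span (f '' A ∪ S)) (hB : ∀ b ∈ B, Δ.Col x (f b.opp)) :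
    x ∈ Δ.span (f '' (A \ B) ∪ S) := by
  induction B, B.toFinite using Set.Finite.induction_on with
  | empty => simpa using hx
  | @insert b B hbB hfin ih =>
    have := mem_span_diff_singleton hf hS hSf (hA.mono Set.sdiff_subset)
      (ih fun b' hb' => hB b' (by simp [hb'])) (hB b (by simp))
    rwa [Set.sdiff_sdiff, Set.union_singleton] at this

theorem span_clique (hf : Δ.IsPartialFrame f) {A : Set (Vert k)} (hA : Clq A) :
    Δ.span (f '' A) ∈ Δ.Ω ∧ Δ.rk (Δ.span (f '' A)) = A.ncard := by
  have := span_clique_union hf empty_mem (by simp) hA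
  simpa [rk_empty] using this

/-- A vertex whose antipode is collinear with `x` is not needed to generate `x`. -/
theorem mem_span_clique_diff (hf : Δ.IsPartialFrame f) {A B : Set (Vert k)} (hA : Clq A) {x : X}
    (hx : x ∈ Δ.span (f '' A)) (hB : ∀ b ∈ B, Δ.Col x (f b.opp)) :
    x ∈ Δ.span (f '' (A \ B)) := by
  have := mem_span_diff hf empty_mem (by simp) hA (by simpa using hx) hB
  simpa using this

/-- One half of the vertices: a maximal clique. -/
def half (k : ℕ) (b : Bool) : Set (Vert k) := {a | a.2 = b}

theorem half_clq (b : Bool) : Clq (half k b) := by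
  rintro ⟨i, c⟩ rfl
  simp [half, Vert.opp]

theorem opp_mem_half {a : Vert k} {b : Bool} (ha : a ∈ half k b) : a.opp ∈ half k (!b) := by
  simp only [half, Set.mem_ofPred_eq, Vert.opp] at ha ⊢
  rw [ha]

theorem half_ncard (b : Bool) : (half k b).ncard = k := by
  have : half k b = (fun i : Fin k => (i, b)) '' Set.univ := by
    ext ⟨i, c⟩
    simp [half, eq_comm]
  rw [this, Set.ncard_image_of_injective _ (fun i j h => (Prod.ext_iff.1 h).1), Set.ncard_univ,
    Nat.card_fin]

theorem mem_half_or (a : Vert k) : a ∈ half k false ∨ a ∈ half k true := by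
  obtain ⟨i, c⟩ := a
  cases c <;> simp [half]

/-- A partial frame can be extended by a hyperbolic pair containing a given point `p`, the second
point of which is collinear with a given subspace `S`. -/
theorem exists_hyperbolic_partner (hf : Δ.IsPartialFrame f) {S : Set X} (hS : S ∈ Δ.Ω)
    (hSf : ∀ s ∈ S, ∀ a, Δ.Col (f a) s) {p : X} (hp : ∀ a, Δ.Col (f a) p) (hpS : p ∉ S)
    (hpS' : ∀ s ∈ S, Δ.Col p s) :
    ∃ q, (∀ a, Δ.Col (f a) q) ∧ (∀ s ∈ S, Δ.Col q s) ∧ ¬ Δ.Col p q := by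
  have hT := (span_clique_union hf hS hSf (half_clq (k := k) false)).1
  set T := Δ.span (f '' half k false ∪ S) with hTdef
  have hE' := (span_clique hf (half_clq (k := k) true)).1
  have hpT : p ∉ T := by
    intro h
    have := mem_span_diff hf hS hSf (half_clq false) (B := half k false) h
      fun b _ => (hp b.opp).symm
    rw [Set.sdiff_self] at this
    simp only [Set.image_empty, Set.empty_union, span_self hS] at this
    exact hpS this
  have hpT' : ∀ x ∈ T, Δ.Col p x := fun x hx => col_span hT (subset_span _) (by
    rintro s (⟨b, -, rfl⟩ | hs)
    · exact (hp b).symm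
    · exact hpS' s hs) hx
  obtain ⟨M₁, hM₁, hsub₁⟩ := exists_insert hT hpT'
  obtain ⟨M, hM, hMr, hMM⟩ := exists_mss_ge hM₁
  have hsub : insert p T ⊆ M := hsub₁.trans hMM
  have hTM : T ⊆ M := (Set.subset_insert _ _).trans hsub
  have hdis : Disjoint (Δ.span (f '' half k true)) M := by
    refine Set.disjoint_left.2 fun x hx hxM => ?_
    have := mem_span_clique_diff hf (half_clq true) (B := half k true) hx
      fun b hb => ⟨M, hM, hxM, hTM (subset_span _ (.inl ⟨_, opp_mem_half hb, rfl⟩))⟩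
    rw [Set.sdiff_self] at this
    simp [span_self empty_mem] at this
  obtain ⟨N, hN, hNr, hEN, hNM⟩ := exists_disjoint_mss_ge hE' hM hdis
  have hspT := span_mem hM hsub
  have hrT : Δ.rk (Δ.span (insert p T)) = Δ.rk T + 1 := rk_insert hM hT hTM (hsub (by simp)) hpT
  have hle := rk_le hspT
  have h1 := rk_proj_le hN hT (Δ.rk T) ∅ empty_mem (Set.empty_subset _) (by omega)
  rw [proj_empty] at h1
  have h2 := rk_proj_le hN hM (n - (Δ.rk T + 1)) _ hspT (span_subset hM hsub) (by omega)
  have h3 : Δ.proj N M = ∅ := by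
    refine Set.subset_empty_iff.1 fun y hy => ?_
    rw [mem_proj] at hy
    exact Set.disjoint_left.1 hNM hy.1 (mem_of_col hM hMr fun x hx => (hy.2 x hx).symm)
  rw [h3, rk_empty] at h2
  have h4 : ¬ Δ.proj N T ⊆ Δ.proj N (Δ.span (insert p T)) := fun h => by
    have := rk_mono (proj_mem hN _) (proj_mem hN _) h
    omega
  obtain ⟨q, hq, hq'⟩ := Set.not_subset.1 h4
  rw [mem_proj] at hq
  have hqT : ∀ s ∈ T, Δ.Col q s := fun s hs => (hq.2 s hs).symm
  refine ⟨q, fun a => ?_, fun s hs => hqT s (subset_span _ (.inr hs)), fun hc => hq' ?_⟩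
  · rcases mem_half_or a with ha | ha
    · exact (hqT _ (subset_span _ (.inl ⟨a, ha, rfl⟩))).symm
    · exact ⟨N, hN, hEN (subset_span _ ⟨a, ha, rfl⟩), hq.1⟩
  · refine mem_proj.2 ⟨hq.1, fun x hx => (col_span hspT (subset_span _) ?_ hx).symm⟩
    rintro s (rfl | hs)
    · exact hc.symm
    · exact hqT s hs

theorem exists_col_frame (hf : Δ.IsPartialFrame f) (hk : k < n) : ∃ p, ∀ a, Δ.Col (f a) p := by
  obtain ⟨hE, hEr⟩ := span_clique hf (half_clq (k := k) false)
  obtain ⟨hE', hEr'⟩ := span_clique hf (half_clq (k := k) true)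
  rw [half_ncard] at hEr hEr'
  obtain ⟨M, hM, hMr, hEM⟩ := exists_mss_ge hE
  have h1 := rk_proj_le hM hE' k ∅ empty_mem (Set.empty_subset _) (by omega)
  rw [proj_empty] at h1
  obtain ⟨p, hp⟩ := nonempty_of_rk (Δ := Δ) (U := Δ.proj M (Δ.span (f '' half k true))) (by omega)
  rw [mem_proj] at hp
  refine ⟨p, fun a => ?_⟩
  rcases mem_half_or a with ha | ha
  · exact ⟨M, hM, hEM (subset_span _ ⟨a, ha, rfl⟩), hp.1⟩
  · exact hp.2 _ (subset_span _ ⟨a, ha, rfl⟩)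

/-- A frame of `n` pairs cannot be extended. -/
theorem not_col_frame {f : Vert n → X} (hf : Δ.IsPartialFrame f) {p : X}
    (hp : ∀ a, Δ.Col (f a) p) : False := by
  obtain ⟨hE, hEr⟩ := span_clique hf (half_clq (k := n) false)
  rw [half_ncard] at hEr
  have h1 : p ∈ Δ.span (f '' half n false) := mem_of_col hE hEr fun y hy =>
    col_span hE (subset_span _) (by rintro _ ⟨a, -, rfl⟩; exact (hp a).symm) hy
  have h2 := mem_span_clique_diff hf (half_clq false) h1 (B := half n false)
    fun b _ => (hp b.opp).symm
  rw [Set.sdiff_self] at h2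
  simp [span_self empty_mem] at h2

/-! ### Frames adapted to two singular subspaces -/

/-- Adding the pair `p, q` to a partial frame. -/
def consFrame (p q : X) (f : Vert k → X) : Vert (k + 1) → X := fun a =>
  Fin.cons (α := fun _ => X) (if a.2 then q else p) (fun i => f (i, a.2)) a.1

theorem consFrame_isPartialFrame (hf : Δ.IsPartialFrame f) {p q : X} (hp : ∀ a, Δ.Col (f a) p)
    (hq : ∀ a, Δ.Col (f a) q) (hpq : ¬ Δ.Col p q) : Δ.IsPartialFrame (consFrame p q f) := by
  have hqp : ¬ Δ.Col q p := fun h => hpq h.symm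
  rintro ⟨i, b⟩ ⟨j, c⟩
  refine Fin.cases ?_ (fun i => ?_) i <;> refine Fin.cases ?_ (fun j => ?_) j
  · cases b <;> cases c <;> simp [consFrame, Vert.opp, col_refl, hpq, hqp]
  · cases b <;> cases c <;> simp [consFrame, Vert.opp, (hp _).symm, (hq _).symm]
  · cases b <;> cases c <;>
    simp [consFrame, Vert.opp, hp, hq, (Fin.succ_ne_zero _).symm]
  · have := hf (i, b) (j, c)
    simpa [consFrame, Vert.opp] using this

theorem range_consFrame (p q : X) (f : Vert k → X) :
    Set.range (consFrame p q f) = {p, q} ∪ Set.range f := by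
  ext x
  constructor
  · rintro ⟨⟨i, b⟩, rfl⟩
    refine Fin.cases ?_ (fun i => ?_) i
    · cases b <;> simp [consFrame]
    · exact .inr ⟨(i, b), by simp [consFrame]⟩
  · rintro ((rfl | rfl) | ⟨⟨i, b⟩, rfl⟩)
    · exact ⟨(0, false), by simp [consFrame]⟩
    · exact ⟨(0, true), by simp [consFrame]⟩
    · exact ⟨(i.succ, b), by simp [consFrame]⟩

variable (Δ) in
/-- `I` is spanned by points of the partial frame `f` and by points collinear with all of `f`. -/
def IsAdapted (f : Vert k → X) (I : Set X) : Prop :=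
  I ⊆ Δ.span ((I ∩ Set.range f) ∪ Δ.proj I (Set.range f))

theorem mem_proj_range {I : Set X} {x : X} :
    x ∈ Δ.proj I (Set.range f) ↔ x ∈ I ∧ ∀ a, Δ.Col (f a) x := by
  simp only [mem_proj, Set.forall_mem_range]

theorem IsAdapted.cons {I : Set X} (hI : I ∈ Δ.Ω) (h : Δ.IsAdapted f I) {p q : X}
    (hp : ∀ a, Δ.Col (f a) p) (hq : ∀ a, Δ.Col (f a) q) (hpq : ¬ Δ.Col p q)
    (hcond : p ∈ I ∨ q ∈ I ∨ ∀ x ∈ Δ.proj I (Set.range f), Δ.Col p x ∧ Δ.Col q x) :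
    Δ.IsAdapted (consFrame p q f) I := by
  have hV : Δ.span ((I ∩ Set.range (consFrame p q f)) ∪ Δ.proj I (Set.range (consFrame p q f)))
      ∈ Δ.Ω := span_mem hI (Set.union_subset Set.inter_subset_left proj_subset)
  refine h.trans (span_subset hV ?_)
  rintro x (⟨hxI, hxf⟩ | hx)
  · refine subset_span _ (.inl ⟨hxI, ?_⟩)
    rw [range_consFrame]
    exact .inr hxf
  have hx' := mem_proj_range.1 hx
  have key : ∀ p q : X, (∀ a, Δ.Col (f a) p) → ¬ Δ.Col p q → p ∈ I →
      x ∈ Δ.span (insert p {y | y ∈ Δ.proj I (Set.range f) ∧ Δ.Col p y ∧ Δ.Col q y}) := by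
    intro p q hp hpq hpI
    by_cases hxp : x = p
    · subst hxp; exact subset_span _ (by simp)
    obtain ⟨y, hy, hqy⟩ := exists_col_ln q ⟨I, hI, hpI, hx'.1⟩ (Ne.symm hxp)
    have hyp : y ≠ p := by rintro rfl; exact hpq hqy.symm
    have hyI := ln_subset hI hpI hx'.1 hy
    refine span_mono ?_ (ln_exchange ⟨I, hI, hpI, hx'.1⟩ (Ne.symm hxp) hy hyp)
    rintro z (rfl | rfl)
    · simp
    · refine .inr ⟨mem_proj_range.2 ⟨hyI, fun a => ?_⟩, ⟨I, hI, hpI, hyI⟩, hqy⟩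
      exact col_ln ⟨I, hI, hpI, hx'.1⟩ (hp a) (hx'.2 a) hy
  have hproj : ∀ y ∈ Δ.proj I (Set.range f), Δ.Col p y → Δ.Col q y →
      y ∈ Δ.proj I (Set.range (consFrame p q f)) := by
    intro y hy hpy hqy
    have hy' := mem_proj.1 hy
    refine mem_proj.2 ⟨hy'.1, ?_⟩
    rw [range_consFrame]
    rintro z ((rfl | rfl) | hz)
    · exact hpy
    · exact hqy
    · exact hy'.2 z hz
  rcases hcond with hpI | hqI | hall
  · refine span_mono ?_ (key p q hp hpq hpI)
    rintro z (rfl | ⟨hz, h1, h2⟩)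
    · exact .inl ⟨hpI, by simp [range_consFrame]⟩
    · exact .inr (hproj z hz h1 h2)
  · refine span_mono ?_ (key q p hq (fun h => hpq h.symm) hqI)
    rintro z (rfl | ⟨hz, h1, h2⟩)
    · exact .inl ⟨hqI, by simp [range_consFrame]⟩
    · exact .inr (hproj z hz h2 h1)
  · exact subset_span _ (.inr (hproj x hx (hall x hx).1 (hall x hx).2))

/-- The pair to be added to a partial frame: a point of `I` and a point of `J` not collinear with
it, if possible, and otherwise a point of `I` and a point collinear with the relevant part of
`J`. -/
theorem exists_adapted_pair (hf : Δ.IsPartialFrame f) {I J : Set X} (hJ : J ∈ Δ.Ω)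
    {p : X} (hp : p ∈ Δ.proj I (Set.range f)) :
    ∃ q, (∀ a, Δ.Col (f a) q) ∧ ¬ Δ.Col p q ∧
      (p ∈ J ∨ q ∈ J ∨ ∀ x ∈ Δ.proj J (Set.range f), Δ.Col p x ∧ Δ.Col q x) := by
  have hp' := mem_proj_range.1 hp
  by_cases h1 : ∃ q ∈ Δ.proj J (Set.range f), ¬ Δ.Col p q
  · obtain ⟨q, hq, hpq⟩ := h1
    have hq' := mem_proj_range.1 hq
    exact ⟨q, hq'.2, hpq, .inr (.inl hq'.1)⟩
  push Not at h1
  by_cases hpJ : p ∈ J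
  · obtain ⟨q, hq, -, hpq⟩ := exists_hyperbolic_partner hf empty_mem (by simp) hp'.2
      (Set.notMem_empty _) (by simp)
    exact ⟨q, hq, hpq, .inl hpJ⟩
  · obtain ⟨q, hq, hqJ, hpq⟩ := exists_hyperbolic_partner hf (proj_mem hJ (Set.range f))
      (fun s hs => (mem_proj_range.1 hs).2) hp'.2 (fun h => hpJ (proj_subset h)) h1
    exact ⟨q, hq, hpq, .inr (.inr fun x hx => ⟨h1 x hx, hqJ x hx⟩)⟩

theorem exists_adapted_cons (hf : Δ.IsPartialFrame f) (hk : k < n) {I J : Set X} (hI : I ∈ Δ.Ω)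
    (hJ : J ∈ Δ.Ω) (hIf : Δ.IsAdapted f I) (hJf : Δ.IsAdapted f J) :
    ∃ g : Vert (k + 1) → X, Δ.IsPartialFrame g ∧ Δ.IsAdapted g I ∧ Δ.IsAdapted g J := by
  by_cases h1 : (Δ.proj I (Set.range f)).Nonempty
  · obtain ⟨p, hp⟩ := h1
    have hp' := mem_proj_range.1 hp
    obtain ⟨q, hq, hpq, hc⟩ := exists_adapted_pair hf hJ hp
    exact ⟨consFrame p q f, consFrame_isPartialFrame hf hp'.2 hq hpq,
      hIf.cons hI hp'.2 hq hpq (.inl hp'.1), hJf.cons hJ hp'.2 hq hpq hc⟩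
  by_cases h2 : (Δ.proj J (Set.range f)).Nonempty
  · obtain ⟨p, hp⟩ := h2
    have hp' := mem_proj_range.1 hp
    obtain ⟨q, hq, hpq, hc⟩ := exists_adapted_pair hf hI hp
    exact ⟨consFrame p q f, consFrame_isPartialFrame hf hp'.2 hq hpq,
      hIf.cons hI hp'.2 hq hpq hc, hJf.cons hJ hp'.2 hq hpq (.inl hp'.1)⟩
  obtain ⟨p, hp⟩ := exists_col_frame hf hk
  obtain ⟨q, hq, -, hpq⟩ := exists_hyperbolic_partner hf empty_mem (by simp) hp
    (Set.notMem_empty _) (by simp)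
  rw [Set.not_nonempty_iff_eq_empty] at h1 h2
  exact ⟨consFrame p q f, consFrame_isPartialFrame hf hp hq hpq,
    hIf.cons hI hp hq hpq (.inr (.inr (by simp [h1]))),
    hJf.cons hJ hp hq hpq (.inr (.inr (by simp [h2])))⟩

theorem clq_preimage (hf : Δ.IsPartialFrame f) {I : Set X} (hI : I ∈ Δ.Ω) : Clq (f ⁻¹' I) :=
  fun a ha ha' => hf.not_col a ⟨I, hI, ha, ha'⟩

/-- Any two singular subspaces are spanned by points of a common frame. -/
theorem exists_frame {I J : Set X} (hI : I ∈ Δ.Ω) (hJ : J ∈ Δ.Ω) :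
    ∃ f : Vert n → X, Δ.IsPartialFrame f ∧ ∃ A B : Set (Vert n), Clq A ∧ Clq B ∧
      I = Δ.span (f '' A) ∧ J = Δ.span (f '' B) := by
  have key : ∀ k ≤ n, ∃ f : Vert k → X, Δ.IsPartialFrame f ∧ Δ.IsAdapted f I ∧
      Δ.IsAdapted f J := by
    intro k
    induction k with
    | zero =>
      intro _
      refine ⟨fun a => a.1.elim0, fun a => a.1.elim0, ?_, ?_⟩ <;>
      · refine fun x hx => subset_span _ (.inr (mem_proj_range.2 ⟨hx, fun a => a.1.elim0⟩))
    | succ k ih =>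
      intro hk
      obtain ⟨f, hf, hIf, hJf⟩ := ih (by omega)
      exact exists_adapted_cons hf (by omega) hI hJ hIf hJf
  obtain ⟨f, hf, hIf, hJf⟩ := key n le_rfl
  have h : ∀ I ∈ Δ.Ω, Δ.IsAdapted f I → I = Δ.span (f '' (f ⁻¹' I)) := by
    intro I hI hIf
    have h1 : Δ.proj I (Set.range f) = ∅ := Set.subset_empty_iff.1 fun x hx =>
      not_col_frame hf (mem_proj_range.1 hx).2
    rw [IsAdapted, h1, Set.union_empty] at hIf
    rw [Set.image_preimage_eq_inter_range]
    exact hIf.antisymm (span_subset hI Set.inter_subset_left)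
  exact ⟨f, hf, _, _, clq_preimage hf hI, clq_preimage hf hJ, h I hI hIf, h J hJ hJf⟩

/-! ### Singular subspaces spanned by cliques of a frame -/

theorem span_clique_inter (hf : Δ.IsPartialFrame f) {A B : Set (Vert k)} (hA : Clq A)
    (hB : Clq B) : Δ.span (f '' A) ∩ Δ.span (f '' B) = Δ.span (f '' (A ∩ B)) := by
  refine Set.Subset.antisymm ?_ (Set.subset_inter
    (span_mono (Set.image_mono Set.inter_subset_left))
    (span_mono (Set.image_mono Set.inter_subset_right)))
  rintro x ⟨hxA, hxB⟩
  have := mem_span_clique_diff hf hA hxA (B := Bᶜ) fun b hb => by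
    refine (col_span (span_clique hf hB).1 (subset_span _) ?_ hxB).symm
    rintro _ ⟨c, hc, rfl⟩
    refine hf.col ?_
    rw [opp_opp]
    rintro rfl
    exact hb hc
  rwa [sdiff_compl] at this

/-- The vertices of `B` that are not antipodal to a vertex of `A`. -/
def nonOpp (A B : Set (Vert k)) : Set (Vert k) := {b | b ∈ B ∧ b.opp ∉ A}

theorem clq_union_nonOpp {A B : Set (Vert k)} (hA : Clq A) (hB : Clq B) :
    Clq (A ∪ nonOpp A B) := by
  rintro a (ha | ha) (ha' | ha')
  · exact hA a ha ha'
  · exact ha'.2 (by simpa using ha)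
  · exact ha.2 ha'
  · exact hB a ha.1 ha'.1

theorem up_span_clique (hf : Δ.IsPartialFrame f) {A B : Set (Vert k)} (hA : Clq A)
    (hB : Clq B) :
    Δ.up (Δ.span (f '' A)) (Δ.span (f '' B)) = Δ.span (f '' (A ∪ nonOpp A B)) := by
  have hN : Clq (nonOpp A B) := hB.mono fun b hb => hb.1
  have h1 : Δ.proj (Δ.span (f '' B)) (Δ.span (f '' A)) = Δ.span (f '' nonOpp A B) := by
    refine Set.Subset.antisymm ?_ (span_subset (proj_mem (span_clique hf hB).1 _) ?_)
    · intro x hx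
      rw [mem_proj] at hx
      have := mem_span_clique_diff hf hB hx.1 (B := {b | b.opp ∈ A}) fun b hb =>
        (hx.2 _ (subset_span _ ⟨_, hb, rfl⟩)).symm
      exact this
    · rintro _ ⟨b, ⟨hb, hbA⟩, rfl⟩
      refine mem_proj.2 ⟨subset_span _ ⟨b, hb, rfl⟩, fun y hy => ?_⟩
      refine (col_span (span_clique hf hA).1 (subset_span _) ?_ hy).symm
      rintro _ ⟨a, ha, rfl⟩
      refine hf.col ?_
      rintro rfl
      exact hbA ha
  have h2 := (span_clique hf (clq_union_nonOpp hA hB)).1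
  rw [up, h1]
  refine Set.Subset.antisymm (span_subset h2 (Set.union_subset ?_ ?_)) ?_
  · exact span_mono (Set.image_mono Set.subset_union_left)
  · exact span_mono (Set.image_mono Set.subset_union_right)
  · rw [Set.image_union]
    exact span_mono (Set.union_subset_union (subset_span _) (subset_span _))

end PolarSpace

namespace PolarSpace

variable {n : ℕ}

/-! ### Automorphisms of the cross-polytope -/

theorem aut_opp (w : Vert.Xi n ≃g Vert.Xi n) (a : Vert n) : w a.opp = (w a).opp := by
  have h1 : ¬ (Vert.Xi n).Adj (w a) (w a.opp) := by
    rw [w.map_adj_iff, Vert.Xi_adj]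
    simp [Vert.opp]
  have h2 : w a.opp ≠ w a := fun h => opp_ne a (w.injective h)
  by_contra h
  exact h1 ⟨h2.symm, h⟩

theorem clq_image {A : Set (Vert n)} (hA : Clq A) (w : Vert.Xi n ≃g Vert.Xi n) :
    Clq (w '' A) := by
  rintro _ ⟨a, ha, rfl⟩ ⟨b, hb, h⟩
  rw [← aut_opp] at h
  exact hA a ha (w.injective h ▸ hb)

theorem ncard_aut_image (A : Set (Vert n)) (w : Vert.Xi n ≃g Vert.Xi n) :
    (w '' A).ncard = A.ncard := Set.ncard_image_of_injective _ w.injective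

theorem aut_image_union_nonOpp (A B : Set (Vert n)) (w : Vert.Xi n ≃g Vert.Xi n) :
    w '' (A ∪ nonOpp A B) = w '' A ∪ nonOpp (w '' A) (w '' B) := by
  rw [Set.image_union]
  congr 1
  ext x
  constructor
  · rintro ⟨b, ⟨hb, hb'⟩, rfl⟩
    refine ⟨⟨b, hb, rfl⟩, ?_⟩
    rw [← aut_opp]
    rintro ⟨c, hc, h⟩
    exact hb' (w.injective h ▸ hc)
  · rintro ⟨⟨b, hb, rfl⟩, h⟩
    refine ⟨b, ⟨hb, fun h' => h ?_⟩, rfl⟩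
    rw [← aut_opp]
    exact ⟨_, h', rfl⟩

/-- The automorphism permuting the coordinates by `σ` after changing the signs prescribed by
`t`. -/
def signedPerm (σ : Equiv.Perm (Fin n)) (t : Fin n → Bool) : Vert.Xi n ≃g Vert.Xi n where
  toFun a := (σ a.1, xor a.2 (t a.1))
  invFun a := (σ.symm a.1, xor a.2 (t (σ.symm a.1)))
  left_inv a := by simp
  right_inv a := by simp
  map_rel_iff' := by
    intro a b
    simp [Vert.Xi_adj]

theorem signedPerm_apply (σ : Equiv.Perm (Fin n)) (t : Fin n → Bool) (a : Vert n) :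
    signedPerm σ t a = (σ a.1, xor a.2 (t a.1)) := rfl

theorem flip_apply (i : Fin n) (a : Vert n) : Vert.flip i a = if a.1 = i then a.opp else a := rfl

theorem transp_apply (i j : Fin n) (a : Vert n) :
    Vert.transp i j a = (Equiv.swap i j a.1, a.2) := rfl

theorem aut_mul_apply (w v : Vert.Xi n ≃g Vert.Xi n) (a : Vert n) : (w * v) a = w (v a) := rfl

theorem flip_mul_self (i : Fin n) : Vert.flip i * Vert.flip i = 1 := by
  ext1 a
  rw [aut_mul_apply, flip_apply, flip_apply]
  by_cases h : a.1 = i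
  · rw [if_pos h, if_pos (by simpa [Vert.opp] using h), opp_opp]; rfl
  · rw [if_neg h, if_neg h]; rfl

theorem transp_mul_self (i j : Fin n) : Vert.transp i j * Vert.transp i j = 1 := by
  ext1 a
  rw [aut_mul_apply, transp_apply, transp_apply]
  simp

theorem aut_fst (w : Vert.Xi n ≃g Vert.Xi n) (i : Fin n) (b : Bool) :
    (w (i, b)).1 = (w (i, false)).1 := by
  cases b
  · rfl
  · have := aut_opp w (i, false)
    simp only [Vert.opp, Bool.not_false] at this
    rw [this]

theorem aut_snd (w : Vert.Xi n ≃g Vert.Xi n) (i : Fin n) (b : Bool) :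
    (w (i, b)).2 = xor b (w (i, false)).2 := by
  cases b
  · simp
  · have := aut_opp w (i, false)
    simp only [Vert.opp, Bool.not_false] at this
    rw [this]; simp

/-- The permutation of the coordinates that underlies an automorphism. -/
def autPerm (w : Vert.Xi n ≃g Vert.Xi n) : Equiv.Perm (Fin n) where
  toFun i := (w (i, false)).1
  invFun i := (w.symm (i, false)).1
  left_inv i := by
    have h := aut_fst w.symm (w (i, false)).1 (w (i, false)).2
    change (w.symm ((w (i, false)).1, false)).1 = i
    rw [← h]; simp
  right_inv i := by
    have h := aut_fst w (w.symm (i, false)).1 (w.symm (i, false)).2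
    change (w ((w.symm (i, false)).1, false)).1 = i
    rw [← h]; simp

theorem autPerm_apply (w : Vert.Xi n ≃g Vert.Xi n) (i : Fin n) :
    autPerm w i = (w (i, false)).1 := rfl

theorem aut_eq_signedPerm (w : Vert.Xi n ≃g Vert.Xi n) :
    w = signedPerm (autPerm w) fun i => (w (i, false)).2 := by
  ext1 ⟨i, b⟩
  rw [signedPerm_apply]
  exact Prod.ext (aut_fst w i b) (aut_snd w i b)

/-- A sign as an element of `ℤ/2`. -/
def bit (b : Bool) : ZMod 2 := if b then 1 else 0

theorem bit_xor (b c : Bool) : bit (xor b c) = bit b + bit c := by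
  revert b c; decide

/-- The parity of the number of sign changes of an automorphism. -/
def signParity (w : Vert.Xi n ≃g Vert.Xi n) : ZMod 2 := ∑ i, bit (w (i, false)).2

theorem signParity_mul (w v : Vert.Xi n ≃g Vert.Xi n) :
    signParity (w * v) = signParity w + signParity v := by
  unfold signParity
  rw [← Equiv.sum_comp (autPerm v) fun i => bit (w (i, false)).2, ← Finset.sum_add_distrib]
  refine Finset.sum_congr rfl fun i _ => ?_
  rw [aut_mul_apply, autPerm_apply, ← Prod.mk.eta (p := v (i, false)), aut_snd, bit_xor]
  ring

theorem signParity_one : signParity (1 : Vert.Xi n ≃g Vert.Xi n) = 0 :=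
  Finset.sum_eq_zero fun _ _ => rfl

theorem signParity_transp (i j : Fin n) : signParity (Vert.transp i j) = 0 :=
  Finset.sum_eq_zero fun _ _ => rfl

theorem signParity_flip (i : Fin n) : signParity (Vert.flip i) = 1 := by
  unfold signParity
  rw [Finset.sum_eq_single i]
  · simp [flip_apply, Vert.opp, bit]
  · intro j _ hj
    simp [flip_apply, hj, bit]
  · simp

/-! ### The two classes of maximal cliques -/

/-- The maximal clique with sign `κ i` in the coordinate `i`. -/
def sec (κ : Fin n → Bool) : Set (Vert n) := {a | a.2 = κ a.1}

/-- The parity of the number of vertices `ξ_{-i}` in the maximal clique `sec κ`. -/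
def parity (κ : Fin n → Bool) : ZMod 2 := ∑ i, bit (κ i)

theorem sec_clq (κ : Fin n → Bool) : Clq (sec κ) := by
  rintro ⟨i, b⟩ hb
  simp only [sec, Set.mem_ofPred_eq] at hb
  simp [sec, Vert.opp, hb]

theorem sec_eq_image (κ : Fin n → Bool) : sec κ = (fun i => (i, κ i)) '' Set.univ := by
  ext ⟨i, b⟩
  simp [sec, eq_comm]

theorem sec_ncard (κ : Fin n → Bool) : (sec κ).ncard = n := by
  rw [sec_eq_image, Set.ncard_image_of_injective _ (fun i j h => (Prod.ext_iff.1 h).1),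
    Set.ncard_univ, Nat.card_fin]

theorem image_sec (w : Vert.Xi n ≃g Vert.Xi n) (κ : Fin n → Bool) :
    ∃ κ', w '' sec κ = sec κ' ∧ parity κ' = parity κ + signParity w := by
  refine ⟨fun j => (w ((autPerm w).symm j, κ ((autPerm w).symm j))).2, ?_, ?_⟩
  · ext ⟨j, b⟩
    constructor
    · rintro ⟨⟨i, c⟩, hc, h⟩
      have hc' : c = κ i := hc
      subst hc'
      have hi : autPerm w i = j := by rw [autPerm_apply, ← aut_fst w i (κ i), h]
      simp only [sec, Set.mem_ofPred_eq, ← hi, Equiv.symm_apply_apply]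
      rw [h]
    · intro h
      refine ⟨((autPerm w).symm j, κ ((autPerm w).symm j)), rfl, Prod.ext ?_ h.symm⟩
      rw [aut_fst, ← autPerm_apply, Equiv.apply_symm_apply]
  · unfold parity signParity
    rw [← Equiv.sum_comp (autPerm w), ← Finset.sum_add_distrib]
    refine Finset.sum_congr rfl fun i _ => ?_
    beta_reduce
    rw [Equiv.symm_apply_apply, aut_snd, bit_xor]

theorem exists_subset_sec {A : Set (Vert n)} (hA : Clq A) : ∃ κ, A ⊆ sec κ := by
  classical
  refine ⟨fun i => decide ((i, true) ∈ A), ?_⟩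
  rintro ⟨i, b⟩ hb
  cases b
  · have : (i, true) ∉ A := hA _ hb
    simp [sec, this]
  · simp [sec, hb]

theorem exists_sec {A : Set (Vert n)} (hA : Clq A) (h : n ≤ A.ncard) : ∃ κ, A = sec κ := by
  obtain ⟨κ, hsub⟩ := exists_subset_sec hA
  exact ⟨κ, Set.eq_of_subset_of_ncard_le hsub (by rwa [sec_ncard]) (Set.toFinite _)⟩

theorem isClique_iff {A : Set (Vert n)} : (Vert.Xi n).IsClique A ↔ Clq A := by
  constructor
  · intro h a ha ha'
    have := h ha ha' (opp_ne a).symm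
    rw [Vert.Xi_adj] at this
    exact this rfl
  · rintro h a ha b hb hab
    refine ⟨hab, ?_⟩
    rintro rfl
    exact h a ha hb

theorem ncard_clq_le {A : Set (Vert n)} (hA : Clq A) : A.ncard ≤ n := by
  obtain ⟨κ, hsub⟩ := exists_subset_sec hA
  have := Set.ncard_le_ncard hsub (Set.toFinite _)
  rwa [sec_ncard] at this

theorem maximal_isClique_iff {A : Set (Vert n)} :
    Maximal (Vert.Xi n).IsClique A ↔ ∃ κ, A = sec κ := by
  constructor
  · rintro ⟨h1, h2⟩
    obtain ⟨κ, hsub⟩ := exists_subset_sec (isClique_iff.1 h1)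
    exact ⟨κ, hsub.antisymm (h2 (isClique_iff.2 (sec_clq κ)) hsub)⟩
  · rintro ⟨κ, rfl⟩
    refine ⟨isClique_iff.2 (sec_clq κ), fun B hB hAB => ?_⟩
    rw [isClique_iff] at hB
    refine (Set.eq_of_subset_of_ncard_le hAB ?_ (Set.toFinite _)).ge
    rw [sec_ncard]
    exact ncard_clq_le hB

theorem sameClass_sec (κ κ' : Fin n → Bool) :
    Vert.SameClass (sec κ) (sec κ') ↔ parity κ = parity κ' := by
  classical
  have h1 : (sec κ ∩ sec κ').ncard = (Finset.univ.filter fun i => κ i = κ' i).card := by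
    have : sec κ ∩ sec κ' = (fun i => (i, κ i)) '' {i | κ i = κ' i} := by
      ext ⟨i, b⟩
      constructor
      · rintro ⟨h1, h2⟩
        simp only [sec, Set.mem_ofPred_eq] at h1 h2
        exact ⟨i, h1.symm.trans h2, by rw [h1]⟩
      · rintro ⟨j, hj, h⟩
        obtain ⟨rfl, rfl⟩ := Prod.ext_iff.1 h
        exact ⟨rfl, hj⟩
    rw [this, Set.ncard_image_of_injective _ (fun i j h => (Prod.ext_iff.1 h).1),
      ← Set.ncard_coe_finset]
    simp
  have h2 := Finset.card_filter_add_card_filter_not (s := Finset.univ) fun i => κ i = κ' i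
  rw [Finset.card_univ, Fintype.card_fin] at h2
  have h3 : parity κ + parity κ' = ((Finset.univ.filter fun i => ¬ κ i = κ' i).card : ZMod 2) := by
    unfold parity
    rw [← Finset.sum_add_distrib, Finset.card_filter, Nat.cast_sum]
    refine Finset.sum_congr rfl fun i _ => ?_
    generalize κ i = b
    generalize κ' i = c
    revert b c
    decide
  have h4 : parity κ = parity κ' ↔ parity κ + parity κ' = 0 := by
    generalize parity κ = a
    generalize parity κ' = b
    revert a b
    decide
  -- `h3` counts the coordinates in which `κ` and `κ'` differ, `h1` those in which they agree
  unfold Vert.SameClass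
  rw [h4, h3, h1, ZMod.natCast_eq_zero_iff]
  omega

theorem preservesClasses_iff (w : Vert.Xi n ≃g Vert.Xi n) :
    Vert.PreservesClasses w ↔ signParity w = 0 := by
  unfold Vert.PreservesClasses
  constructor
  · intro h
    obtain ⟨κ', h1, h2⟩ := image_sec w fun _ => false
    have := h _ (maximal_isClique_iff.2 ⟨fun _ => false, rfl⟩)
    rw [h1, sameClass_sec, h2] at this
    exact left_eq_add.1 this
  · rintro h _ hK
    obtain ⟨κ, rfl⟩ := maximal_isClique_iff.1 hK
    obtain ⟨κ', h1, h2⟩ := image_sec w κ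
    rw [h1, sameClass_sec, h2, h, add_zero]

/-! ### The generators -/

/-- Permutations of the coordinates as automorphisms. -/
def permHom (n : ℕ) : Equiv.Perm (Fin n) →* (Vert.Xi n ≃g Vert.Xi n) where
  toFun σ := signedPerm σ fun _ => false
  map_one' := by ext1 a; simp [signedPerm_apply]
  map_mul' σ τ := by ext1 a; simp [signedPerm_apply, aut_mul_apply]

theorem permHom_swap (i j : Fin n) : permHom n (Equiv.swap i j) = Vert.transp i j := by
  ext1 a
  simp [permHom, signedPerm_apply, transp_apply]

theorem permHom_mem {H : Submonoid (Vert.Xi n ≃g Vert.Xi n)}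
    (h : ∀ i j : Fin n, (i : ℕ) + 1 = j → Vert.transp i j ∈ H) (σ : Equiv.Perm (Fin n)) :
    permHom n σ ∈ H := by
  cases n with
  | zero =>
    rw [Subsingleton.elim σ 1, map_one]
    exact H.one_mem
  | succ m =>
    have h1 : σ ∈ Submonoid.closure (Set.range fun i : Fin m => Equiv.swap i.castSucc i.succ) := by
      rw [Equiv.Perm.mclosure_swap_castSucc_succ]
      trivial
    have h2 : Submonoid.closure (Set.range fun i : Fin m => Equiv.swap i.castSucc i.succ) ≤
        H.comap (permHom (m + 1)) := by
      rw [Submonoid.closure_le]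
      rintro _ ⟨i, rfl⟩
      simp only [SetLike.mem_coe, Submonoid.mem_comap, permHom_swap]
      exact h _ _ (by simp)
    exact h2 h1

theorem flip_conj (i j : Fin n) :
    Vert.transp i j * Vert.flip j * Vert.transp i j = Vert.flip i := by
  ext1 a
  simp only [aut_mul_apply, transp_apply, flip_apply]
  by_cases h : a.1 = i
  · simp [h, Vert.opp]
  · have : Equiv.swap i j a.1 ≠ j := fun e => h (by
      have := congrArg (Equiv.swap i j) e
      simpa using this)
    simp [h, this]

theorem flip_comm (i j : Fin n) : Vert.flip i * Vert.flip j = Vert.flip j * Vert.flip i := by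
  have h : ∀ (i : Fin n) (a : Vert n), Vert.flip i a = (a.1, xor a.2 (decide (a.1 = i))) := by
    intro i a
    rw [flip_apply]
    by_cases h : a.1 = i <;> simp [h, Vert.opp]
  ext1 a
  simp only [aut_mul_apply, h]
  rw [Bool.xor_right_comm]

/-- If `H` contains the permutations of the coordinates and the products of two sign changes, then
each automorphism is in `H`, possibly after the sign change in the coordinate `l`. -/
theorem mem_or_mul_flip_mem {H : Submonoid (Vert.Xi n ≃g Vert.Xi n)}
    (h : ∀ σ, permHom n σ ∈ H) (l : Fin n) (hl : ∀ i, Vert.flip i * Vert.flip l ∈ H)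
    (w : Vert.Xi n ≃g Vert.Xi n) : w ∈ H ∨ w * Vert.flip l ∈ H := by
  classical
  have key : ∀ (k : ℕ) (w : Vert.Xi n ≃g Vert.Xi n),
      (Finset.univ.filter fun i => (w (i, false)).2 = true).card = k →
      w ∈ H ∨ w * Vert.flip l ∈ H := by
    intro k
    induction k with
    | zero =>
      intro w hw
      rw [Finset.card_eq_zero, Finset.filter_eq_empty_iff] at hw
      left
      have : w = permHom n (autPerm w) := by
        have h0 : (fun i => (w (i, false)).2) = fun _ => false := by
          ext i
          simpa using hw (Finset.mem_univ i)
        conv_lhs => rw [aut_eq_signedPerm w, h0]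
        rfl
      rw [this]
      exact h _
    | succ k ih =>
      intro w hw
      obtain ⟨i, hi⟩ := Finset.card_pos.1 (by omega : 0 < (Finset.univ.filter fun i =>
        (w (i, false)).2 = true).card)
      have hi' : (w (i, false)).2 = true := by simpa using hi
      have hcard : (Finset.univ.filter fun j => ((w * Vert.flip i) (j, false)).2 = true).card
          = k := by
        have : (Finset.univ.filter fun j => ((w * Vert.flip i) (j, false)).2 = true) =
            (Finset.univ.filter fun j => (w (j, false)).2 = true).erase i := by
          ext j
          rw [Finset.mem_erase, Finset.mem_filter, Finset.mem_filter]
          by_cases hj : j = i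
          · subst hj
            have : (w (j, true)).2 = false := by rw [aut_snd, hi']; rfl
            simp [aut_mul_apply, flip_apply, Vert.opp, this]
          · simp [aut_mul_apply, flip_apply, hj]
        rw [this, Finset.card_erase_of_mem hi, hw]
        rfl
      have hmul : Vert.flip i * (Vert.flip i * Vert.flip l) = Vert.flip l := by
        rw [← mul_assoc, flip_mul_self, one_mul]
      rcases ih _ hcard with h1 | h1
      · right
        have := H.mul_mem h1 (hl i)
        rwa [mul_assoc, hmul] at this
      · left
        have := H.mul_mem h1 (hl i)
        have e : w * Vert.flip i * Vert.flip l * (Vert.flip i * Vert.flip l) = w := by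
          rw [flip_comm i l, mul_assoc (w * _), ← mul_assoc (Vert.flip l), flip_mul_self, one_mul,
            mul_assoc, flip_mul_self, mul_one]
        rwa [e] at this
  exact key _ w rfl

theorem mem_closure_gensB (hn : 2 ≤ n) (w : Vert.Xi n ≃g Vert.Xi n) :
    w ∈ Submonoid.closure (Vert.gensB n) := by
  have h1 : ∀ σ, permHom n σ ∈ Submonoid.closure (Vert.gensB n) := permHom_mem fun i j hij =>
    Submonoid.subset_closure (.inl ⟨i, j, hij, rfl⟩)
  set l : Fin n := ⟨n - 1, by omega⟩
  have h2 : Vert.flip l ∈ Submonoid.closure (Vert.gensB n) :=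
    Submonoid.subset_closure (.inr ⟨l, by simp only [l]; omega, rfl⟩)
  have h3 : ∀ i, Vert.flip i * Vert.flip l ∈ Submonoid.closure (Vert.gensB n) := by
    intro i
    rw [← flip_conj i l, ← permHom_swap]
    exact mul_mem (mul_mem (mul_mem (h1 _) h2) (h1 _)) h2
  rcases mem_or_mul_flip_mem h1 l h3 w with h | h
  · exact h
  · have := mul_mem h h2
    rwa [mul_assoc, flip_mul_self, mul_one] at this

theorem mem_closure_gensD (hn : 2 ≤ n) {w : Vert.Xi n ≃g Vert.Xi n} (hw : signParity w = 0) :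
    w ∈ Submonoid.closure (Vert.gensD n) := by
  have h1 : ∀ σ, permHom n σ ∈ Submonoid.closure (Vert.gensD n) := permHom_mem fun i j hij =>
    Submonoid.subset_closure (.inl ⟨i, j, hij, rfl⟩)
  set l : Fin n := ⟨n - 1, by omega⟩ with hl
  set m : Fin n := ⟨n - 2, by omega⟩ with hm
  have hml : (m : ℕ) + 1 = l := by simp only [hl, hm]; omega
  have hml' : m ≠ l := fun e => by rw [e] at hml; omega
  have h2 : Vert.flip l * Vert.transp m l * Vert.flip l ∈ Submonoid.closure (Vert.gensD n) :=
    Submonoid.subset_closure (.inr ⟨m, l, hml, by simp only [hl]; omega, rfl⟩)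
  have e : Vert.transp m l * (Vert.flip l * Vert.transp m l * Vert.flip l) =
      Vert.flip m * Vert.flip l := by
    rw [← flip_conj m l]
    simp only [mul_assoc]
  have h3 : ∀ i, Vert.flip i * Vert.flip l ∈ Submonoid.closure (Vert.gensD n) := by
    intro i
    by_cases hi : i = l
    · rw [hi, flip_mul_self]
      exact one_mem _
    have e2 : Vert.flip i * Vert.flip l =
        Vert.transp i m * (Vert.flip m * Vert.flip l) * Vert.transp i m := by
      have e3 : Vert.flip l * Vert.transp i m = Vert.transp i m * Vert.flip l := by
        ext1 a
        simp only [aut_mul_apply, transp_apply, flip_apply]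
        by_cases h : a.1 = l
        · simp [h, Equiv.swap_apply_of_ne_of_ne (Ne.symm hi) hml'.symm, Vert.opp]
        · have : Equiv.swap i m a.1 ≠ l := fun e => h (by
            have := congrArg (Equiv.swap i m) e
            simpa [Equiv.swap_apply_of_ne_of_ne (Ne.symm hi) hml'.symm] using this)
          simp [h, this]
      rw [← flip_conj i m]
      simp only [mul_assoc, e3]
    rw [e2, ← e, ← permHom_swap i m, ← permHom_swap m l]
    rw [← permHom_swap m l] at h2
    exact mul_mem (mul_mem (h1 _) (mul_mem (h1 _) h2)) (h1 _)
  have h4 : ∀ v ∈ Submonoid.closure (Vert.gensD n), signParity v = 0 := by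
    intro v hv
    induction hv using Submonoid.closure_induction with
    | mem v hv =>
      rcases hv with ⟨i, j, -, rfl⟩ | ⟨i, j, -, -, rfl⟩
      · exact signParity_transp i j
      · rw [signParity_mul, signParity_mul, signParity_flip, signParity_transp]
        decide
    | one => exact signParity_one
    | mul v v' _ _ h h' => rw [signParity_mul, h, h', add_zero]
  rcases mem_or_mul_flip_mem h1 l h3 w with h | h
  · exact h
  · have := h4 _ h
    rw [signParity_mul, hw, signParity_flip] at this
    exact absurd this (by decide)

/-! ### Word length -/

section WordLength

variable {G : Type*} [Group G] {S : Set G}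

theorem wordLength_le {l : List G} (hl : ∀ s ∈ l, s ∈ S) : wordLength S l.prod ≤ l.length :=
  iInf_le (fun l' : {l' : List G // (∀ s ∈ l', s ∈ S) ∧ l'.prod = l.prod} =>
    (l'.1.length : ℕ∞)) ⟨l, hl, rfl⟩

theorem exists_wordLength_eq {w : G} (hw : w ∈ Submonoid.closure S) :
    ∃ l : List G, (∀ s ∈ l, s ∈ S) ∧ l.prod = w ∧ wordLength S w = l.length := by
  obtain ⟨l, hl, hlw⟩ := Submonoid.exists_list_of_mem_closure hw
  have : Nonempty {l : List G // (∀ s ∈ l, s ∈ S) ∧ l.prod = w} := ⟨⟨l, hl, hlw⟩⟩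
  obtain ⟨⟨l', h1, h2⟩, h3⟩ := ciInf_mem
    fun l : {l : List G // (∀ s ∈ l, s ∈ S) ∧ l.prod = w} => (l.1.length : ℕ∞)
  exact ⟨l', h1, h2, h3.symm⟩

theorem exists_mul_left_shorter (hS : ∀ s ∈ S, s * s = 1) {w : G} (hw : w ∈ Submonoid.closure S)
    (h1 : w ≠ 1) : ∃ s ∈ S, wordLength S (s * w) < wordLength S w := by
  obtain ⟨l, hl, rfl, hlen⟩ := exists_wordLength_eq hw
  cases l with
  | nil => exact absurd rfl h1
  | cons s l =>
    refine ⟨s, hl s (by simp), ?_⟩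
    have : s * (s :: l).prod = l.prod := by
      rw [List.prod_cons, ← mul_assoc, hS s (hl s (by simp)), one_mul]
    rw [this, hlen]
    refine (wordLength_le fun t ht => hl t (by simp [ht])).trans_lt ?_
    simp only [List.length_cons]
    exact_mod_cast Nat.lt_succ_self _

theorem exists_mul_right_shorter (hS : ∀ s ∈ S, s * s = 1) {w : G}
    (hw : w ∈ Submonoid.closure S) (h1 : w ≠ 1) :
    ∃ s ∈ S, wordLength S (w * s) < wordLength S w := by
  obtain ⟨l, hl, rfl, hlen⟩ := exists_wordLength_eq hw
  rcases List.eq_nil_or_concat l with rfl | ⟨l, s, rfl⟩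
  · exact absurd rfl h1
  · rw [List.concat_eq_append] at *
    refine ⟨s, hl s (by simp), ?_⟩
    have : (l ++ [s]).prod * s = l.prod := by
      rw [List.prod_append, List.prod_singleton, mul_assoc, hS s (hl s (by simp)), mul_one]
    rw [this, hlen]
    refine (wordLength_le fun t ht => hl t (by simp [ht])).trans_lt ?_
    simp only [List.length_append, List.length_singleton]
    exact_mod_cast Nat.lt_succ_self _

end WordLength

theorem gensB_mul_self {s : Vert.Xi n ≃g Vert.Xi n} (hs : s ∈ Vert.gensB n) : s * s = 1 := by
  rcases hs with ⟨i, j, -, rfl⟩ | ⟨i, -, rfl⟩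
  · exact transp_mul_self i j
  · exact flip_mul_self i

theorem gensD_mul_self {s : Vert.Xi n ≃g Vert.Xi n} (hs : s ∈ Vert.gensD n) : s * s = 1 := by
  rcases hs with ⟨i, j, -, rfl⟩ | ⟨i, j, -, -, rfl⟩
  · exact transp_mul_self i j
  · calc Vert.flip j * Vert.transp i j * Vert.flip j * (Vert.flip j * Vert.transp i j * Vert.flip j)
        = Vert.flip j * (Vert.transp i j * ((Vert.flip j * Vert.flip j) * Vert.transp i j)) *
          Vert.flip j := by simp only [mul_assoc]
      _ = 1 := by rw [flip_mul_self, one_mul, transp_mul_self, mul_one, flip_mul_self]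

theorem signParity_gensD {s : Vert.Xi n ≃g Vert.Xi n} (hs : s ∈ Vert.gensD n) :
    signParity s = 0 := by
  rcases hs with ⟨i, j, -, rfl⟩ | ⟨i, j, -, -, rfl⟩
  · exact signParity_transp i j
  · rw [signParity_mul, signParity_mul, signParity_flip, signParity_transp]
    decide

/-! ### Transitivity on pairs of cliques -/

open Classical in
theorem clq_ncard {A : Set (Vert n)} (hA : Clq A) :
    A.ncard = ∑ i : Fin n, if (i, true) ∈ A ∨ (i, false) ∈ A then 1 else 0 := by
  have h1 : (Prod.fst '' A).ncard = A.ncard := by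
    refine Set.InjOn.ncard_image ?_
    rintro ⟨i, b⟩ hb ⟨j, c⟩ hc (h : i = j)
    subst h
    by_cases hbc : b = c
    · rw [hbc]
    · have : (i, c) = Vert.opp (i, b) := by revert hbc; cases b <;> cases c <;> simp [Vert.opp]
      exact absurd (this ▸ hc) (hA _ hb)
  rw [← h1, ← Finset.card_filter, ← Set.ncard_coe_finset]
  congr 1
  ext i
  constructor
  · rintro ⟨⟨i, b⟩, hb, rfl⟩
    cases b <;> simp [hb]
  · intro h
    simp only [Finset.coe_filter, Finset.mem_univ, true_and, Set.mem_ofPred_eq] at h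
    rcases h with h | h
    · exact ⟨_, h, rfl⟩
    · exact ⟨_, h, rfl⟩

open Classical in
/-- A sign for the coordinate `i` that the clique `K`, or else the clique `L`, contains, if either
has a vertex there. -/
def baseSign (K L : Set (Vert n)) (i : Fin n) : Bool :=
  if (i, true) ∈ K then true else if (i, false) ∈ K then false else decide ((i, true) ∈ L)

open Classical in
/-- The position of the pair of cliques `K, L` in the coordinate `i`, up to a change of sign:
whether the base vertex is in `K`, whether it is in `L`, and whether its antipode is in `L`. -/
def color (K L : Set (Vert n)) (i : Fin n) : Bool × Bool × Bool :=
  (decide ((i, baseSign K L i) ∈ K), decide ((i, baseSign K L i) ∈ L),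
    decide ((i, !baseSign K L i) ∈ L))

theorem mem_left_iff_color {K L : Set (Vert n)} (hK : Clq K) (i : Fin n) (b : Bool) :
    (i, b) ∈ K ↔ (color K L i).1 = true ∧ xor b (baseSign K L i) = false := by
  have h := hK (i, true)
  have h' := hK (i, false)
  simp only [Vert.opp, Bool.not_true, Bool.not_false] at h h'
  unfold color baseSign
  by_cases h1 : (i, true) ∈ K
  · have h2 := h h1
    cases b <;> simp [h1, h2]
  · by_cases h2 : (i, false) ∈ K
    · cases b <;> simp [h1, h2]
    · by_cases h3 : (i, true) ∈ L <;> cases b <;> simp [h1, h2, h3]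

theorem mem_right_iff_color (K L : Set (Vert n)) (i : Fin n) (b : Bool) :
    (i, b) ∈ L ↔ if xor b (baseSign K L i) then (color K L i).2.2 = true
      else (color K L i).2.1 = true := by
  unfold color
  generalize baseSign K L i = c
  cases b <;> cases c <;> simp

open Classical in
/-- The number of coordinates of a given color. -/
def colorCount (K L : Set (Vert n)) (c : Bool × Bool × Bool) : ℕ :=
  ∑ i, if color K L i = c then 1 else 0

open Classical in
/-- Only five colors occur, and the cardinalities of the cliques are sums of numbers of coordinates
of these colors. -/
theorem colorCount_spec {K L : Set (Vert n)} (hK : Clq K) (hL : Clq L) :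
    K.ncard = colorCount K L (true, true, false) + colorCount K L (true, false, true) +
      colorCount K L (true, false, false) ∧
    L.ncard = colorCount K L (true, true, false) + colorCount K L (true, false, true) +
      colorCount K L (false, true, false) ∧
    (K ∩ L).ncard = colorCount K L (true, true, false) ∧
    (K ∪ nonOpp K L).ncard = colorCount K L (true, true, false) +
      colorCount K L (true, false, true) + colorCount K L (true, false, false) +
      colorCount K L (false, true, false) ∧
    n = colorCount K L (true, true, false) + colorCount K L (true, false, true) +
      colorCount K L (true, false, false) + colorCount K L (false, true, false) +
      colorCount K L (false, false, false) ∧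
    colorCount K L (true, true, true) = 0 ∧ colorCount K L (false, true, true) = 0 ∧
    colorCount K L (false, false, true) = 0 := by
  have hn : n = ∑ i : Fin n, 1 := by simp
  have hpt : ∀ i, ((i, true) ∈ L → (i, false) ∉ L) ∧ ((i, true) ∈ K → (i, false) ∉ K) :=
    fun i => ⟨fun h => hL _ h, fun h => hK _ h⟩
  rw [clq_ncard hK, clq_ncard hL, clq_ncard (hK.mono Set.inter_subset_left),
    clq_ncard (clq_union_nonOpp hK hL)]
  refine ⟨?_, ?_, ?_, ?_, ?_, ?_, ?_, ?_⟩
  on_goal 5 => conv_lhs => rw [hn]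
  on_goal 6 => refine Finset.sum_eq_zero fun i _ => ?_
  on_goal 7 => refine Finset.sum_eq_zero fun i _ => ?_
  on_goal 8 => refine Finset.sum_eq_zero fun i _ => ?_
  all_goals
    try simp only [colorCount, ← Finset.sum_add_distrib]
    try refine Finset.sum_congr rfl fun i _ => ?_
    obtain ⟨hl, hk⟩ := hpt i
    by_cases h1 : (i, true) ∈ K <;> by_cases h2 : (i, false) ∈ K <;>
    by_cases h3 : (i, true) ∈ L <;> by_cases h4 : (i, false) ∈ L <;>
    simp_all [color, baseSign, nonOpp, Vert.opp]

theorem colorCount_eq {K L A B : Set (Vert n)} (hK : Clq K) (hL : Clq L) (hA : Clq A) (hB : Clq B)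
    (h1 : K.ncard = A.ncard) (h2 : L.ncard = B.ncard) (h3 : (K ∩ L).ncard = (A ∩ B).ncard)
    (h4 : (K ∪ nonOpp K L).ncard = (A ∪ nonOpp A B).ncard) (c : Bool × Bool × Bool) :
    colorCount K L c = colorCount A B c := by
  obtain ⟨k1, k2, k3, k4, k5, k6, k7, k8⟩ := colorCount_spec hK hL
  obtain ⟨a1, a2, a3, a4, a5, a6, a7, a8⟩ := colorCount_spec hA hB
  rcases c with ⟨_ | _, _ | _, _ | _⟩ <;> omega

/-- The automorphism group of the cross-polytope is transitive on the pairs of cliques with given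
cardinalities. -/
theorem exists_aut {K L A B : Set (Vert n)} (hK : Clq K) (hL : Clq L) (hA : Clq A) (hB : Clq B)
    (h1 : K.ncard = A.ncard) (h2 : L.ncard = B.ncard) (h3 : (K ∩ L).ncard = (A ∩ B).ncard)
    (h4 : (K ∪ nonOpp K L).ncard = (A ∪ nonOpp A B).ncard) :
    ∃ u : Vert.Xi n ≃g Vert.Xi n, u '' K = A ∧ u '' L = B := by
  classical
  have hfib : ∀ c, Nonempty ({i // color K L i = c} ≃ {i // color A B i = c}) := by
    intro c
    rw [← Fintype.card_eq, Fintype.card_subtype, Fintype.card_subtype, Finset.card_filter,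
      Finset.card_filter]
    have := colorCount_eq hK hL hA hB h1 h2 h3 h4 c
    unfold colorCount at this
    convert this
  let e := fun c => Classical.choice (hfib c)
  have he := Equiv.ofFiberEquiv_map e
  set σ : Equiv.Perm (Fin n) := Equiv.ofFiberEquiv e
  set u := signedPerm σ fun i => xor (baseSign K L i) (baseSign A B (σ i))
  have hu : ∀ i b, xor (u (i, b)).2 (baseSign A B (u (i, b)).1) = xor b (baseSign K L i) := by
    intro i b
    simp only [u, signedPerm_apply]
    generalize baseSign K L i = x
    generalize baseSign A B (σ i) = y
    revert b x y
    decide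
  have hc : ∀ i b, color A B (u (i, b)).1 = color K L i := fun i b => he i
  have key : ∀ {S T : Set (Vert n)}, (∀ a, a ∈ S ↔ u a ∈ T) → u '' S = T := by
    intro S T h
    ext x
    constructor
    · rintro ⟨a, ha, rfl⟩
      exact (h a).1 ha
    · intro hx
      obtain ⟨a, rfl⟩ := u.surjective x
      exact ⟨a, (h a).2 hx, rfl⟩
  refine ⟨u, key ?_, key ?_⟩
  · rintro ⟨i, b⟩
    rw [mem_left_iff_color hK, ← Prod.mk.eta (p := u (i, b)), mem_left_iff_color hA, hu, hc]
  · rintro ⟨i, b⟩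
    rw [mem_right_iff_color K, ← Prod.mk.eta (p := u (i, b)), mem_right_iff_color A, hu, hc]

/-! ### The standard chambers -/

theorem initial_clq (m : ℕ) : Clq (Vert.initial n m) := by
  rintro ⟨i, b⟩ ⟨-, hb⟩ ⟨-, h⟩
  simp_all [Vert.opp]

theorem initial_ncard {m : ℕ} (hm : m ≤ n) : (Vert.initial n m).ncard = m := by
  have : Vert.initial n m = (fun i : Fin m => (Fin.castLE hm i, false)) '' Set.univ := by
    ext ⟨i, b⟩
    constructor
    · rintro ⟨h, rfl : b = false⟩
      exact ⟨⟨i, h⟩, trivial, rfl⟩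
    · rintro ⟨j, -, h⟩
      obtain ⟨rfl, rfl⟩ := Prod.ext_iff.1 h
      exact ⟨j.2, rfl⟩
  rw [this, Set.ncard_image_of_injective, Set.ncard_univ, Nat.card_fin]
  intro i j h
  exact Fin.castLE_injective hm (Prod.ext_iff.1 h).1

theorem initial_mono {m m' : ℕ} (h : m ≤ m') : Vert.initial n m ⊆ Vert.initial n m' :=
  fun _ ha => ⟨lt_of_lt_of_le ha.1 h, ha.2⟩

theorem twisted_eq_sec : Vert.twisted n = sec fun i : Fin n => decide ((i : ℕ) + 1 = n) := by
  ext ⟨i, b⟩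
  simp only [Vert.twisted, sec, Set.mem_ofPred_eq]
  by_cases h : (i : ℕ) + 1 = n <;> cases b <;> simp [h]

theorem twisted_clq : Clq (Vert.twisted n) := twisted_eq_sec (n := n) ▸ sec_clq _

theorem twisted_ncard : (Vert.twisted n).ncard = n := twisted_eq_sec (n := n) ▸ sec_ncard _

theorem initial_subset_twisted {m : ℕ} (h : m + 1 ≤ n) : Vert.initial n m ⊆ Vert.twisted n := by
  rintro ⟨i, b⟩ ⟨h1, h2⟩
  simp only at h1 h2
  subst h2
  simp only [Vert.twisted, Set.mem_ofPred_eq, Bool.false_eq_true, false_iff]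
  omega

theorem initial_inter_twisted : Vert.initial n n ∩ Vert.twisted n = Vert.initial n (n - 1) := by
  ext ⟨i, b⟩
  have := i.2
  cases b
  · simp [Vert.twisted, Vert.initial]; omega
  · simp [Vert.initial]

theorem flip_last_twisted {l : Fin n} (hl : (l : ℕ) + 1 = n) :
    Vert.flip l '' Vert.twisted n = Vert.initial n n := by
  refine Set.eq_of_subset_of_ncard_le ?_ ?_ (Set.toFinite _)
  · rintro _ ⟨⟨i, b⟩, h, rfl⟩
    rw [flip_apply]
    by_cases hi : i = l
    · subst hi
      have : b = true := by
        have := h.2 hl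
        exact this
      simp [this, Vert.initial, Vert.opp]
    · have : ¬ b = true := fun hb => hi (Fin.ext (by
        have := h.1 hb
        simp only at this
        omega))
      simpa [hi, Vert.initial] using this
  · rw [ncard_aut_image, twisted_ncard, initial_ncard le_rfl]

theorem image_eq_self {K : Set (Vert n)} {s : Vert.Xi n ≃g Vert.Xi n} (h : ∀ a ∈ K, s a ∈ K) :
    s '' K = K := by
  refine Set.eq_of_subset_of_ncard_le ?_ (ncard_aut_image K s).ge (Set.toFinite _)
  rintro _ ⟨a, ha, rfl⟩
  exact h a ha

theorem flip_image_eq_self {K : Set (Vert n)} {i : Fin n} (h : ∀ a ∈ K, a.1 ≠ i) :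
    Vert.flip i '' K = K :=
  image_eq_self fun a ha => by rwa [flip_apply, if_neg (h a ha)]

theorem transp_initial {m : ℕ} {i j : Fin n} (hij : (i : ℕ) + 1 = j) (hm : m ≠ j) :
    Vert.transp i j '' Vert.initial n m = Vert.initial n m := by
  refine image_eq_self ?_
  rintro ⟨l, b⟩ ⟨h1, h2⟩
  simp only at h1 h2
  rw [transp_apply]
  refine ⟨?_, h2⟩
  simp only [Equiv.swap_apply_def]
  split_ifs with h h'
  · subst h; omega
  · omega
  · exact h1

theorem transp_twisted {i j : Fin n} (hij : (i : ℕ) + 1 = j) (hj : (j : ℕ) + 1 ≠ n) :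
    Vert.transp i j '' Vert.twisted n = Vert.twisted n := by
  refine image_eq_self ?_
  rintro ⟨l, b⟩ h
  rw [transp_apply]
  simp only [Vert.twisted, Set.mem_ofPred_eq] at h ⊢
  rw [h, Equiv.swap_apply_def]
  have := j.2
  split_ifs with h1 h2
  · subst h1; omega
  · subst h2; omega
  · rfl

/-- Each generator of type `B_n` moves only one member of the standard chamber. -/
theorem gensB_fixes {s : Vert.Xi n ≃g Vert.Xi n} (hs : s ∈ Vert.gensB n) {K K' : Set (Vert n)}
    (hK : K ∈ Vert.stdChamberB n) (hK' : K' ∈ Vert.stdChamberB n) (hne : K ≠ K') :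
    s '' K = K ∨ s '' K' = K' := by
  obtain ⟨m, hm1, hmn, rfl⟩ := hK
  obtain ⟨m', hm1', hmn', rfl⟩ := hK'
  have hmm : m ≠ m' := by rintro rfl; exact hne rfl
  have hflip : ∀ (m : ℕ) (j : Fin n), m ≤ j → Vert.flip j '' Vert.initial n m =
      Vert.initial n m := fun m j hmj => flip_image_eq_self fun a ha e => by
    have := ha.1
    rw [e] at this
    omega
  rcases hs with ⟨i, j, hij, rfl⟩ | ⟨j, hj, rfl⟩
  · by_cases h : m = j
    · exact .inr (transp_initial hij (by omega))
    · exact .inl (transp_initial hij h)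
  · by_cases h : m = n
    · exact .inr (hflip _ _ (by omega))
    · exact .inl (hflip _ _ (by omega))

/-- The generator `s_n'` in coordinates. -/
theorem flip_transp_flip_apply {i j : Fin n} (hij : (i : ℕ) + 1 = j) (a : Vert n) :
    (Vert.flip j * Vert.transp i j * Vert.flip j) a =
      if a.1 = i then (j, !a.2) else if a.1 = j then (i, !a.2) else a := by
  have hne : i ≠ j := fun e => by rw [e] at hij; omega
  obtain ⟨l, b⟩ := a
  simp only [aut_mul_apply, flip_apply, transp_apply]
  by_cases h1 : l = i
  · subst h1; simp [hne, Vert.opp]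
  · by_cases h2 : l = j
    · subst h2; simp [hne, hne.symm, Vert.opp]
    · simp [h1, h2, Equiv.swap_apply_of_ne_of_ne h1 h2]

/-- Each generator of type `D_n` moves only one member of the standard chamber. -/
theorem gensD_fixes {s : Vert.Xi n ≃g Vert.Xi n} (hs : s ∈ Vert.gensD n) {K K' : Set (Vert n)}
    (hK : K ∈ Vert.stdChamberD n) (hK' : K' ∈ Vert.stdChamberD n) (hne : K ≠ K') :
    s '' K = K ∨ s '' K' = K' := by
  rcases hs with ⟨i, j, hij, rfl⟩ | ⟨i, j, hij, hj, rfl⟩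
  · have hj := j.2
    have h1 : ∀ K ∈ Vert.stdChamberD n, Vert.transp i j '' K = K ∨
        ((j : ℕ) + 1 = n ∧ K = Vert.twisted n) ∨ ((j : ℕ) + 1 ≠ n ∧ K = Vert.initial n j) := by
      rintro K (⟨m, hm1, hmn, rfl⟩ | rfl | rfl)
      · by_cases h : m = j
        · subst h
          exact .inr (.inr ⟨by omega, rfl⟩)
        · exact .inl (transp_initial hij h)
      · exact .inl (transp_initial hij (by omega))
      · by_cases h : (j : ℕ) + 1 = n
        · exact .inr (.inl ⟨h, rfl⟩)
        · exact .inl (transp_twisted hij h)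
    rcases h1 K hK with h | ⟨h, e⟩ | ⟨h, e⟩
    · exact .inl h
    · rcases h1 K' hK' with h' | ⟨h', e'⟩ | ⟨h', e'⟩
      · exact .inr h'
      · exact absurd (e.trans e'.symm) hne
      · exact absurd h h'
    · rcases h1 K' hK' with h' | ⟨h', e'⟩ | ⟨h', e'⟩
      · exact .inr h'
      · exact absurd h' h
      · exact absurd (e.trans e'.symm) hne
  · have h1 : ∀ K ∈ Vert.stdChamberD n,
        (Vert.flip j * Vert.transp i j * Vert.flip j) '' K = K ∨ K = Vert.initial n n := by
      rintro K (⟨m, hm1, hmn, rfl⟩ | rfl | rfl)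
      · left
        refine image_eq_self ?_
        rintro ⟨l, b⟩ ⟨hl, hb⟩
        simp only at hl hb
        rw [flip_transp_flip_apply hij, if_neg, if_neg]
        · exact ⟨hl, hb⟩
        · rintro rfl; simp only at hj; omega
        · rintro rfl; simp only at hij; omega
      · exact .inr rfl
      · left
        refine image_eq_self ?_
        rintro ⟨l, b⟩ h
        simp only [Vert.twisted, Set.mem_ofPred_eq] at h
        rw [flip_transp_flip_apply hij]
        split_ifs with h1 h2
        · simp only at h1
          subst h1
          have : ¬ b = true := fun hb => by
            have := h.1 hb
            omega
          simp [Vert.twisted, this, hj]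
        · simp only at h2
          subst h2
          have : b = true := h.2 hj
          simp only [Vert.twisted, Set.mem_ofPred_eq, this, Bool.not_true, Bool.false_eq_true,
            false_iff]
          omega
        · exact h
    rcases h1 K hK with h | e
    · exact .inl h
    · rcases h1 K' hK' with h' | e'
      · exact .inr h'
      · exact absurd (e.trans e'.symm) hne

end PolarSpace

namespace PolarSpace

variable {X : Type*} {n : ℕ} {Δ : PolarSpace X n}

/-! ### Chambers of an apartment -/

theorem isPartialFrame_comp {f : Vert n → X} (hf : Δ.IsPartialFrame f)
    (w : Vert.Xi n ≃g Vert.Xi n) : Δ.IsPartialFrame (f ∘ w) := by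
  intro a b
  rw [Function.comp, Function.comp, hf, ← aut_opp]
  exact w.injective.eq_iff

theorem std_clq {K : Set (Vert n)} (hK : K ∈ Δ.stdChamber) : Clq K := by
  unfold stdChamber at hK
  split_ifs at hK
  · rcases hK with ⟨m, -, -, rfl⟩ | rfl | rfl
    · exact initial_clq m
    · exact initial_clq n
    · exact twisted_clq
  · obtain ⟨m, -, -, rfl⟩ := hK
    exact initial_clq m

theorem std_ncard {K : Set (Vert n)} (hK : K ∈ Δ.stdChamber) :
    1 ≤ K.ncard ∧ (Δ.IsHyperbolic → K.ncard + 1 ≠ n) := by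
  have hn := Δ.two_le
  unfold stdChamber at hK
  split_ifs at hK with hyp
  · rcases hK with ⟨m, h1, h2, rfl⟩ | rfl | rfl
    · rw [initial_ncard (by omega)]; omega
    · rw [initial_ncard le_rfl]; omega
    · rw [twisted_ncard]; omega
  · obtain ⟨m, h1, h2, rfl⟩ := hK
    rw [initial_ncard h2]
    exact ⟨h1, fun h => absurd h hyp⟩

theorem isElement_iff {U : Set X} :
    Δ.IsElement U ↔ U ∈ Δ.Ω ∧ 1 ≤ Δ.rk U ∧ (Δ.IsHyperbolic → Δ.rk U + 1 ≠ n) := by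
  unfold IsElement
  refine and_congr_right fun hU => and_congr ⟨fun ⟨x, hx⟩ => rk_pos hU hx, nonempty_of_rk⟩ ?_
  rw [dim_eq]
  refine imp_congr_right fun _ => not_congr ?_
  omega

theorem isElement_span_clique {f : Vert n → X} (hf : Δ.IsPartialFrame f) {K : Set (Vert n)}
    (hK : Clq K) (h : 1 ≤ K.ncard ∧ (Δ.IsHyperbolic → K.ncard + 1 ≠ n)) :
    Δ.IsElement (Δ.span (f '' K)) := by
  obtain ⟨h1, h2⟩ := span_clique hf hK
  rw [isElement_iff, h2]
  exact ⟨h1, h⟩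

theorem incident_comm {U V : Set X} (h : Δ.Incident U V) : Δ.Incident V U := by
  rcases h with h | h | ⟨h1, h2, h3, h4⟩
  · exact .inr (.inl h)
  · exact .inl h
  · exact .inr (.inr ⟨h1, h3, h2, by rwa [Set.inter_comm]⟩)

theorem isMSS_span_clique {f : Vert n → X} (hf : Δ.IsPartialFrame f) {K : Set (Vert n)}
    (hK : Clq K) (h : K.ncard = n) : Δ.IsMSS (Δ.span (f '' K)) := by
  rw [isMSS_iff]
  obtain ⟨h1, h2⟩ := span_clique hf hK
  exact ⟨h1, h2.trans h⟩

theorem incident_initial_twisted (hyp : Δ.IsHyperbolic) {f : Vert n → X}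
    (hf : Δ.IsPartialFrame f) :
    Δ.Incident (Δ.span (f '' Vert.initial n n)) (Δ.span (f '' Vert.twisted n)) := by
  have hn := Δ.two_le
  refine .inr (.inr ⟨hyp, isMSS_span_clique hf (initial_clq n) (initial_ncard le_rfl),
    isMSS_span_clique hf twisted_clq twisted_ncard, ?_⟩)
  rw [span_clique_inter hf (initial_clq n) twisted_clq, initial_inter_twisted, dim_eq,
    (span_clique hf (initial_clq _)).2, initial_ncard (by omega)]
  omega

theorem incident_span_std {f : Vert n → X} (hf : Δ.IsPartialFrame f) {K K' : Set (Vert n)}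
    (hK : K ∈ Δ.stdChamber) (hK' : K' ∈ Δ.stdChamber) :
    Δ.Incident (Δ.span (f '' K)) (Δ.span (f '' K')) := by
  have mono : ∀ {A B : Set (Vert n)}, A ⊆ B → Δ.Incident (Δ.span (f '' A)) (Δ.span (f '' B)) :=
    fun h => .inl (span_mono (Set.image_mono h))
  have tot : ∀ m m', Δ.Incident (Δ.span (f '' Vert.initial n m))
      (Δ.span (f '' Vert.initial n m')) := by
    intro m m'
    rcases le_total m m' with h | h
    · exact mono (initial_mono h)
    · exact incident_comm (mono (initial_mono h))
  unfold stdChamber at hK hK'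
  split_ifs at hK hK' with hyp
  · rcases hK with ⟨m, -, hm, rfl⟩ | rfl | rfl <;> rcases hK' with ⟨m', -, hm', rfl⟩ | rfl | rfl
    · exact tot _ _
    · exact tot _ _
    · exact mono (initial_subset_twisted (by omega))
    · exact tot _ _
    · exact tot _ _
    · exact incident_initial_twisted hyp hf
    · exact incident_comm (mono (initial_subset_twisted (by omega)))
    · exact incident_comm (incident_initial_twisted hyp hf)
    · exact mono subset_rfl
  · obtain ⟨m, -, -, rfl⟩ := hK
    obtain ⟨m', -, -, rfl⟩ := hK'
    exact tot _ _

theorem eq_of_incident {U V : Set X} (hU : U ∈ Δ.Ω) (hV : V ∈ Δ.Ω) (h : Δ.Incident U V)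
    (hr : Δ.rk U = Δ.rk V) (h' : Δ.IsHyperbolic → Δ.rk U < n) : U = V := by
  rcases h with h | h | ⟨hyp, h1, -, -⟩
  · exact eq_of_rk_le hU hV h hr.ge
  · exact (eq_of_rk_le hV hU h hr.le).symm
  · have := h' hyp
    rw [isMSS_iff] at h1
    omega

/-- The singular subspaces spanned by the members of the standard chamber form a maximal flag: an
element incident with all of them has the dimension of one of them and so is equal to it. In the
hyperbolic case a maximal singular subspace different from the two in the flag would be adjacent to
both, but three maximal singular subspaces are never pairwise adjacent. -/
theorem isChamber_realize {f : Vert n → X} (hf : Δ.IsPartialFrame f) :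
    Δ.IsChamber (Δ.realize f Δ.stdChamber) := by
  have hn := Δ.two_le
  refine ⟨⟨?_, ?_⟩, ?_⟩
  · rintro _ ⟨K, hK, rfl⟩
    exact isElement_span_clique hf (std_clq hK) (std_ncard hK)
  · rintro _ ⟨K, hK, rfl⟩ _ ⟨K', hK', rfl⟩
    exact incident_span_std hf hK hK'
  rintro F ⟨hF1, hF2⟩ hsub U hU
  obtain ⟨hUΩ, hU1, hU2⟩ := isElement_iff.1 (hF1 U hU)
  have hUn := rk_le hUΩ
  have hmem : ∀ K ∈ Δ.stdChamber, Δ.Incident U (Δ.span (f '' K)) := fun K hK =>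
    hF2 U hU _ (hsub ⟨K, hK, rfl⟩)
  have hinit : Vert.initial n (Δ.rk U) ∈ Δ.stdChamber → (Δ.IsHyperbolic → Δ.rk U < n) →
      U ∈ Δ.realize f Δ.stdChamber := by
    intro h1 h2
    obtain ⟨h3, h4⟩ := span_clique hf (initial_clq (n := n) (Δ.rk U))
    rw [initial_ncard hUn] at h4
    exact ⟨_, h1, (eq_of_incident hUΩ h3 (hmem _ h1) h4.symm h2).symm⟩
  by_cases hyp : Δ.IsHyperbolic
  swap
  · refine hinit ?_ fun h => absurd h hyp
    simp only [stdChamber, hyp, if_false]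
    exact ⟨_, hU1, hUn, rfl⟩
  by_cases hr : Δ.rk U < n
  · refine hinit ?_ fun _ => hr
    simp only [stdChamber, hyp, if_true]
    have := hU2 hyp
    exact .inl ⟨_, hU1, by omega, rfl⟩
  have hr' : Δ.rk U = n := by omega
  have hUM : Δ.IsMSS U := isMSS_iff.2 ⟨hUΩ, hr'⟩
  have hP : Vert.initial n n ∈ Δ.stdChamber := by
    simp only [stdChamber, hyp, if_true]; exact .inr (.inl rfl)
  have hQ : Vert.twisted n ∈ Δ.stdChamber := by
    simp only [stdChamber, hyp, if_true]; exact .inr (.inr rfl)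
  have eq_or_adj : ∀ K ∈ Δ.stdChamber, K.ncard = n → U = Δ.span (f '' K) ∨
      Δ.rk (U ∩ Δ.span (f '' K)) + 1 = n := by
    intro K hK hKn
    obtain ⟨h1, h2⟩ := span_clique hf (std_clq hK)
    rcases hmem K hK with h | h | ⟨-, -, -, h⟩
    · exact .inl (eq_of_rk_le hUΩ h1 h (by omega))
    · exact .inl (eq_of_rk_le h1 hUΩ h (by omega)).symm
    · rw [dim_eq] at h
      right; omega
  rcases eq_or_adj _ hP (initial_ncard le_rfl) with h | h
  · exact ⟨_, hP, h.symm⟩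
  rcases eq_or_adj _ hQ twisted_ncard with h' | h'
  · exact ⟨_, hQ, h'.symm⟩
  -- three pairwise adjacent maximal singular subspaces cannot exist in the hyperbolic case
  have hP' := isMSS_iff.1 (isMSS_span_clique hf (initial_clq n) (initial_ncard le_rfl))
  have hQ' := isMSS_iff.1 (isMSS_span_clique hf twisted_clq twisted_ncard)
  have hPQ : Δ.rk (Δ.span (f '' Vert.initial n n) ∩ Δ.span (f '' Vert.twisted n)) + 1 = n := by
    rw [span_clique_inter hf (initial_clq n) twisted_clq, initial_inter_twisted,
      (span_clique hf (initial_clq _)).2, initial_ncard (by omega)]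
    omega
  have := rk_inter_adjacent hyp hUΩ hr' hP'.1 hP'.2 hQ'.1 hQ'.2 hPQ
  omega

/-! ### Types of the subspaces of an apartment -/

open Classical in
theorem type_of_top (hyp : Δ.IsHyperbolic) (M₀ : Set X) {U : Set X} (hU : Δ.rk U = n) :
    Δ.type M₀ U = if Δ.SameFamily M₀ U then .prime else .doublePrime :=
  if_pos (⟨hyp, dim_eq_top_iff.2 hU⟩ : Δ.IsHyperbolic ∧ Δ.dim U = n - 1)

theorem type_of_not_top (M₀ : Set X) {U : Set X} (h : ¬ (Δ.IsHyperbolic ∧ Δ.rk U = n)) :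
    Δ.type M₀ U = .dim (Δ.dim U) := by
  rw [← dim_eq_top_iff] at h
  exact if_neg h

theorem rk_of_type_eq {M₀ U V : Set X} (h : Δ.type M₀ U = Δ.type M₀ V) : Δ.rk U = Δ.rk V := by
  by_cases hU : Δ.IsHyperbolic ∧ Δ.rk U = n <;> by_cases hV : Δ.IsHyperbolic ∧ Δ.rk V = n
  · rw [hU.2, hV.2]
  · rw [type_of_top hU.1 M₀ hU.2, type_of_not_top M₀ hV] at h
    split_ifs at h
  · rw [type_of_top hV.1 M₀ hV.2, type_of_not_top M₀ hU] at h
    split_ifs at h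
  · rw [type_of_not_top M₀ hU, type_of_not_top M₀ hV, BuildingType.dim.injEq, dim_eq, dim_eq] at h
    omega

theorem type_eq_prime_iff (hyp : Δ.IsHyperbolic) {M₀ U : Set X} (hU : Δ.rk U = n) :
    Δ.type M₀ U = .prime ↔ Δ.SameFamily M₀ U := by
  rw [type_of_top hyp M₀ hU]
  split_ifs with h <;> simp [h]

theorem type_eq_iff (hyp : Δ.IsHyperbolic) {M₀ U V : Set X} (hU : Δ.rk U = n)
    (hV : Δ.rk V = n) :
    Δ.type M₀ U = Δ.type M₀ V ↔ (Δ.SameFamily M₀ U ↔ Δ.SameFamily M₀ V) := by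
  rw [type_of_top hyp M₀ hU, type_of_top hyp M₀ hV]
  split_ifs with h h' h' <;> simp [h, h']

theorem type_eq_of_rk {M₀ U V : Set X} (h : Δ.rk U = Δ.rk V) (h' : Δ.IsHyperbolic → Δ.rk U ≠ n) :
    Δ.type M₀ U = Δ.type M₀ V := by
  rw [type_of_not_top M₀ fun hc => h' hc.1 hc.2,
    type_of_not_top M₀ fun hc => h' hc.1 (h.trans hc.2), dim_eq, dim_eq, h]

theorem rk_span_sec {f : Vert n → X} (hf : Δ.IsPartialFrame f) (κ : Fin n → Bool) :
    Δ.rk (Δ.span (f '' sec κ)) = n := by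
  rw [(span_clique hf (sec_clq κ)).2, sec_ncard]

/-- The family of the maximal singular subspace spanned by a maximal clique depends only on the
parity of the clique. -/
theorem sameFamily_span_sec (hyp : Δ.IsHyperbolic) {M₀ : Set X} (hM₀ : Δ.IsMSS M₀)
    {f : Vert n → X} (hf : Δ.IsPartialFrame f) (κ κ' : Fin n → Bool) :
    (Δ.SameFamily M₀ (Δ.span (f '' sec κ)) ↔ Δ.SameFamily M₀ (Δ.span (f '' sec κ'))) ↔
      parity κ = parity κ' := by
  classical
  -- passing from `s` to `insert a s` leads to an adjacent subspace and changes the parity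
  have key : ∀ s : Finset (Fin n),
      Δ.SameFamily M₀ (Δ.span (f '' sec fun i => decide (i ∈ s))) ↔
        (Δ.SameFamily M₀ (Δ.span (f '' sec fun _ => false)) ↔
          parity (fun i : Fin n => decide (i ∈ s)) = 0) := by
    intro s
    induction s using Finset.induction_on with
    | empty => simp [parity, bit]
    | @insert a s ha ih =>
      have hp : parity (fun i : Fin n => decide (i ∈ insert a s)) =
          parity (fun i : Fin n => decide (i ∈ s)) + 1 := by
        unfold parity bit
        simp only [decide_eq_true_eq, Finset.sum_ite_mem, Finset.univ_inter, Finset.sum_const,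
          Finset.card_insert_of_notMem ha, nsmul_eq_mul, mul_one, Nat.cast_add, Nat.cast_one]
      have hint : sec (fun i : Fin n => decide (i ∈ insert a s)) ∩
          sec (fun i : Fin n => decide (i ∈ s)) =
          sec (fun i : Fin n => decide (i ∈ s)) \ {(a, false)} := by
        ext ⟨i, b⟩
        simp only [sec, Set.mem_inter_iff, Set.mem_ofPred_eq, Finset.mem_insert, Set.mem_sdiff,
          Set.mem_singleton_iff, Prod.mk.injEq]
        by_cases hi : i = a
        · subst hi; cases b <;> simp [ha]
        · simp [hi]
      have hadj := sameFamily_adjacent hyp hM₀ (isMSS_span_clique hf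
        (sec_clq fun i => decide (i ∈ insert a s)) (sec_ncard _))
        (isMSS_span_clique hf (sec_clq fun i => decide (i ∈ s)) (sec_ncard _)) (by
          have hpos := a.pos
          rw [span_clique_inter hf (sec_clq _) (sec_clq _),
            (span_clique hf ((sec_clq _).mono Set.inter_subset_left)).2, hint,
            Set.ncard_sdiff_singleton_of_mem (by simp [sec, ha]), sec_ncard]
          omega)
      have hz : ∀ x : ZMod 2, x + 1 = 0 ↔ ¬ x = 0 := by decide
      rw [hadj, ih, hp, hz]
      by_cases h0 : Δ.SameFamily M₀ (Δ.span (f '' sec fun _ => false)) <;>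
      simp only [h0, true_iff, false_iff]
  have key' : ∀ κ : Fin n → Bool, Δ.SameFamily M₀ (Δ.span (f '' sec κ)) ↔
      (Δ.SameFamily M₀ (Δ.span (f '' sec fun _ => false)) ↔ parity κ = 0) := by
    intro κ
    have := key (Finset.univ.filter fun i => κ i = true)
    simpa using this
  have hz : ∀ x y : ZMod 2, x = y ↔ (x = 0 ↔ y = 0) := by decide
  rw [key' κ, key' κ', hz (parity κ) (parity κ')]
  by_cases h0 : Δ.SameFamily M₀ (Δ.span (f '' sec fun _ => false)) <;> simp only [h0, true_iff,
    false_iff, not_iff_not]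

/-- The frame `f` is numbered such that the type `(n-1)'` belongs to the clique
`{ξ_1, …, ξ_{n-1}, ξ_{-n}}`; a condition in the hyperbolic case only. -/
def IsTyped (Δ : PolarSpace X n) (M₀ : Set X) (f : Vert n → X) : Prop :=
  Δ.IsHyperbolic → Δ.type M₀ (Δ.span (f '' Vert.twisted n)) = .prime

theorem isTyped_iff {M₀ : Set X} {f : Vert n → X} (hf : Δ.IsPartialFrame f) :
    Δ.IsTyped M₀ f ↔
      (Δ.IsHyperbolic → Δ.SameFamily M₀ (Δ.span (f '' Vert.twisted n))) := by
  refine imp_congr_right fun hyp => type_eq_prime_iff hyp ?_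
  rw [(span_clique hf twisted_clq).2, twisted_ncard]

theorem type_span_clique {M₀ : Set X} (hM₀ : Δ.IsMSS M₀) {f g : Vert n → X}
    (hf : Δ.IsPartialFrame f) (hg : Δ.IsPartialFrame g) (hft : Δ.IsTyped M₀ f)
    (hgt : Δ.IsTyped M₀ g) {A : Set (Vert n)} (hA : Clq A) :
    Δ.type M₀ (Δ.span (f '' A)) = Δ.type M₀ (Δ.span (g '' A)) := by
  have hr : Δ.rk (Δ.span (f '' A)) = Δ.rk (Δ.span (g '' A)) := by
    rw [(span_clique hf hA).2, (span_clique hg hA).2]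
  by_cases h : Δ.IsHyperbolic ∧ A.ncard = n
  · obtain ⟨hyp, hAn⟩ := h
    obtain ⟨κ, rfl⟩ := exists_sec hA hAn.ge
    rw [type_eq_iff hyp (rk_span_sec hf κ) (rk_span_sec hg κ)]
    have h1 := (isTyped_iff hf).1 hft hyp
    have h2 := (isTyped_iff hg).1 hgt hyp
    rw [twisted_eq_sec] at h1 h2
    have h3 := sameFamily_span_sec hyp hM₀ hf κ fun i => decide ((i : ℕ) + 1 = n)
    have h4 := sameFamily_span_sec hyp hM₀ hg κ fun i => decide ((i : ℕ) + 1 = n)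
    tauto
  · refine type_eq_of_rk hr fun hyp hc => h ⟨hyp, ?_⟩
    rwa [(span_clique hf hA).2] at hc

/-- Renumbering a frame by `u` keeps the families of the subspaces spanned by maximal cliques if and
only if `u` has an even number of sign changes. -/
theorem isTyped_comp_iff {M₀ : Set X} (hM₀ : Δ.IsMSS M₀) {f : Vert n → X}
    (hf : Δ.IsPartialFrame f) (u : Vert.Xi n ≃g Vert.Xi n) (hyp : Δ.IsHyperbolic)
    (κ : Fin n → Bool) :
    (Δ.SameFamily M₀ (Δ.span (f '' sec κ)) ↔
      Δ.SameFamily M₀ (Δ.span ((f ∘ u) '' sec κ))) ↔ signParity u = 0 := by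
  obtain ⟨κ', h1, h2⟩ := image_sec u κ
  rw [Set.image_comp, h1, sameFamily_span_sec hyp hM₀ hf, h2]
  exact left_eq_add

theorem IsTyped.comp {M₀ : Set X} (hM₀ : Δ.IsMSS M₀) {f : Vert n → X} (hf : Δ.IsPartialFrame f)
    (hft : Δ.IsTyped M₀ f) {u : Vert.Xi n ≃g Vert.Xi n}
    (hu : Δ.IsHyperbolic → signParity u = 0) : Δ.IsTyped M₀ (f ∘ u) := by
  rw [isTyped_iff hf] at hft
  rw [isTyped_iff (isPartialFrame_comp hf u)]
  intro hyp
  have h1 := hft hyp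
  rw [twisted_eq_sec] at h1 ⊢
  exact ((isTyped_comp_iff hM₀ hf u hyp _).2 (hu hyp)).1 h1

/-- If the numbering of a frame does not respect the types, a sign change repairs it. -/
theorem isTyped_or_comp_flip {M₀ : Set X} (hM₀ : Δ.IsMSS M₀) {f : Vert n → X}
    (hf : Δ.IsPartialFrame f) (i : Fin n) :
    Δ.IsTyped M₀ f ∨ Δ.IsTyped M₀ (f ∘ Vert.flip i) := by
  rw [isTyped_iff hf, isTyped_iff (isPartialFrame_comp hf _)]
  by_cases hyp : Δ.IsHyperbolic
  swap
  · exact .inl fun h => absurd h hyp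
  have h := isTyped_comp_iff hM₀ hf (Vert.flip i) hyp fun i => decide ((i : ℕ) + 1 = n)
  rw [signParity_flip, ← twisted_eq_sec] at h
  have : ¬ (1 : ZMod 2) = 0 := by decide
  tauto

/-! ### Weyl distances -/

/-- The data that realise the Weyl distance `w` from `U` to `V`: a typed frame that
identifies `U` with a member `K` of the standard chamber and `V` with the image under `w` of a
member `K'`. -/
structure Realizes (Δ : PolarSpace X n) (M₀ : Set X) (w : Vert.Xi n ≃g Vert.Xi n)
    (K K' : Set (Vert n)) (U V : Set X) (f : Vert n → X) : Prop where
  frame : Δ.IsPartialFrame f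
  left_mem : K ∈ Δ.stdChamber
  right_mem : K' ∈ Δ.stdChamber
  left_eq : U = Δ.span (f '' K)
  right_eq : V = Δ.span (f '' (w '' K'))
  parity : Δ.IsHyperbolic → signParity w = 0
  typed : Δ.IsTyped M₀ f

theorem realize_image (f : Vert n → X) (w : Vert.Xi n ≃g Vert.Xi n) (c : Set (Set (Vert n))) :
    Δ.realize f ((fun K => w '' K) '' c) = Δ.realize (f ∘ w) c := by
  unfold realize
  rw [Set.image_image]
  simp only [Set.image_comp]

theorem mem_distances_iff {M₀ U V : Set X} {w : Vert.Xi n ≃g Vert.Xi n} :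
    w ∈ Δ.distances M₀ U V ↔ ∃ K K' f, Δ.Realizes M₀ w K K' U V f := by
  constructor
  · rintro ⟨C, C', -, -, hU, hV, f, hf, rfl, rfl, hyp⟩
    obtain ⟨K, hK, rfl⟩ := hU
    obtain ⟨_, ⟨K', hK', rfl⟩, rfl⟩ := hV
    exact ⟨K, K', f, isFrame_iff.1 hf, hK, hK', rfl, rfl,
      fun h => (preservesClasses_iff w).1 (hyp h).1, fun h => (hyp h).2⟩
  · rintro ⟨K, K', f, hf, hK, hK', rfl, rfl, hw, ht⟩
    refine ⟨Δ.realize f Δ.stdChamber, Δ.realize f ((fun K => w '' K) '' Δ.stdChamber),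
      isChamber_realize hf, ?_, ⟨K, hK, rfl⟩, ⟨_, ⟨K', hK', rfl⟩, rfl⟩, f,
      isFrame_iff.2 hf, rfl, rfl, fun h => ⟨(preservesClasses_iff w).2 (hw h), ht h⟩⟩
    have := isChamber_realize (isPartialFrame_comp hf w)
    rwa [← realize_image] at this

theorem gens_mul_self {s : Vert.Xi n ≃g Vert.Xi n} (hs : s ∈ Δ.gens) : s * s = 1 := by
  unfold gens at hs
  split_ifs at hs
  · exact gensD_mul_self hs
  · exact gensB_mul_self hs

theorem signParity_gens {s : Vert.Xi n ≃g Vert.Xi n} (hs : s ∈ Δ.gens) (hyp : Δ.IsHyperbolic) :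
    signParity s = 0 := by
  rw [gens, if_pos hyp] at hs
  exact signParity_gensD hs

theorem mem_closure_gens {w : Vert.Xi n ≃g Vert.Xi n} (hw : Δ.IsHyperbolic → signParity w = 0) :
    w ∈ Submonoid.closure Δ.gens := by
  unfold gens
  split_ifs with hyp
  · exact mem_closure_gensD Δ.two_le (hw hyp)
  · exact mem_closure_gensB Δ.two_le w

theorem gens_fixes {s : Vert.Xi n ≃g Vert.Xi n} (hs : s ∈ Δ.gens) {K K' : Set (Vert n)}
    (hK : K ∈ Δ.stdChamber) (hK' : K' ∈ Δ.stdChamber) (hne : K ≠ K') :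
    s '' K = K ∨ s '' K' = K' := by
  unfold gens at hs
  unfold stdChamber at hK hK'
  split_ifs at hs hK hK'
  · exact gensD_fixes hs hK hK' hne
  · exact gensB_fixes hs hK hK' hne

theorem aut_mul_image (w v : Vert.Xi n ≃g Vert.Xi n) (K : Set (Vert n)) :
    (w * v) '' K = w '' (v '' K) := by
  rw [← Set.image_comp]; rfl

theorem aut_one_image (K : Set (Vert n)) : (1 : Vert.Xi n ≃g Vert.Xi n) '' K = K :=
  Set.image_id K

/-- A generator fixing `K` may be multiplied to a Weyl distance from the left. -/
theorem Realizes.mul_left {M₀ : Set X} (hM₀ : Δ.IsMSS M₀) {w : Vert.Xi n ≃g Vert.Xi n}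
    {K K' : Set (Vert n)} {U V : Set X} {f : Vert n → X} (h : Δ.Realizes M₀ w K K' U V f)
    {s : Vert.Xi n ≃g Vert.Xi n} (hs : s ∈ Δ.gens) (hsK : s '' K = K) :
    Δ.Realizes M₀ (s * w) K K' U V (f ∘ s) where
  frame := isPartialFrame_comp h.frame s
  left_mem := h.left_mem
  right_mem := h.right_mem
  left_eq := by rw [Set.image_comp, hsK, h.left_eq]
  right_eq := by
    rw [Set.image_comp, ← aut_mul_image, ← mul_assoc, gens_mul_self hs, one_mul, h.right_eq]
  parity hyp := by rw [signParity_mul, signParity_gens hs hyp, h.parity hyp, add_zero]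
  typed := h.typed.comp hM₀ h.frame fun hyp => signParity_gens hs hyp

/-- A generator fixing `K'` may be multiplied to a Weyl distance from the right. -/
theorem Realizes.mul_right {M₀ : Set X} {w : Vert.Xi n ≃g Vert.Xi n}
    {K K' : Set (Vert n)} {U V : Set X} {f : Vert n → X} (h : Δ.Realizes M₀ w K K' U V f)
    {s : Vert.Xi n ≃g Vert.Xi n} (hs : s ∈ Δ.gens) (hsK : s '' K' = K') :
    Δ.Realizes M₀ (w * s) K K' U V f where
  frame := h.frame
  left_mem := h.left_mem
  right_mem := h.right_mem
  left_eq := h.left_eq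
  right_eq := by rw [aut_mul_image, hsK, h.right_eq]
  parity hyp := by rw [signParity_mul, signParity_gens hs hyp, h.parity hyp, add_zero]
  typed := h.typed

/-- If a Weyl distance is minimal for two pairs of elements and not the identity, then its left and
right descents determine the types of the elements. -/
theorem Realizes.eq_of_minimal {M₀ : Set X} (hM₀ : Δ.IsMSS M₀) {w : Vert.Xi n ≃g Vert.Xi n}
    {K K' L L' : Set (Vert n)} {I J I' J' : Set X} {f g : Vert n → X}
    (h : Δ.Realizes M₀ w K K' I J f) (h' : Δ.Realizes M₀ w L L' I' J' g)
    (hmin : ∀ w' ∈ Δ.distances M₀ I J, wordLength Δ.gens w ≤ wordLength Δ.gens w')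
    (hmin' : ∀ w' ∈ Δ.distances M₀ I' J', wordLength Δ.gens w ≤ wordLength Δ.gens w')
    (hw : w ≠ 1) : K = L ∧ K' = L' := by
  -- a generator that shortens `w` fixes one of the two members of the standard chamber, and then
  -- multiplying by it gives a shorter distance for the corresponding pair
  have hmem := mem_closure_gens h.parity
  constructor
  · by_contra hne
    obtain ⟨s, hs, hlt⟩ := exists_mul_left_shorter (fun _ => gens_mul_self) hmem hw
    rcases gens_fixes hs h.left_mem h'.left_mem hne with hf | hf
    · exact absurd hlt (hmin _ (mem_distances_iff.2 ⟨_, _, _, h.mul_left hM₀ hs hf⟩)).not_gt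
    · exact absurd hlt (hmin' _ (mem_distances_iff.2 ⟨_, _, _, h'.mul_left hM₀ hs hf⟩)).not_gt
  · by_contra hne
    obtain ⟨s, hs, hlt⟩ := exists_mul_right_shorter (fun _ => gens_mul_self) hmem hw
    rcases gens_fixes hs h.right_mem h'.right_mem hne with hf | hf
    · exact absurd hlt (hmin _ (mem_distances_iff.2 ⟨_, _, _, h.mul_right hs hf⟩)).not_gt
    · exact absurd hlt (hmin' _ (mem_distances_iff.2 ⟨_, _, _, h'.mul_right hs hf⟩)).not_gt

/-- The identity is a Weyl distance for flags only. -/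
theorem Realizes.isFlag {M₀ : Set X} {K K' : Set (Vert n)} {U V : Set X} {f : Vert n → X}
    (h : Δ.Realizes M₀ 1 K K' U V f) : Δ.IsFlag {U, V} := by
  obtain ⟨h1, h2⟩ := (isChamber_realize h.frame).1
  have hsub : ({U, V} : Set (Set X)) ⊆ Δ.realize f Δ.stdChamber := by
    rintro W (rfl | rfl)
    · exact ⟨K, h.left_mem, h.left_eq.symm⟩
    · exact ⟨K', h.right_mem, by rw [h.right_eq, aut_one_image]⟩
  exact ⟨fun W hW => h1 W (hsub hW), fun W hW W' hW' => h2 W (hsub hW) W' (hsub hW')⟩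

/-- An element spanned by points of a frame corresponds to a member of the standard chamber, for a
suitable renumbering of the frame. -/
theorem exists_aut_std {M₀ : Set X} (hM₀ : Δ.IsMSS M₀) {g : Vert n → X}
    (hg : Δ.IsPartialFrame g) {A : Set (Vert n)} (hA : Clq A) (hE : Δ.IsElement (Δ.span (g '' A))) :
    ∃ u : Vert.Xi n ≃g Vert.Xi n, ∃ K ∈ Δ.stdChamber, u '' K = A ∧ Δ.IsTyped M₀ (g ∘ u) := by
  have hn := Δ.two_le
  obtain ⟨-, h1, h2⟩ := isElement_iff.1 hE
  rw [(span_clique hg hA).2] at h1 h2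
  have hAn := ncard_clq_le hA
  set m := A.ncard with hm
  have hcard : (Vert.initial n m).ncard = m := initial_ncard hAn
  have hclq := initial_clq (n := n) m
  have hno : ∀ {B : Set (Vert n)}, Clq B → B ∪ nonOpp B B = B := fun hB =>
    Set.union_eq_left.2 fun b hb => hb.1
  obtain ⟨u, hu, -⟩ := exists_aut hclq hclq hA hA hcard hcard
    (by rw [Set.inter_self, Set.inter_self, hcard]) (by rw [hno hclq, hno hA, hcard])
  let l : Fin n := ⟨n - 1, by omega⟩
  have hl : (l : ℕ) + 1 = n := by simp only [l]; omega
  by_cases hyp : Δ.IsHyperbolic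
  swap
  · refine ⟨u, _, ?_, hu, fun h => absurd h hyp⟩
    simp only [stdChamber, hyp, if_false]
    exact ⟨m, h1, hAn, rfl⟩
  have h3 := h2 hyp
  have hstd : Vert.initial n m ∈ Δ.stdChamber := by
    simp only [stdChamber, hyp, if_true]
    by_cases hmn : m = n
    · rw [hmn]; exact .inr (.inl rfl)
    · exact .inl ⟨m, h1, by omega, rfl⟩
  rcases isTyped_or_comp_flip hM₀ (isPartialFrame_comp hg u) l with ht | ht
  · exact ⟨u, _, hstd, hu, ht⟩
  by_cases hmn : m = n
  · refine ⟨u * Vert.flip l, Vert.twisted n, ?_, ?_, ht⟩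
    · simp only [stdChamber, hyp, if_true]
      exact .inr (.inr rfl)
    · rw [aut_mul_image, flip_last_twisted hl, ← hu, hmn]
  · refine ⟨u * Vert.flip l, _, hstd, ?_, ht⟩
    rw [aut_mul_image, flip_image_eq_self, hu]
    intro a ha e
    have := ha.1
    rw [e] at this
    omega

theorem distances_nonempty {M₀ : Set X} (hM₀ : Δ.IsMSS M₀) {I J : Set X} (hI : Δ.IsElement I)
    (hJ : Δ.IsElement J) : (Δ.distances M₀ I J).Nonempty := by
  obtain ⟨g, hg, A, B, hA, hB, rfl, rfl⟩ := exists_frame hI.1 hJ.1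
  obtain ⟨u, K, hK, rfl, hut⟩ := exists_aut_std hM₀ hg hA hI
  obtain ⟨v, K', hK', rfl, hvt⟩ := exists_aut_std hM₀ hg hB hJ
  refine ⟨u⁻¹ * v, mem_distances_iff.2 ⟨K, K', g ∘ u, isPartialFrame_comp hg u, hK, hK', ?_, ?_,
    ?_, hut⟩⟩
  · rw [Set.image_comp]
  · rw [Set.image_comp, ← aut_mul_image, mul_inv_cancel_left]
  · intro hyp
    have h1 := (isTyped_iff (isPartialFrame_comp hg u)).1 hut hyp
    have h2 := (isTyped_iff (isPartialFrame_comp hg v)).1 hvt hyp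
    rw [twisted_eq_sec] at h1 h2
    refine (isTyped_comp_iff hM₀ (isPartialFrame_comp hg u) (u⁻¹ * v) hyp _).1
      (iff_of_true h1 ?_)
    have e : (g ∘ u) ∘ (u⁻¹ * v : Vert.Xi n ≃g Vert.Xi n) = g ∘ v := by
      funext a
      have : u ((u⁻¹ * v) a) = v a := by rw [← aut_mul_apply, mul_inv_cancel_left]
      exact congrArg g this
    rwa [e]

theorem exists_isWeylDistance {M₀ : Set X} (hM₀ : Δ.IsMSS M₀) {I J : Set X} (hI : Δ.IsElement I)
    (hJ : Δ.IsElement J) : ∃ w, Δ.IsWeylDistance M₀ I J w := by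
  have wf : WellFounded ((· < ·) : ℕ∞ → ℕ∞ → Prop) := wellFounded_lt
  obtain ⟨_, ⟨w, hw, rfl⟩, hmin⟩ := wf.has_min
    (wordLength Δ.gens '' Δ.distances M₀ I J) ((distances_nonempty hM₀ hI hJ).image _)
  exact ⟨w, hw, fun w' hw' => not_lt.1 (hmin _ ⟨w', hw', rfl⟩)⟩

/-- Equality of the four types, as a relation between pairs of singular subspaces. -/
def SameTypes (Δ : PolarSpace X n) (M₀ I J I' J' : Set X) : Prop :=
  Δ.type M₀ I = Δ.type M₀ I' ∧ Δ.type M₀ J = Δ.type M₀ J' ∧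
    Δ.type M₀ (I ∩ J) = Δ.type M₀ (I' ∩ J') ∧ Δ.type M₀ (Δ.up I J) = Δ.type M₀ (Δ.up I' J')

/-- Two pairs of singular subspaces of the same types have the same Weyl distances: the
automorphism that matches the cliques of the one with those of the other can be chosen to respect
the types of maximal subspaces, by the condition on `up I J` if this is maximal, and by a sign
change in an unused coordinate otherwise. -/
theorem distances_subset {M₀ : Set X} (hM₀ : Δ.IsMSS M₀) {I J I' J' : Set X} (hI' : I' ∈ Δ.Ω)
    (hJ' : J' ∈ Δ.Ω) (h : Δ.SameTypes M₀ I J I' J') :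
    Δ.distances M₀ I J ⊆ Δ.distances M₀ I' J' := by
  intro w hw
  obtain ⟨K, K', f, hf, hK, hK', rfl, rfl, hwp, hft⟩ := mem_distances_iff.1 hw
  obtain ⟨g, hg, A, B, hA, hB, rfl, rfl⟩ := exists_frame hI' hJ'
  obtain ⟨t1, t2, t3, t4⟩ := h
  have hKc := std_clq hK
  have hLc := clq_image (std_clq hK') w
  have hPc := clq_union_nonOpp hKc hLc
  have hQc := clq_union_nonOpp hA hB
  rw [span_clique_inter hf hKc hLc, span_clique_inter hg hA hB] at t3
  rw [up_span_clique hf hKc hLc, up_span_clique hg hA hB] at t4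
  have r1 := rk_of_type_eq t1
  have r2 := rk_of_type_eq t2
  have r3 := rk_of_type_eq t3
  have r4 := rk_of_type_eq t4
  rw [(span_clique hf hKc).2, (span_clique hg hA).2] at r1
  rw [(span_clique hf hLc).2, (span_clique hg hB).2] at r2
  rw [(span_clique hf (hKc.mono Set.inter_subset_left)).2,
    (span_clique hg (hA.mono Set.inter_subset_left)).2] at r3
  rw [(span_clique hf hPc).2, (span_clique hg hQc).2] at r4
  have hu : ∃ u : Vert.Xi n ≃g Vert.Xi n, u '' K = A ∧ u '' (w '' K') = B ∧
      Δ.IsTyped M₀ (g ∘ u) := by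
    obtain ⟨u, hu1, hu2⟩ := exists_aut hKc hLc hA hB r1 r2 r3 r4
    by_cases hP : n ≤ (K ∪ nonOpp K (w '' K')).ncard
    · refine ⟨u, hu1, hu2, ?_⟩
      have hgu := isPartialFrame_comp hg u
      rw [isTyped_iff hgu]
      intro hyp
      obtain ⟨κ, hκ⟩ := exists_sec hPc hP
      have e : g '' (A ∪ nonOpp A B) = (g ∘ u) '' sec κ := by
        rw [← hκ, Set.image_comp, aut_image_union_nonOpp, hu1, hu2]
      rw [e, hκ, type_eq_iff hyp (rk_span_sec hf κ) (rk_span_sec hgu κ)] at t4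
      have h1 := (isTyped_iff hf).1 hft hyp
      rw [twisted_eq_sec] at h1 ⊢
      have h2 := sameFamily_span_sec hyp hM₀ hf κ fun i => decide ((i : ℕ) + 1 = n)
      have h3 := sameFamily_span_sec hyp hM₀ hgu κ fun i => decide ((i : ℕ) + 1 = n)
      tauto
    · have hi : ∃ i : Fin n, ∀ a ∈ K ∪ nonOpp K (w '' K'), a.1 ≠ i := by
        by_contra hc
        push Not at hc
        refine hP ?_
        have h1 : Prod.fst '' (K ∪ nonOpp K (w '' K')) = Set.univ := by
          ext i
          obtain ⟨a, ha, hai⟩ := hc i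
          simp only [Set.mem_univ, iff_true]
          exact ⟨a, ha, hai⟩
        have h2 := Set.ncard_image_le (f := Prod.fst) (Set.toFinite (K ∪ nonOpp K (w '' K')))
        rwa [h1, Set.ncard_univ, Nat.card_fin] at h2
      obtain ⟨i, hi⟩ := hi
      have hKi : Vert.flip i '' K = K := flip_image_eq_self fun a ha => hi a (.inl ha)
      have hLi : Vert.flip i '' (w '' K') = w '' K' := flip_image_eq_self fun a ha => by
        by_cases h : a.opp ∈ K
        · exact hi a.opp (.inl h)
        · exact hi _ (.inr ⟨ha, h⟩)
      rcases isTyped_or_comp_flip hM₀ (isPartialFrame_comp hg u) i with ht | ht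
      · exact ⟨u, hu1, hu2, ht⟩
      · exact ⟨u * Vert.flip i, by rw [aut_mul_image, hKi, hu1],
          by rw [aut_mul_image, hLi, hu2], ht⟩
  obtain ⟨u, hu1, hu2, hut⟩ := hu
  exact mem_distances_iff.2 ⟨K, K', g ∘ u, isPartialFrame_comp hg u, hK, hK',
    by rw [Set.image_comp, hu1], by rw [Set.image_comp, hu2], hwp, hut⟩

/-- Typed frames realising the same distance between the same standard vertices lead to the same
types. -/
theorem Realizes.sameTypes {M₀ : Set X} (hM₀ : Δ.IsMSS M₀) {w : Vert.Xi n ≃g Vert.Xi n}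
    {K K' : Set (Vert n)} {I J I' J' : Set X} {f g : Vert n → X}
    (h : Δ.Realizes M₀ w K K' I J f) (h' : Δ.Realizes M₀ w K K' I' J' g) :
    Δ.SameTypes M₀ I J I' J' := by
  obtain ⟨hf, hK, hK', rfl, rfl, -, hft⟩ := h
  obtain ⟨hg, -, -, rfl, rfl, -, hgt⟩ := h'
  have hKc := std_clq hK
  have hLc := clq_image (std_clq hK') w
  unfold SameTypes
  rw [span_clique_inter hf hKc hLc, span_clique_inter hg hKc hLc, up_span_clique hf hKc hLc,
    up_span_clique hg hKc hLc]
  exact ⟨type_span_clique hM₀ hf hg hft hgt hKc, type_span_clique hM₀ hf hg hft hgt hLc,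
    type_span_clique hM₀ hf hg hft hgt (hKc.mono Set.inter_subset_left),
    type_span_clique hM₀ hf hg hft hgt (clq_union_nonOpp hKc hLc)⟩

theorem isWeylDistance_weylDistance {M₀ I J : Set X} (h : ∃ w, Δ.IsWeylDistance M₀ I J w) :
    Δ.IsWeylDistance M₀ I J (Δ.weylDistance M₀ I J) := by
  unfold weylDistance
  rw [dif_pos h]
  exact h.choose_spec

open Classical in
theorem weylDistance_congr {M₀ I J I' J' : Set X}
    (h : Δ.distances M₀ I J = Δ.distances M₀ I' J') :
    Δ.weylDistance M₀ I J = Δ.weylDistance M₀ I' J' := by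
  have : Δ.IsWeylDistance M₀ I J = Δ.IsWeylDistance M₀ I' J' := by
    unfold IsWeylDistance
    rw [h]
  have key : ∀ P Q : (Vert.Xi n ≃g Vert.Xi n) → Prop, P = Q →
      (if h : ∃ w, P w then h.choose else 1) = if h : ∃ w, Q w then h.choose else 1 := by
    rintro P _ rfl
    rfl
  exact key _ _ this

end PolarSpace

end

theorem lemma2p1 {X : Type*} {n : ℕ} (Δ : PolarSpace X n) (M₀ : Set X) (hM₀ : Δ.IsMSS M₀)
    (I J I' J' : Set X)
    (hI : Δ.IsElement I) (hJ : Δ.IsElement J) (hI' : Δ.IsElement I') (hJ' : Δ.IsElement J')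
    (hIJ : ¬ Δ.IsFlag {I, J}) (hIJ' : ¬ Δ.IsFlag {I', J'}) :
    (∃ w, Δ.IsWeylDistance M₀ I J w) ∧ (∃ w, Δ.IsWeylDistance M₀ I' J' w) ∧
    (Δ.weylDistance M₀ I J = Δ.weylDistance M₀ I' J' ↔
      Δ.type M₀ I = Δ.type M₀ I' ∧
      Δ.type M₀ J = Δ.type M₀ J' ∧
      Δ.type M₀ (I ∩ J) = Δ.type M₀ (I' ∩ J') ∧
      Δ.type M₀ (Δ.up I J) = Δ.type M₀ (Δ.up I' J')) := by
  have h1 := PolarSpace.exists_isWeylDistance hM₀ hI hJ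
  have h2 := PolarSpace.exists_isWeylDistance hM₀ hI' hJ'
  refine ⟨h1, h2, fun h => ?_, fun h => ?_⟩
  · obtain ⟨hw, hmin⟩ := PolarSpace.isWeylDistance_weylDistance h1
    obtain ⟨hw', hmin'⟩ := PolarSpace.isWeylDistance_weylDistance h2
    rw [← h] at hw' hmin'
    obtain ⟨K, K', f, hr⟩ := PolarSpace.mem_distances_iff.1 hw
    obtain ⟨L, L', g, hr'⟩ := PolarSpace.mem_distances_iff.1 hw'
    have hne : Δ.weylDistance M₀ I J ≠ 1 := fun e => hIJ (by
      rw [e] at hr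
      exact hr.isFlag)
    obtain ⟨rfl, rfl⟩ := hr.eq_of_minimal hM₀ hr' hmin hmin' hne
    exact hr.sameTypes hM₀ hr'
  · refine PolarSpace.weylDistance_congr (Set.Subset.antisymm
      (PolarSpace.distances_subset hM₀ hI'.1 hJ'.1 h)
      (PolarSpace.distances_subset hM₀ hI.1 hJ.1 ?_))
    exact ⟨h.1.symm, h.2.1.symm, h.2.2.1.symm, h.2.2.2.symm⟩
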